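/- Let $M>0$. For $u\in\mathbb R$ let $r(u)\in(2M,\infty)$ be the unique solution of $u=r+2M\log\left(\frac{r}{2M}-1\right)$, and put $$V_0(u)=\Bigl(1-\frac{2M}{r(u)}\Bigr)\frac{2M}{r(u)^3}.$$ For $\omega\in\mathbb R\setminus\{0\}$ let $\grave\phi_\omega(u)=\sum_{k=0}^\infty\phi^{(k)}_\omega(u)$, $u\in\mathbb R$, be the series with $$\phi^{(0)}_\omega(u)=e^{-i\omega u},\qquad \phi^{(k+1)}_\omega(u)=-\int_u^\infty\frac1\omega\sin(\omega(u-v))\,V_0(v)\,\phi^{(k)}_\omega(v)\,dv .$$ Then $\grave\phi_\omega$ is the Jost solution at $+\infty$ for the angular mode $l=0$, that is, it is twice differentiable on $\mathbb R$ and satisfies $$\bigl(-\partial_u^2-\omega^2+V_0(u)\bigr)\grave\phi_\omega(u)=0,\qquad \lim_{u\to+\infty}e^{i\omega u}\grave\phi_\omega(u)=1,\qquad \lim_{u\to+\infty}\bigl(e^{i\omega u}\grave\phi_\omega(u)\bigr)'=0 .$$ Moreover, for every integer $n\ge 3$ and every fixed $u>0$ there are functions $h_0(\cdot,u)$ and $h_{ijk}(\cdot,u)$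 in $C^n(\mathbb R)$ (complex-valued, defined for all $\omega\in\mathbb R$, including $\omega=0$), where $i,j,k$ run through the non-negative integers with $1\le j+k\le i\le n$, such that for all $\omega\in\mathbb R\setminus\{0\}$ the first $u$-derivative of $\grave\phi_\omega$ satisfies $$\grave\phi'_\omega(u)=-i\omega e^{-i\omega u}+h_0(\omega,u)+\sum_{1\le j+k\le i\le n}(2i\omega)^i\,\log^j(2i\omega)\,\log^k(-2i\omega)\,h_{ijk}(\omega,u),$$ where $\log$ is the principal branch of the logarithm. -/

import Mathlib

open Complex Filter Topology MeasureTheory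

noncomputable section

/-- The Regge-Wheeler coordinate `u(r) = r + 2M log (r / (2M) - 1)`, for `r > 2M`. -/
def reggeWheeler (M r : ℝ) : ℝ := r + 2 * M * Real.log (r / (2 * M) - 1)

/-- For `M > 0`, the Regge-Wheeler coordinate is a bijection of `(2M, ∞)` onto the real line. -/
theorem reggeWheeler_bijOn {M : ℝ} (hM : 0 < M) :
    Set.BijOn (reggeWheeler M) (Set.Ioi (2 * M)) Set.univ := by
  have h2 : 0 < 2 * M := by linarith
  have hpos : ∀ r ∈ Set.Ioi (2 * M), 0 < r / (2 * M) - 1 := by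
    intro r hr
    have : 1 < r / (2 * M) := (one_lt_div h2).2 hr
    linarith
  have hmono : StrictMonoOn (reggeWheeler M) (Set.Ioi (2 * M)) := by
    intro a ha b hb hab
    have h1 : a / (2 * M) - 1 < b / (2 * M) - 1 := by
      have := div_lt_div_of_pos_right hab h2
      linarith
    have h3 := mul_lt_mul_of_pos_left (Real.log_lt_log (hpos a ha) h1) h2
    unfold reggeWheeler
    linarith
  have hcont : ContinuousOn (reggeWheeler M) (Set.Ioi (2 * M)) := by
    unfold reggeWheeler
    refine continuousOn_id.add (continuousOn_const.mul (ContinuousOn.log ?_ ?_))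
    · fun_prop
    · intro r hr
      exact (hpos r hr).ne'
  refine ⟨fun _ _ => Set.mem_univ _, hmono.injOn, ?_⟩
  intro u _
  have hval : ∀ y : ℝ, reggeWheeler M (2 * M * (1 + Real.exp y))
      = 2 * M * (1 + Real.exp y + y) := by
    intro y
    unfold reggeWheeler
    have : 2 * M * (1 + Real.exp y) / (2 * M) - 1 = Real.exp y := by
      field_simp
      ring
    rw [this, Real.log_exp]
    ring
  have hmem : ∀ y : ℝ, 2 * M * (1 + Real.exp y) ∈ Set.Ioi (2 * M) := by
    intro y
    have := mul_pos h2 (Real.exp_pos y)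
    simp only [Set.mem_Ioi]
    linarith
  have hu : u = 2 * M * (u / (2 * M)) := by field_simp
  set t := u / (2 * M) with ht
  have hpre : IsPreconnected (Set.Ioi (2 * M)) := isPreconnected_Ioi
  have hlow : reggeWheeler M (2 * M * (1 + Real.exp (-(|t| + 2)))) ≤ u := by
    rw [hval, hu]
    refine mul_le_mul_of_nonneg_left ?_ h2.le
    have h1 : Real.exp (-(|t| + 2)) ≤ 1 := Real.exp_le_one_iff.2 (by linarith [abs_nonneg t])
    linarith [neg_abs_le t]
  have hhigh : u ≤ reggeWheeler M (2 * M * (1 + Real.exp |t|)) := by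
    rw [hval, hu]
    refine mul_le_mul_of_nonneg_left ?_ h2.le
    linarith [Real.exp_pos |t|, le_abs_self t]
  exact hpre.intermediate_value (hmem _) (hmem _) hcont ⟨hlow, hhigh⟩

/-- The Schwarzschild radius `r(u) > 2M` as a function of the Regge-Wheeler coordinate `u`. -/
def radius (M u : ℝ) : ℝ := Function.invFunOn (reggeWheeler M) (Set.Ioi (2 * M)) u

theorem two_mul_lt_radius {M : ℝ} (hM : 0 < M) (u : ℝ) : 2 * M < radius M u :=
  Function.invFunOn_mem ((reggeWheeler_bijOn hM).surjOn (Set.mem_univ u))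

theorem reggeWheeler_radius {M : ℝ} (hM : 0 < M) (u : ℝ) : reggeWheeler M (radius M u) = u :=
  Function.invFunOn_eq ((reggeWheeler_bijOn hM).surjOn (Set.mem_univ u))

/-- The potential `V_l(u) = (1 - 2M/r) (2M/r³ + l(l+1)/r²)`, `r = r(u)`, of the angular mode `l`. -/
def potential (M : ℝ) (l : ℕ) (u : ℝ) : ℝ :=
  (1 - 2 * M / radius M u) * (2 * M / radius M u ^ 3 + l * (l + 1) / radius M u ^ 2)

/-- The iterates of the Jost equation with boundary condition at `+∞`: `φ⁽⁰⁾(u) = e^{-iωu}` and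
`φ⁽ᵏ⁺¹⁾(u) = - ∫_u^∞ (1/ω) sin(ω(u-v)) V(v) φ⁽ᵏ⁾(v) dv`. -/
def jostIterate (V : ℝ → ℝ) (ω : ℝ) : ℕ → ℝ → ℂ
  | 0, u => cexp (-I * ω * u)
  | k + 1, u =>
      -∫ v in Set.Ioi u, ((1 / ω * Real.sin (ω * (u - v)) * V v : ℝ) : ℂ) * jostIterate V ω k v

/-- The Jost solution at `+∞`, as the sum of the iterates. -/
def jostSolution (V : ℝ → ℝ) (ω : ℝ) (u : ℝ) : ℂ := ∑' k, jostIterate V ω k u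

/-- The boundary value problem of the Jost solution at `+∞`, for real `ω ≠ 0`: the equation
`(-∂_u² - ω² + V(u)) φ(u) = 0` on the real line, with `e^{iωu} φ(u) → 1` and
`(e^{iωu} φ(u))' → 0` as `u → +∞`. -/
structure IsJostSolution (V : ℝ → ℝ) (ω : ℝ) (φ : ℝ → ℂ) : Prop where
  differentiable : Differentiable ℝ φ
  differentiable_deriv : Differentiable ℝ (deriv φ)
  schroedinger : ∀ u : ℝ, -deriv (deriv φ) u + (-(ω : ℂ) ^ 2 + V u) * φ u = 0
  tendsto_one : Tendsto (fun u : ℝ => cexp (I * ω * u) * φ u) atTop (𝓝 1)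
  tendsto_deriv_zero :
    Tendsto (deriv fun u : ℝ => cexp (I * ω * u) * φ u) atTop (𝓝 0)

/-- The index triples `(i, j, k)` with `1 ≤ j + k ≤ i ≤ n`. -/
def expansionIndices (n : ℕ) : Finset (ℕ × ℕ × ℕ) :=
  (Finset.range (n + 1) ×ˢ Finset.range (n + 1) ×ˢ Finset.range (n + 1)).filter
    fun p => 1 ≤ p.2.1 + p.2.2 ∧ p.2.1 + p.2.2 ≤ p.1

end

/-! Existence. For `l = 0` the potential is an exact derivative: V₀ = -Q' with Q = M/r² → 0. The
iterated integrals therefore reproduce powers of Q, |φ⁽ᵏ⁾| ≤ (Q/|ω|)ᵏ/k!, and the series and its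
derivatives are dominated by exponential series. Termwise differentiation gives the equation, and
|e^{iωu}φ - 1| ≤ exp(Q/|ω|) - 1 gives the boundary values (`IsTailPotential.isJostSolution`). This
bound degenerates as ω → 0, so the low-frequency expansion needs another representation.

Complexification. With x = 2iωr and a = 4iωM, the function e^{iωu}φ becomes ψ(x, a),
`jostAmplitude`, the solution of a Volterra equation with kernel (1 - e^{P(x) - P(x+t)}) a/(x+t)³.
Here P(s) = s + a log(s - a) is 2iωu up to a constant, and the contour is rotated to x + t, t ≥ 0,
where the exponential is bounded by 1. The equation is a contraction as soon as |a| is small against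
Re x + 2|Im x|, without any lower bound on |ω|, so ψ is holomorphic also at complex frequencies near
the real axis. For real ω a Wronskian argument (`IsSolutionOn.jost_unique`) identifies it with the
Jost series.

Expansion. Put x = e^t and y = a e^{-t}, so that xy = a. The radial equation is a linear system in
t, and an explicit change of unknowns (`hasDerivAt_gauge`) turns it into diag(0, 1) plus a times a
matrix of convergent power series in x and y. Now iterate the integration in t. A monomial xᵐyⁿ is
an eigenvector of ∂_t with eigenvalue m - n, so it integrates to a monomial or, at a resonance, to a
factor t; because of the prefactor a, this factor enters only as a(t - c). The range of t has length
O(|log |a||), hence each round improves the error by a factor a log a (`HasLogExpansion.integrate`).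
At a fixed radius R, with z = 2iω and c = log R, one has x = Rz, y = 2M/R and a(t - c) = 2M z log z.
So ψ is a polynomial in z log z with analytic coefficients up to a small error, which is why logʲ z
comes only with zⁱ, i ≥ j.

Conclusion. The data at R are transported to u by a solution that is entire in ω (`cosineSolution`).
After subtraction of the finitely many zⁱ logʲ z with j ≤ i ≤ n, the remainder is holomorphic on a
double cone around the real ω-axis and O(|ω|^{n+1/2}) at the vertex. Cauchy estimates on discs of
radius proportional to |ω| make it `n` times continuously differentiable through 0
(`contDiff_of_flat`). The coefficients obtained are constants, and log(2iω) alone suffices. -/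

theorem hasDerivAt_setIntegral_Ioi {g : ℝ → ℂ} {a u : ℝ} (hg : IntegrableOn g (Set.Ioi a))
    (hau : a < u) (hc : ContinuousOn g (Set.Ioi a)) :
    HasDerivAt (fun u => ∫ v in Set.Ioi u, g v) (-g u) u := by
  have h1 : HasDerivAt (fun w => (∫ v in Set.Ioi a, g v) - ∫ v in a..w, g v) (-g u) u := by
    have := (intervalIntegral.integral_hasDerivAt_right (f := g) (a := a) (b := u) ?_ ?_ ?_)
    · simpa using this.const_sub (∫ v in Set.Ioi a, g v)
    · rw [intervalIntegrable_iff_integrableOn_Ioc_of_le hau.le]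
      exact hg.mono_set Set.Ioc_subset_Ioi_self
    · exact hc.stronglyMeasurableAtFilter isOpen_Ioi u hau
    · exact hc.continuousAt (Ioi_mem_nhds hau)
  refine h1.congr_of_eventuallyEq ?_
  filter_upwards [Ioi_mem_nhds hau] with w hw
  have hw' : a < w := hw
  rw [← intervalIntegral.integral_interval_add_Ioi' (a := a) (b := w)]
  · ring
  · rw [intervalIntegrable_iff_integrableOn_Ioc_of_le hw'.le]
    exact hg.mono_set Set.Ioc_subset_Ioi_self
  · exact hg.mono_set (Set.Ioi_subset_Ioi hw'.le)

/-! ### The Jost series of a potential with an explicit tail integral -/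

/-- `V` is continuous and non-negative with the antiderivative `-Q`, and `Q → 0` at `+∞`. -/
structure IsTailPotential (V Q : ℝ → ℝ) : Prop where
  continuous : Continuous V
  nonneg : ∀ u, 0 ≤ V u
  hasDerivAt : ∀ u, HasDerivAt Q (-V u) u
  tendsto : Tendsto Q atTop (𝓝 0)

namespace IsTailPotential

variable {V Q : ℝ → ℝ} (hV : IsTailPotential V Q)
include hV

theorem antitone : Antitone Q :=
  antitone_of_deriv_nonpos (fun u => (hV.hasDerivAt u).differentiableAt)
    fun u => by rw [(hV.hasDerivAt u).deriv]; linarith [hV.nonneg u]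

theorem tail_nonneg (u : ℝ) : 0 ≤ Q u :=
  hV.antitone.le_of_tendsto hV.tendsto u

/-- The integrand is the derivative of -(Q/c)^(k+1)/(k+1)!, so integrating against V maps each term
of the exponential series of Q/c to the next one. -/
theorem integrableOn_and_integral {c : ℝ} (hc : 0 < c) (k : ℕ) (u : ℝ) :
    IntegrableOn (fun v => V v / c * ((Q v / c) ^ k / k.factorial)) (Set.Ioi u) ∧
      ∫ v in Set.Ioi u, V v / c * ((Q v / c) ^ k / k.factorial)
        = (Q u / c) ^ (k + 1) / (k + 1).factorial := by
  have hd : ∀ v, HasDerivAt (fun v => -((Q v / c) ^ (k + 1) / (k + 1).factorial))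
      (V v / c * ((Q v / c) ^ k / k.factorial)) v := by
    intro v
    have := ((((hV.hasDerivAt v).div_const c).pow (k + 1)).div_const
      ((k + 1).factorial : ℝ)).neg
    refine this.congr_deriv ?_
    have h1 : ((k : ℝ) + 1) ≠ 0 := by positivity
    have h2 : (k.factorial : ℝ) ≠ 0 := by positivity
    simp only [Nat.factorial_succ, Nat.cast_mul, Nat.cast_add, Nat.cast_one, Nat.add_sub_cancel]
    field_simp
  have ht : Tendsto (fun v => -((Q v / c) ^ (k + 1) / (k + 1).factorial)) atTop (𝓝 0) := by
    have := (((hV.tendsto.div_const c).pow (k + 1)).div_const ((k + 1).factorial : ℝ)).neg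
    simpa using this
  have h0 : ∀ v ∈ Set.Ioi u, 0 ≤ V v / c * ((Q v / c) ^ k / k.factorial) := fun v _ => by
    have := hV.nonneg v
    have := hV.tail_nonneg v
    positivity
  refine ⟨integrableOn_Ioi_deriv_of_nonneg' (fun v _ => hd v) h0 ht, ?_⟩
  rw [integral_Ioi_of_hasDerivAt_of_nonneg' (fun v _ => hd v) h0 ht]
  ring

theorem integrableOn_mul {f g : ℝ → ℂ} {c : ℝ} (hc : 0 < c) (k : ℕ) (hf : Continuous f)
    (hb : ∀ u, ‖f u‖ ≤ (Q u / c) ^ k / k.factorial) (hg : Continuous g) (hg1 : ∀ u, ‖g u‖ ≤ 1)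
    (u : ℝ) : IntegrableOn (fun v => g v * (V v * f v)) (Set.Ioi u) := by
  have hcont : Continuous fun v => g v * ((V v : ℂ) * f v) :=
    hg.mul ((continuous_ofReal.comp hV.continuous).mul hf)
  refine Integrable.mono' ((hV.integrableOn_and_integral hc k u).1.const_mul c)
    hcont.aestronglyMeasurable (Eventually.of_forall fun v => ?_)
  rw [norm_mul, norm_mul, norm_real, Real.norm_eq_abs, abs_of_nonneg (hV.nonneg v)]
  have h3 := mul_le_mul_of_nonneg_left (hb v) (hV.nonneg v)
  have h4 : 0 ≤ V v * ‖f v‖ := mul_nonneg (hV.nonneg v) (norm_nonneg _)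
  calc ‖g v‖ * (V v * ‖f v‖) ≤ 1 * (V v * ‖f v‖) := by gcongr; exact hg1 v
    _ ≤ V v * ((Q v / c) ^ k / k.factorial) := by linarith
    _ = _ := by field_simp

end IsTailPotential

/-- The derivative of `jostIterate`. -/
noncomputable def jostIterateDeriv (V : ℝ → ℝ) (ω : ℝ) : ℕ → ℝ → ℂ
  | 0, u => -I * ω * cexp (-I * ω * u)
  | k + 1, u => -∫ v in Set.Ioi u, (Real.cos (ω * (u - v)) : ℂ) * (V v * jostIterate V ω k v)

/-- The second derivative of `jostIterate`. -/
noncomputable def jostIterateDeriv₂ (V : ℝ → ℝ) (ω : ℝ) : ℕ → ℝ → ℂ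
  | 0, u => -ω ^ 2 * jostIterate V ω 0 u
  | k + 1, u => -ω ^ 2 * jostIterate V ω (k + 1) u + V u * jostIterate V ω k u

section Kernel

variable {f : ℝ → ℂ} {ω : ℝ}
  (hi : ∀ g : ℝ → ℂ, Continuous g → (∀ u, ‖g u‖ ≤ 1) → ∀ u, IntegrableOn (fun v => g v * f v)
    (Set.Ioi u))
include hi

/-- The addition formula separates `u` from `v`; the `u`-derivative then needs only the product rule
and the fundamental theorem, with no differentiation under the integral sign. -/
theorem integral_sin_kernel (u : ℝ) :
    ∫ v in Set.Ioi u, (Real.sin (ω * (u - v)) : ℂ) * f v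
      = Real.sin (ω * u) * (∫ v in Set.Ioi u, (Real.cos (ω * v) : ℂ) * f v)
        - Real.cos (ω * u) * ∫ v in Set.Ioi u, (Real.sin (ω * v) : ℂ) * f v := by
  have hs := hi (fun v => (Real.sin (ω * v) : ℂ)) (by fun_prop)
    (fun v => by rw [norm_real]; exact Real.abs_sin_le_one _) u
  have hc := hi (fun v => (Real.cos (ω * v) : ℂ)) (by fun_prop)
    (fun v => by rw [norm_real]; exact Real.abs_cos_le_one _) u
  rw [← integral_const_mul, ← integral_const_mul,
    ← integral_sub (hc.const_mul _) (hs.const_mul _)]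
  refine integral_congr_ae (Eventually.of_forall fun v => ?_)
  simp only [mul_sub, Real.sin_sub]
  push_cast
  ring

theorem integral_cos_kernel (u : ℝ) :
    ∫ v in Set.Ioi u, (Real.cos (ω * (u - v)) : ℂ) * f v
      = Real.cos (ω * u) * (∫ v in Set.Ioi u, (Real.cos (ω * v) : ℂ) * f v)
        + Real.sin (ω * u) * ∫ v in Set.Ioi u, (Real.sin (ω * v) : ℂ) * f v := by
  have hs := hi (fun v => (Real.sin (ω * v) : ℂ)) (by fun_prop)
    (fun v => by rw [norm_real]; exact Real.abs_sin_le_one _) u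
  have hc := hi (fun v => (Real.cos (ω * v) : ℂ)) (by fun_prop)
    (fun v => by rw [norm_real]; exact Real.abs_cos_le_one _) u
  rw [← integral_const_mul, ← integral_const_mul,
    ← integral_add (hc.const_mul _) (hs.const_mul _)]
  refine integral_congr_ae (Eventually.of_forall fun v => ?_)
  simp only [mul_sub, Real.cos_sub]
  push_cast
  ring

theorem hasDerivAt_integral_trig (hf : Continuous f) (u : ℝ) :
    HasDerivAt (fun u => ∫ v in Set.Ioi u, (Real.cos (ω * v) : ℂ) * f v)
        (-(Real.cos (ω * u) * f u)) u ∧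
      HasDerivAt (fun u => ∫ v in Set.Ioi u, (Real.sin (ω * v) : ℂ) * f v)
        (-(Real.sin (ω * u) * f u)) u := by
  have hs := hi (fun v => (Real.sin (ω * v) : ℂ)) (by fun_prop)
    (fun v => by rw [norm_real]; exact Real.abs_sin_le_one _) (u - 1)
  have hc := hi (fun v => (Real.cos (ω * v) : ℂ)) (by fun_prop)
    (fun v => by rw [norm_real]; exact Real.abs_cos_le_one _) (u - 1)
  exact ⟨hasDerivAt_setIntegral_Ioi hc (by linarith) (by fun_prop),
    hasDerivAt_setIntegral_Ioi hs (by linarith) (by fun_prop)⟩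

theorem hasDerivAt_integral_kernel (hf : Continuous f) (u : ℝ) :
    HasDerivAt (fun u => ∫ v in Set.Ioi u, (Real.sin (ω * (u - v)) : ℂ) * f v)
        (ω * ∫ v in Set.Ioi u, (Real.cos (ω * (u - v)) : ℂ) * f v) u ∧
      HasDerivAt (fun u => ∫ v in Set.Ioi u, (Real.cos (ω * (u - v)) : ℂ) * f v)
        (-(ω * ∫ v in Set.Ioi u, (Real.sin (ω * (u - v)) : ℂ) * f v) - f u) u := by
  obtain ⟨hC, hS⟩ := hasDerivAt_integral_trig (ω := ω) hi hf u
  have h0 : HasDerivAt (fun u : ℝ => ω * u) ω u := by simpa using (hasDerivAt_id u).const_mul ω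
  have hsin : HasDerivAt (fun u : ℝ => (Real.sin (ω * u) : ℂ)) (Real.cos (ω * u) * ω : ℝ) u :=
    h0.sin.ofReal_comp
  have hcos : HasDerivAt (fun u : ℝ => (Real.cos (ω * u) : ℂ)) (-Real.sin (ω * u) * ω : ℝ) u :=
    h0.cos.ofReal_comp
  have hsc : ((Real.sin (ω * u) : ℂ)) ^ 2 + (Real.cos (ω * u) : ℂ) ^ 2 = 1 := by
    exact_mod_cast Real.sin_sq_add_cos_sq (ω * u)
  constructor
  · refine (((hsin.mul hC).sub (hcos.mul hS)).congr_of_eventuallyEq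
      (Eventually.of_forall fun v => integral_sin_kernel hi v)).congr_deriv ?_
    rw [integral_cos_kernel hi]
    push_cast
    ring
  · refine (((hcos.mul hC).add (hsin.mul hS)).congr_of_eventuallyEq
      (Eventually.of_forall fun v => integral_cos_kernel hi v)).congr_deriv ?_
    rw [integral_sin_kernel hi]
    push_cast at hsc ⊢
    linear_combination (-f u) * hsc

end Kernel

namespace IsTailPotential

variable {V Q : ℝ → ℝ} (hV : IsTailPotential V Q) {ω : ℝ} (hω : ω ≠ 0)
include hV hω

omit hV hω in
theorem jostIterate_succ (k : ℕ) (u : ℝ) : jostIterate V ω (k + 1) u =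
    -(1 / ω * ∫ v in Set.Ioi u, (Real.sin (ω * (u - v)) : ℂ) * (V v * jostIterate V ω k v)) := by
  rw [jostIterate, ← integral_const_mul]
  congr 2
  funext v
  push_cast
  ring

omit hω in
theorem norm_integral_kernel_le {f g : ℝ → ℂ} {c : ℝ} (hc : 0 < c) (k : ℕ)
    (hb : ∀ u, ‖f u‖ ≤ (Q u / c) ^ k / k.factorial) (hg1 : ∀ u, ‖g u‖ ≤ 1) (u : ℝ) :
    ‖∫ v in Set.Ioi u, g v * (V v * f v)‖ ≤ c * ((Q u / c) ^ (k + 1) / (k + 1).factorial) := by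
  obtain ⟨h1, h2⟩ := hV.integrableOn_and_integral hc k u
  rw [← h2, ← integral_const_mul]
  refine norm_integral_le_of_norm_le (h1.const_mul c) (Eventually.of_forall fun v => ?_)
  rw [norm_mul, norm_mul, norm_real, Real.norm_eq_abs, abs_of_nonneg (hV.nonneg v)]
  have h3 := mul_le_mul_of_nonneg_left (hb v) (hV.nonneg v)
  have h4 : 0 ≤ V v * ‖f v‖ := mul_nonneg (hV.nonneg v) (norm_nonneg _)
  calc ‖g v‖ * (V v * ‖f v‖) ≤ 1 * (V v * ‖f v‖) := by gcongr; exact hg1 v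
    _ ≤ V v * ((Q v / c) ^ k / k.factorial) := by linarith
    _ = _ := by field_simp

omit hω hV in
theorem norm_exp_neg_I_mul (u : ℝ) : ‖cexp (-I * ω * u)‖ = 1 := by
  have : -I * ω * u = ((-(ω * u) : ℝ) : ℂ) * I := by push_cast; ring
  rw [this, norm_exp_ofReal_mul_I]

/-- Continuity and the bound are proved together, since integrability of the next integrand uses
both. The factor `c = |ω|` lost in `norm_integral_kernel_le` cancels the prefactor 1/ω. -/
theorem jostIterate_bound (k : ℕ) : Continuous (jostIterate V ω k) ∧
    ∀ u, ‖jostIterate V ω k u‖ ≤ (Q u / |ω|) ^ k / k.factorial := by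
  have hc : 0 < |ω| := abs_pos.2 hω
  induction k with
  | zero =>
    refine ⟨?_, fun u => ?_⟩
    · have : jostIterate V ω 0 = fun u : ℝ => cexp (-I * ω * u) := by funext; rw [jostIterate]
      rw [this]
      fun_prop
    · rw [jostIterate, norm_exp_neg_I_mul]
      simp
  | succ k ih =>
    have hi := fun g hg hg1 u => hV.integrableOn_mul hc k ih.1 ih.2 (g := g) hg hg1 u
    have hf : Continuous fun v => (V v : ℂ) * jostIterate V ω k v :=
      (continuous_ofReal.comp hV.continuous).mul ih.1
    refine ⟨?_, fun u => ?_⟩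
    · refine Continuous.congr ?_ fun u => (jostIterate_succ k u).symm
      refine (continuous_const.mul ?_).neg
      exact continuous_iff_continuousAt.2 fun u =>
        (hasDerivAt_integral_kernel (ω := ω) hi hf u).1.continuousAt
    · rw [jostIterate_succ, norm_neg, norm_mul]
      have := hV.norm_integral_kernel_le hc k ih.2
        (g := fun v => (Real.sin (ω * (u - v)) : ℂ))
        (fun v => by rw [norm_real]; exact Real.abs_sin_le_one _) u
      have h1 : ‖(1 : ℂ) / ω‖ = 1 / |ω| := by simp
      rw [h1]
      calc _ ≤ 1 / |ω| * (|ω| * ((Q u / |ω|) ^ (k + 1) / (k + 1).factorial)) := by gcongr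
        _ = _ := by field_simp

theorem hasDerivAt_jostIterate (k : ℕ) (u : ℝ) :
    HasDerivAt (jostIterate V ω k) (jostIterateDeriv V ω k u) u ∧
      HasDerivAt (jostIterateDeriv V ω k) (jostIterateDeriv₂ V ω k u) u ∧
      ‖jostIterateDeriv V ω k u‖ ≤ |ω| * ((Q u / |ω|) ^ k / k.factorial) := by
  have hc : 0 < |ω| := abs_pos.2 hω
  have hω' : (ω : ℂ) ≠ 0 := ofReal_ne_zero.2 hω
  cases k with
  | zero =>
    have h0 : HasDerivAt (fun u : ℝ => -I * ω * (u : ℂ)) (-I * ω) u := by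
      simpa using (hasDerivAt_id (u : ℝ)).ofReal_comp.const_mul (-I * (ω : ℂ))
    have h1 := h0.cexp
    refine ⟨?_, ?_, ?_⟩
    · have : jostIterate V ω 0 = fun u : ℝ => cexp (-I * ω * u) := by funext; rw [jostIterate]
      rw [this, jostIterateDeriv]
      exact h1.congr_deriv (by ring)
    · have : jostIterateDeriv V ω 0 = fun u : ℝ => -I * ω * cexp (-I * ω * u) := by
        funext; rw [jostIterateDeriv]
      rw [this, jostIterateDeriv₂, jostIterate]
      refine (h1.const_mul (-I * ω)).congr_deriv ?_
      linear_combination (ω ^ 2 * cexp (-I * ω * u)) * I_sq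
    · rw [jostIterateDeriv, norm_mul, norm_exp_neg_I_mul]
      simp
  | succ k =>
    have ih := hV.jostIterate_bound hω k
    have hi := fun g hg hg1 u => hV.integrableOn_mul hc k ih.1 ih.2 (g := g) hg hg1 u
    have hf : Continuous fun v => (V v : ℂ) * jostIterate V ω k v :=
      (continuous_ofReal.comp hV.continuous).mul ih.1
    obtain ⟨h1, h2⟩ := hasDerivAt_integral_kernel (ω := ω) hi hf u
    refine ⟨?_, ?_, ?_⟩
    · refine ((h1.const_mul (1 / (ω : ℂ))).neg.congr_of_eventuallyEq
        (Eventually.of_forall fun v => jostIterate_succ k v)).congr_deriv ?_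
      rw [jostIterateDeriv]
      field_simp
    · have : jostIterateDeriv V ω (k + 1) = fun u => -∫ v in Set.Ioi u,
          (Real.cos (ω * (u - v)) : ℂ) * (V v * jostIterate V ω k v) := by
        funext; rw [jostIterateDeriv]
      rw [this, jostIterateDeriv₂, jostIterate_succ]
      refine h2.neg.congr_deriv ?_
      field_simp
      ring
    · rw [jostIterateDeriv, norm_neg]
      exact hV.norm_integral_kernel_le hc k ih.2
        (g := fun v => (Real.cos (ω * (u - v)) : ℂ))
        (fun v => by rw [norm_real]; exact Real.abs_cos_le_one _) u

theorem summable_jostIterate (u : ℝ) : Summable fun k => jostIterate V ω k u :=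
  Summable.of_norm_bounded (Real.summable_pow_div_factorial _)
    fun k => (hV.jostIterate_bound hω k).2 u

theorem summable_jostIterateDeriv (u : ℝ) : Summable fun k => jostIterateDeriv V ω k u :=
  Summable.of_norm_bounded ((Real.summable_pow_div_factorial _).mul_left |ω|)
    fun k => (hV.hasDerivAt_jostIterate hω k u).2.2

omit hω in
theorem pow_div_factorial_le {u v : ℝ} (huv : u ≤ v) (k : ℕ) :
    (Q v / |ω|) ^ k / k.factorial ≤ (Q u / |ω|) ^ k / k.factorial := by
  have := hV.tail_nonneg v
  have := hV.antitone huv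
  gcongr

theorem hasDerivAt_jostSolution (u : ℝ) :
    HasDerivAt (jostSolution V ω) (∑' k, jostIterateDeriv V ω k u) u := by
  refine hasDerivAt_tsum_of_isPreconnected (t := Set.Ioi (u - 1)) (y₀ := u)
    ((Real.summable_pow_div_factorial (Q (u - 1) / |ω|)).mul_left |ω|) isOpen_Ioi
    isPreconnected_Ioi (fun k v _ => (hV.hasDerivAt_jostIterate hω k v).1) (fun k v hv => ?_)
    (by simp) (hV.summable_jostIterate hω u) (by simp)
  refine (hV.hasDerivAt_jostIterate hω k v).2.2.trans ?_
  gcongr _ * ?_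
  exact hV.pow_div_factorial_le (le_of_lt hv) k

/-- Each second derivative is -ω² times the same iterate plus V times the previous one; the index
shift in the second part returns the whole series, as the zeroth iterate has no such part. -/
theorem tsum_jostIterateDeriv₂ (u : ℝ) : HasSum (fun k => jostIterateDeriv₂ V ω k u)
    ((-(ω : ℂ) ^ 2 + V u) * jostSolution V ω u) := by
  have hs := hV.summable_jostIterate hω u
  have h1 : HasSum (fun k => -(ω : ℂ) ^ 2 * jostIterate V ω k u)
      (-(ω : ℂ) ^ 2 * jostSolution V ω u) := hs.hasSum.mul_left _
  have h2 : HasSum (fun k => jostIterateDeriv₂ V ω k u - -(ω : ℂ) ^ 2 * jostIterate V ω k u)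
      (V u * jostSolution V ω u) := by
    rw [← hasSum_nat_add_iff' 1]
    simp only [Finset.range_one, Finset.sum_singleton, jostIterateDeriv₂, sub_self, sub_zero]
    refine (hs.hasSum.mul_left (V u : ℂ)).congr_fun fun k => ?_
    ring
  have h3 := h1.add h2
  rw [← add_mul] at h3
  simpa using h3

theorem hasDerivAt_tsum_jostIterateDeriv (hVb : ∃ B, ∀ u, V u ≤ B) (u : ℝ) :
    HasDerivAt (fun u => ∑' k, jostIterateDeriv V ω k u)
      ((-(ω : ℂ) ^ 2 + V u) * jostSolution V ω u) u := by
  obtain ⟨B, hB⟩ := hVb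
  rw [← (hV.tsum_jostIterateDeriv₂ hω u).tsum_eq]
  set b : ℕ → ℝ := fun k => (Q (u - 1) / |ω|) ^ k / k.factorial with hb
  have hbs : Summable b := Real.summable_pow_div_factorial _
  have hb0 : ∀ k, 0 ≤ b k := fun k => by
    have := hV.tail_nonneg (u - 1)
    positivity
  have hB0 : 0 ≤ B := (hV.nonneg u).trans (hB u)
  refine hasDerivAt_tsum_of_isPreconnected (t := Set.Ioi (u - 1)) (y₀ := u)
    -- At `k = 0` truncated subtraction makes the second summand `B * b 0`; it is superfluous there
    -- but only enlarges the bound.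
    (u := fun k => ω ^ 2 * b k + B * b (k - 1)) ?_ isOpen_Ioi
    isPreconnected_Ioi (fun k v _ => (hV.hasDerivAt_jostIterate hω k v).2.1) (fun k v hv => ?_)
    (by simp) (hV.summable_jostIterateDeriv hω u) (by simp)
  · refine (hbs.mul_left _).add (Summable.mul_left B ?_)
    rw [← summable_nat_add_iff 1]
    simpa using hbs
  · have hbd : ∀ k, ‖jostIterate V ω k v‖ ≤ b k := fun k =>
      ((hV.jostIterate_bound hω k).2 v).trans (hV.pow_div_factorial_le (le_of_lt hv) k)
    have h2 : ‖-(ω : ℂ) ^ 2‖ = ω ^ 2 := by simp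
    cases k with
    | zero =>
      rw [jostIterateDeriv₂, norm_mul, h2]
      have := mul_le_mul_of_nonneg_left (hbd 0) (sq_nonneg ω)
      have := mul_nonneg hB0 (hb0 (0 - 1))
      linarith
    | succ k =>
      rw [jostIterateDeriv₂, Nat.add_sub_cancel]
      refine (norm_add_le _ _).trans ?_
      rw [norm_mul, norm_mul, h2, norm_real, Real.norm_eq_abs, abs_of_nonneg (hV.nonneg v)]
      have := hbd k
      have := hbd (k + 1)
      have := hB v
      gcongr

omit hV hω in
theorem norm_tsum_succ_le {f : ℕ → ℂ} {c x : ℝ} (hf : ∀ k, ‖f k‖ ≤ c * (x ^ k / k.factorial)) :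
    ‖∑' k, f k - f 0‖ ≤ c * (Real.exp x - 1) := by
  have hs : Summable f := Summable.of_norm_bounded
    ((Real.summable_pow_div_factorial x).mul_left c) hf
  have he : HasSum (fun k : ℕ => x ^ k / (k.factorial : ℝ)) (Real.exp x) := by
    rw [Real.exp_eq_exp_ℝ]
    exact NormedSpace.expSeries_div_hasSum_exp x
  have h1 : HasSum (fun k : ℕ => c * (x ^ (k + 1) / ((k + 1).factorial : ℝ)))
      (c * (Real.exp x - 1)) := by
    have := (hasSum_nat_add_iff' 1).2 he
    simpa using this.mul_left c
  have h2 : ∑' k, f k - f 0 = ∑' k, f (k + 1) := by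
    rw [hs.tsum_eq_zero_add]; ring
  rw [h2]
  exact tsum_of_norm_bounded h1 fun k => hf (k + 1)

theorem isJostSolution (hVb : ∃ B, ∀ u, V u ≤ B) : IsJostSolution V ω (jostSolution V ω) := by
  have hd := hV.hasDerivAt_jostSolution hω
  have hd2 := hV.hasDerivAt_tsum_jostIterateDeriv hω hVb
  have hderiv : deriv (jostSolution V ω) = fun u => ∑' k, jostIterateDeriv V ω k u :=
    funext fun u => (hd u).deriv
  have hexp : ∀ u : ℝ, cexp (I * ω * u) * cexp (-I * ω * u) = 1 := fun u => by
    rw [← Complex.exp_add]; simp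
  have hnorm : ∀ u : ℝ, ‖cexp (I * ω * u)‖ = 1 := fun u => by
    have : I * ω * u = ((ω * u : ℝ) : ℂ) * I := by push_cast; ring
    rw [this, norm_exp_ofReal_mul_I]
  have hlim : Tendsto (fun u => Real.exp (Q u / |ω|) - 1) atTop (𝓝 0) := by
    have := (Real.continuous_exp.tendsto _).comp (hV.tendsto.div_const |ω|)
    simpa using this.sub_const 1
  have hb1 : ∀ u, ‖jostSolution V ω u - jostIterate V ω 0 u‖ ≤ Real.exp (Q u / |ω|) - 1 := fun u => by
    have := norm_tsum_succ_le (f := fun k => jostIterate V ω k u) (c := 1)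
      (x := Q u / |ω|) fun k => by simpa using (hV.jostIterate_bound hω k).2 u
    simpa [jostSolution] using this
  have hb2 : ∀ u, ‖∑' k, jostIterateDeriv V ω k u - jostIterateDeriv V ω 0 u‖
      ≤ |ω| * (Real.exp (Q u / |ω|) - 1) := fun u =>
    norm_tsum_succ_le fun k => (hV.hasDerivAt_jostIterate hω k u).2.2
  refine ⟨fun u => (hd u).differentiableAt, ?_, fun u => ?_, ?_, ?_⟩
  · rw [hderiv]
    exact fun u => (hd2 u).differentiableAt
  · rw [hderiv, (hd2 u).deriv]
    ring
  · rw [tendsto_iff_norm_sub_tendsto_zero]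
    refine squeeze_zero (fun _ => norm_nonneg _) (fun u => ?_) hlim
    have : cexp (I * ω * u) * jostSolution V ω u - 1
        = cexp (I * ω * u) * (jostSolution V ω u - jostIterate V ω 0 u) := by
      rw [jostIterate, mul_sub, hexp]
    rw [this, norm_mul, hnorm, one_mul]
    exact hb1 u
  · have hd3 : ∀ u : ℝ, HasDerivAt (fun u : ℝ => cexp (I * ω * u) * jostSolution V ω u)
        (cexp (I * ω * u) * (I * ω) * jostSolution V ω u
          + cexp (I * ω * u) * ∑' k, jostIterateDeriv V ω k u) u := fun u => by
      have h0 : HasDerivAt (fun u : ℝ => I * ω * (u : ℂ)) (I * ω) u := by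
        simpa using (hasDerivAt_id (u : ℝ)).ofReal_comp.const_mul (I * (ω : ℂ))
      exact h0.cexp.mul (hd u)
    have : deriv (fun u : ℝ => cexp (I * ω * u) * jostSolution V ω u) = fun u : ℝ =>
        cexp (I * ω * u) * (I * ω) * (jostSolution V ω u - jostIterate V ω 0 u)
          + cexp (I * ω * u) * (∑' k, jostIterateDeriv V ω k u - jostIterateDeriv V ω 0 u) := by
      funext u
      rw [(hd3 u).deriv, jostIterate, jostIterateDeriv]
      ring
    rw [this, tendsto_zero_iff_norm_tendsto_zero]
    refine squeeze_zero (g := fun u => 2 * |ω| * (Real.exp (Q u / |ω|) - 1))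
      (fun _ => norm_nonneg _) (fun u => ?_) ?_
    · refine (norm_add_le _ _).trans ?_
      simp only [norm_mul, hnorm, norm_I, norm_real, Real.norm_eq_abs, one_mul]
      have := mul_le_mul_of_nonneg_left (hb1 u) (abs_nonneg ω)
      linarith [hb2 u]
    · simpa using hlim.const_mul (2 * |ω|)

end IsTailPotential

/-! ### The radius as a function of the Regge-Wheeler coordinate, and the potential for l = 0 -/

section Radius

variable {M : ℝ} (hM : 0 < M)
include hM

theorem hasDerivAt_reggeWheeler {r : ℝ} (hr : 2 * M < r) :
    HasDerivAt (reggeWheeler M) (1 - 2 * M / r)⁻¹ r := by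
  have h2 : 0 < 2 * M := by linarith
  have h0 : 0 < r / (2 * M) - 1 := by
    have : 1 < r / (2 * M) := (one_lt_div h2).2 hr
    linarith
  have h := (hasDerivAt_id r).add
    (((((hasDerivAt_id r).div_const (2 * M)).sub_const 1).log h0.ne').const_mul (2 * M))
  refine h.congr_deriv ?_
  have h3 : r - 2 * M ≠ 0 := by linarith
  have h4 : r ≠ 0 := by linarith
  have h5 : r / (2 * M) - 1 = (r - 2 * M) / (2 * M) := by field_simp
  have h6 : 1 - 2 * M / r = (r - 2 * M) / r := by field_simp
  simp only [id]
  rw [h5, h6]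
  field_simp
  ring

theorem radius_pos (u : ℝ) : 0 < radius M u := by
  have := two_mul_lt_radius hM u
  linarith

theorem strictMonoOn_reggeWheeler : StrictMonoOn (reggeWheeler M) (Set.Ioi (2 * M)) := by
  refine strictMonoOn_of_deriv_pos (convex_Ioi _)
    (fun r hr => (hasDerivAt_reggeWheeler hM hr).continuousAt.continuousWithinAt) fun r hr => ?_
  rw [interior_Ioi] at hr
  have hr' : 2 * M < r := hr
  rw [(hasDerivAt_reggeWheeler hM hr).deriv, inv_pos, sub_pos, div_lt_one (by linarith)]
  exact hr

theorem radius_reggeWheeler {r : ℝ} (hr : 2 * M < r) : radius M (reggeWheeler M r) = r :=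
  (strictMonoOn_reggeWheeler hM).injOn (two_mul_lt_radius hM _) hr (reggeWheeler_radius hM _)

theorem strictMono_radius : StrictMono (radius M) := fun u v huv => by
  rw [← (strictMonoOn_reggeWheeler hM).lt_iff_lt (two_mul_lt_radius hM u)
    (two_mul_lt_radius hM v), reggeWheeler_radius hM, reggeWheeler_radius hM]
  exact huv

theorem hasDerivAt_radius (u : ℝ) : HasDerivAt (radius M) (1 - 2 * M / radius M u) u := by
  have hr := two_mul_lt_radius hM u
  have hc : ContinuousAt (radius M) u := by
    refine continuousAt_of_monotoneOn_of_image_mem_nhds (s := Set.univ)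
      ((strictMono_radius hM).monotone.monotoneOn _) univ_mem ?_
    refine mem_of_superset (Ioi_mem_nhds hr) fun r hr' => ?_
    exact ⟨reggeWheeler M r, Set.mem_univ _, radius_reggeWheeler hM hr'⟩
  have h1 : (1 - 2 * M / radius M u) ≠ 0 := by
    rw [sub_ne_zero, ne_comm, Ne, div_eq_one_iff_eq (by linarith)]
    exact hr.ne
  have := HasDerivAt.of_local_left_inverse hc (hasDerivAt_reggeWheeler hM hr) (inv_ne_zero h1)
    (Eventually.of_forall fun v => reggeWheeler_radius hM v)
  rwa [inv_inv] at this

theorem le_two_mul_radius (u : ℝ) : u ≤ 2 * radius M u := by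
  have hr := two_mul_lt_radius hM u
  have h2 : 0 < 2 * M := by linarith
  have h0 : 0 < radius M u / (2 * M) - 1 := by
    have : 1 < radius M u / (2 * M) := (one_lt_div h2).2 hr
    linarith
  have h1 := mul_le_mul_of_nonneg_left (Real.log_le_sub_one_of_pos h0) h2.le
  have h3 : 2 * M * (radius M u / (2 * M) - 1 - 1) = radius M u - 4 * M := by
    field_simp; ring
  have h4 := reggeWheeler_radius hM u
  unfold reggeWheeler at h4
  linarith

theorem tendsto_radius : Tendsto (radius M) atTop atTop :=
  tendsto_atTop_mono (f := fun u => u / 2) (fun u => by linarith [le_two_mul_radius hM u])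
    (tendsto_id.atTop_div_const two_pos)

omit hM in
theorem potential_zero (u : ℝ) :
    potential M 0 u = (1 - 2 * M / radius M u) * (2 * M / radius M u ^ 3) := by
  simp [potential]

/-- From r' = 1 - 2M/r one gets (M/r²)' = -(1 - 2M/r) 2M/r³, which is exactly -V₀. -/
theorem isTailPotential_potential :
    IsTailPotential (potential M 0) (fun u => M / radius M u ^ 2) := by
  have hr0 : ∀ u, radius M u ≠ 0 := fun u => (radius_pos hM u).ne'
  have hc : Continuous (radius M) :=
    continuous_iff_continuousAt.2 fun u => (hasDerivAt_radius hM u).continuousAt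
  refine ⟨?_, fun u => ?_, fun u => ?_, ?_⟩
  · rw [funext (potential_zero (M := M))]
    exact (continuous_const.sub (continuous_const.div hc hr0)).mul
      (continuous_const.div (hc.pow 3) fun u => pow_ne_zero _ (hr0 u))
  · rw [potential_zero]
    have := two_mul_lt_radius hM u
    have h0 := radius_pos hM u
    have : 0 ≤ 1 - 2 * M / radius M u := by
      rw [sub_nonneg, div_le_one h0]; exact this.le
    positivity
  · have := ((hasDerivAt_radius hM u).pow 2).inv (pow_ne_zero 2 (hr0 u)) |>.const_mul M
    refine (this.congr_of_eventuallyEq (Eventually.of_forall fun v => ?_)).congr_deriv ?_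
    · simp [div_eq_mul_inv]
    · rw [potential_zero]
      have := hr0 u
      simp only [Nat.cast_ofNat, Pi.pow_apply]
      field_simp
      ring
  · exact Tendsto.div_atTop tendsto_const_nhds
      ((tendsto_pow_atTop two_ne_zero).comp (tendsto_radius hM))

theorem potential_zero_le (u : ℝ) : potential M 0 u ≤ 2 * M / (2 * M) ^ 3 := by
  rw [potential_zero]
  have h1 := two_mul_lt_radius hM u
  have h0 := radius_pos hM u
  have h2 : 1 - 2 * M / radius M u ≤ 1 := by
    have : 0 ≤ 2 * M / radius M u := by positivity
    linarith
  calc _ ≤ 1 * (2 * M / radius M u ^ 3) := by gcongr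
    _ ≤ 2 * M / (2 * M) ^ 3 := by rw [one_mul]; gcongr

end Radius

/-! ### Wronskians and uniqueness of the Jost solution -/

/-- A solution of `f'' = W f` on `(u₀, ∞)`, with derivative `f'`. -/
def IsSolutionOn (W : ℝ → ℂ) (u₀ : ℝ) (f f' : ℝ → ℂ) : Prop :=
  ∀ u, u₀ < u → HasDerivAt f (f' u) u ∧ HasDerivAt f' (W u * f u) u

theorem IsSolutionOn.wronskian_tendsto {W : ℝ → ℂ} {u₀ : ℝ} {f f' g g' : ℝ → ℂ} {w : ℂ}
    (hf : IsSolutionOn W u₀ f f') (hg : IsSolutionOn W u₀ g g')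
    (hw : Tendsto (fun u => f u * g' u - f' u * g u) atTop (𝓝 w)) {u : ℝ} (hu : u₀ < u) :
    f u * g' u - f' u * g u = w := by
  have hd : ∀ v ∈ Set.Ioi u₀, HasDerivAt (fun u => f u * g' u - f' u * g u) 0 v := fun v hv => by
    have := ((hf v hv).1.mul (hg v hv).2).sub ((hf v hv).2.mul (hg v hv).1)
    exact this.congr_deriv (by ring)
  have hconst : ∀ v, u₀ < v → f v * g' v - f' v * g v = f u * g' u - f' u * g u := fun v hv =>
    isOpen_Ioi.is_const_of_deriv_eq_zero (𝕜 := ℝ) isPreconnected_Ioi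
      (fun x hx => (hd x hx).differentiableAt.differentiableWithinAt)
      (fun x hx => (hd x hx).deriv) hv hu
  refine tendsto_nhds_unique (Tendsto.congr' ?_ tendsto_const_nhds) hw
  filter_upwards [eventually_gt_atTop u₀] with v hv
  exact (hconst v hv).symm

/-- A solution of `f'' = (V - ω²) f` on `(u₀, ∞)` is determined by its Jost boundary values. -/
theorem IsSolutionOn.jost_unique {V : ℝ → ℝ} {ω u₀ : ℝ} (hω : ω ≠ 0) {f f' g g' : ℝ → ℂ}
    (hf : IsSolutionOn (fun u => -(ω : ℂ) ^ 2 + V u) u₀ f f')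
    (hg : IsSolutionOn (fun u => -(ω : ℂ) ^ 2 + V u) u₀ g g')
    (hf0 : Tendsto (fun u : ℝ => cexp (I * ω * u) * f u) atTop (𝓝 1))
    (hf1 : Tendsto (fun u : ℝ => cexp (I * ω * u) * f' u) atTop (𝓝 (-I * ω)))
    (hg0 : Tendsto (fun u : ℝ => cexp (I * ω * u) * g u) atTop (𝓝 1))
    (hg1 : Tendsto (fun u : ℝ => cexp (I * ω * u) * g' u) atTop (𝓝 (-I * ω)))
    {u : ℝ} (hu : u₀ < u) : f u = g u ∧ f' u = g' u := by
  have hE : ∀ u : ℝ, cexp (I * ω * u) * (starRingEnd ℂ) (cexp (I * ω * u)) = 1 := fun u => by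
    rw [← Complex.exp_conj, ← Complex.exp_add]
    simp
  have hd : IsSolutionOn (fun u => -(ω : ℂ) ^ 2 + V u) u₀ (fun u => f u - g u)
      (fun u => f' u - g' u) := fun v hv =>
    ⟨(hf v hv).1.sub (hg v hv).1, ((hf v hv).2.sub (hg v hv).2).congr_deriv (by ring)⟩
  have hc : IsSolutionOn (fun u => -(ω : ℂ) ^ 2 + V u) u₀ (fun u => (starRingEnd ℂ) (f u))
      (fun u => (starRingEnd ℂ) (f' u)) := fun v hv => by
    refine ⟨(hf v hv).1.star, (hf v hv).2.star.congr_deriv ?_⟩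
    simp
  have hd0 : Tendsto (fun u : ℝ => cexp (I * ω * u) * (f u - g u)) atTop (𝓝 0) := by
    simpa [mul_sub] using hf0.sub hg0
  have hd1 : Tendsto (fun u : ℝ => cexp (I * ω * u) * (f' u - g' u)) atTop (𝓝 0) := by
    simpa [mul_sub] using hf1.sub hg1
  have hcont := Complex.continuous_conj
  have hc0 := (hcont.tendsto _).comp hf0
  have hc1 := (hcont.tendsto _).comp hf1
  -- Let d = f - g. As V and ω are real, the conjugate f̄ is a second solution, with W(f, f̄) = 2iω
  -- ≠ 0. The boundary values give W(d, f̄) = W(d, f) = 0, and the identity d W(f, f̄) = f W(d, f̄)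
  -- - f̄ W(d, f), together with its analogue for d', forces d = d' = 0.
  have w1 := hd.wronskian_tendsto hc (w := 0) (by
    have h := (hd0.mul hc1).sub (hd1.mul hc0)
    simp only [zero_mul, sub_zero] at h
    refine h.congr fun u => ?_
    simp only [Function.comp, map_mul]
    linear_combination ((f u - g u) * (starRingEnd ℂ) (f' u)
      - (f' u - g' u) * (starRingEnd ℂ) (f u)) * hE u) hu
  have w2 := hf.wronskian_tendsto hc (w := 2 * I * ω) (by
    have h := (hf0.mul hc1).sub (hf1.mul hc0)
    have h2 : (1 : ℂ) * (starRingEnd ℂ) (-I * ω) - -I * ω * (starRingEnd ℂ) 1 = 2 * I * ω := by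
      simp; ring
    rw [h2] at h
    refine h.congr fun u => ?_
    simp only [Function.comp, map_mul]
    linear_combination (f u * (starRingEnd ℂ) (f' u) - f' u * (starRingEnd ℂ) (f u)) * hE u) hu
  have w3 := hd.wronskian_tendsto hf (w := 0) (by
    -- Without a conjugate the phases do not cancel but leave the square of a unimodular factor,
    -- which is harmless because the limit is zero.
    have hb : Tendsto (fun u : ℝ => (starRingEnd ℂ) (cexp (I * ω * u)) ^ 2 *
        (cexp (I * ω * u) * (f u - g u) * (cexp (I * ω * u) * f' u)
          - cexp (I * ω * u) * (f' u - g' u) * (cexp (I * ω * u) * f u))) atTop (𝓝 0) := by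
      have h := (hd0.mul hf1).sub (hd1.mul hf0)
      simp only [zero_mul, sub_zero] at h
      rw [tendsto_zero_iff_norm_tendsto_zero] at h ⊢
      refine h.congr fun u => ?_
      have : ‖cexp (I * ω * u)‖ = 1 := by
        have : I * ω * u = ((ω * u : ℝ) : ℂ) * I := by push_cast; ring
        rw [this, norm_exp_ofReal_mul_I]
      rw [norm_mul, norm_pow, RCLike.norm_conj, this, one_pow, one_mul]
    refine hb.congr fun u => ?_
    linear_combination ((f u - g u) * f' u - (f' u - g' u) * f u) *
      (cexp (I * ω * u) * (starRingEnd ℂ) (cexp (I * ω * u)) + 1) * hE u) hu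
  have hne : (2 * I * ω : ℂ) ≠ 0 := by simp [hω]
  constructor
  · refine sub_eq_zero.1 ((mul_eq_zero.1 ?_).resolve_right hne)
    linear_combination -(f u - g u) * w2 + f u * w1 - (starRingEnd ℂ) (f u) * w3
  · refine sub_eq_zero.1 ((mul_eq_zero.1 ?_).resolve_right hne)
    linear_combination -(f' u - g' u) * w2 + f' u * w1 - (starRingEnd ℂ) (f' u) * w3

/-! ### The Volterra equation in complex variables x and a -/

/-- A parameter integral of a locally dominated family of holomorphic functions is holomorphic. -/
theorem differentiableOn_integral_of_locally_dominated {α : Type*} [MeasurableSpace α]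
    {μ : Measure α} {U : Set ℂ} (hU : IsOpen U) {F : ℂ → α → ℂ}
    (hm : ∀ w ∈ U, AEStronglyMeasurable (F w) μ)
    (hd : ∀ᵐ t ∂μ, DifferentiableOn ℂ (fun w => F w t) U)
    (hb : ∀ w₀ ∈ U, ∃ V ∈ 𝓝 w₀, ∃ b : α → ℝ, Integrable b μ ∧
      ∀ᵐ t ∂μ, ∀ w ∈ V, ‖F w t‖ ≤ b t) :
    DifferentiableOn ℂ (fun w => ∫ t, F w t ∂μ) U := by
  intro w₀ hw₀
  obtain ⟨V, hV, b, hbi, hFb⟩ := hb w₀ hw₀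
  obtain ⟨δ, hδ, hδU⟩ := Metric.mem_nhds_iff.1 (inter_mem (hU.mem_nhds hw₀) hV)
  set R : ℝ := δ / 3 with hR
  have hR0 : 0 < R := by positivity
  have hsub : ∀ w ∈ Metric.ball w₀ R, Metric.closedBall w R ⊆ U ∩ V := fun w hw v hv => by
    refine hδU ?_
    rw [Metric.mem_ball] at hw ⊢
    rw [Metric.mem_closedBall] at hv
    have := dist_triangle v w w₀
    linarith
  have hdat : ∀ t, DifferentiableOn ℂ (fun w => F w t) U → ∀ w ∈ Metric.ball w₀ R,
      HasDerivAt (fun w => F w t) (deriv (fun w => F w t) w) w := fun t ht w hw =>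
    (ht.differentiableAt (hU.mem_nhds
      (hsub w hw (Metric.mem_closedBall_self hR0.le)).1)).hasDerivAt
  have hball : Metric.ball w₀ R ∈ 𝓝 w₀ := Metric.ball_mem_nhds _ hR0
  have key := hasDerivAt_integral_of_dominated_loc_of_deriv_le (μ := μ) (F := F)
    (F' := fun w t => deriv (fun w => F w t) w) (bound := fun t => b t / R) hball
    ?_ ?_ ?_ ?_ (hbi.div_const R) ?_
  · exact key.2.differentiableAt.differentiableWithinAt
  · filter_upwards [hU.mem_nhds hw₀] with w hw using hm w hw
  · refine hbi.mono' (hm w₀ hw₀) ?_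
    filter_upwards [hFb] with t ht using ht w₀ (mem_of_mem_nhds hV)
  · have hseq : Tendsto (fun n : ℕ => ((R / 2 * (1 / ((n : ℝ) + 1)) : ℝ) : ℂ)) atTop (𝓝[≠] 0) := by
      refine tendsto_nhdsWithin_iff.2 ⟨?_, Eventually.of_forall fun n => ?_⟩
      · have := (tendsto_one_div_add_atTop_nhds_zero_nat (𝕜 := ℝ)).const_mul (R / 2)
        rw [mul_zero] at this
        exact_mod_cast (continuous_ofReal.tendsto _).comp this
      · have : (0 : ℝ) < R / 2 * (1 / ((n : ℝ) + 1)) := by positivity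
        exact ofReal_ne_zero.2 this.ne'
    refine aestronglyMeasurable_of_tendsto_ae atTop (f := fun (n : ℕ) t =>
      ((R / 2 * (1 / ((n : ℝ) + 1)) : ℝ) : ℂ)⁻¹ •
        (F (w₀ + ((R / 2 * (1 / ((n : ℝ) + 1)) : ℝ) : ℂ)) t - F w₀ t)) (fun n => ?_) ?_
    · simp only [smul_eq_mul]
      refine ((hm _ ?_).sub (hm _ hw₀)).const_mul _
      refine (hsub w₀ (Metric.mem_ball_self hR0) ?_).1
      rw [Metric.mem_closedBall, dist_eq_norm, add_sub_cancel_left, norm_real, Real.norm_eq_abs,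
        abs_of_nonneg (by positivity)]
      have : 1 / ((n : ℝ) + 1) ≤ 1 := by
        rw [div_le_one (by positivity)]
        linarith [Nat.cast_nonneg (α := ℝ) n]
      nlinarith
    · filter_upwards [hd] with t ht
      exact (hdat t ht w₀ (Metric.mem_ball_self hR0)).tendsto_slope_zero.comp hseq
  · filter_upwards [hd, hFb] with t ht htb w hw
    refine Complex.norm_deriv_le_of_forall_mem_sphere_norm_le hR0 ?_
      fun v hv => htb v (hsub w hw (Metric.sphere_subset_closedBall hv)).2
    refine DifferentiableOn.diffContOnCl ?_
    rw [closure_ball w hR0.ne']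
    exact ht.mono fun v hv => (hsub w hw hv).1
  · filter_upwards [hd] with t ht w hw using hdat t ht w hw

theorem integrableOn_inv_add_sq {δ : ℝ} (hδ : 0 < δ) :
    IntegrableOn (fun t : ℝ => 1 / (δ + t) ^ 2) (Set.Ioi 0) ∧
      ∫ t in Set.Ioi (0 : ℝ), 1 / (δ + t) ^ 2 = 1 / δ := by
  have hd : ∀ t ∈ Set.Ici (0 : ℝ), HasDerivAt (fun t : ℝ => -(δ + t)⁻¹) (1 / (δ + t) ^ 2) t :=
    fun t ht => by
      have ht' : 0 ≤ t := ht
      have h0 : δ + t ≠ 0 := by positivity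
      refine (((hasDerivAt_id t).const_add δ).inv h0).neg.congr_deriv ?_
      simp only [id]
      field_simp
  have h0 : ∀ t ∈ Set.Ioi (0 : ℝ), 0 ≤ 1 / (δ + t) ^ 2 := fun t _ => by positivity
  have hl : Tendsto (fun t : ℝ => -(δ + t)⁻¹) atTop (𝓝 0) := by
    have := (tendsto_inv_atTop_zero.comp (tendsto_atTop_add_const_left atTop δ tendsto_id)).neg
    simpa using this
  refine ⟨integrableOn_Ioi_deriv_of_nonneg' hd h0 hl, ?_⟩
  rw [integral_Ioi_of_hasDerivAt_of_nonneg' hd h0 hl]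
  simp

/-- A size of `x` which is `> 0` on a sector around the positive half-line and which grows by `t`
under the translation by `t ≥ 0`. -/
def tailSize (x : ℂ) : ℝ := x.re + 2 * |x.im|

theorem tailSize_add_ofReal (x : ℂ) (t : ℝ) : tailSize (x + t) = tailSize x + t := by
  simp [tailSize]; ring

theorem tailSize_le (x : ℂ) : tailSize x ≤ 3 * ‖x‖ := by
  unfold tailSize
  linarith [Complex.re_le_norm x, Complex.abs_im_le_norm x]

theorem tailSize_add_le_norm (x : ℂ) (t : ℝ) : (tailSize x + t) / 3 ≤ ‖x + t‖ := by
  have := tailSize_le (x + t)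
  rw [tailSize_add_ofReal] at this
  linarith

theorem tailSize_sub_le (x y : ℂ) : tailSize x - 3 * ‖y‖ ≤ tailSize (x - y) := by
  unfold tailSize
  rw [sub_re, sub_im]
  linarith [Complex.re_le_norm y, Complex.abs_im_le_norm y, abs_sub_abs_le_abs_sub x.im y.im]

theorem continuous_tailSize : Continuous tailSize := by
  unfold tailSize
  fun_prop

theorem mem_slitPlane_of_tailSize {x : ℂ} (hx : 0 < tailSize x) : x ∈ slitPlane := by
  rw [mem_slitPlane_iff]
  by_contra! h
  unfold tailSize at hx
  rw [h.2] at hx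
  simp at hx
  linarith [h.1]

/-- The domain of the complexified Volterra equation. -/
def volterraDomain : Set (ℂ × ℂ) := {p | 100 * ‖p.2‖ < tailSize p.1}

theorem isOpen_volterraDomain : IsOpen volterraDomain :=
  isOpen_lt (by fun_prop) (continuous_tailSize.comp continuous_fst)

section Domain

variable {x a : ℂ} (h : (x, a) ∈ volterraDomain)
include h

theorem volterraDomain_tailSize_pos : 0 < tailSize x := by
  have h' : 100 * ‖a‖ < tailSize x := h
  linarith [norm_nonneg a]

theorem volterraDomain_norm_le : ‖a‖ ≤ tailSize x / 100 := by
  have h' : 100 * ‖a‖ < tailSize x := h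
  linarith

theorem volterraDomain_add {t : ℝ} (ht : 0 ≤ t) : (x + t, a) ∈ volterraDomain := by
  have h' : 100 * ‖a‖ < tailSize x := h
  change 100 * ‖a‖ < tailSize (x + t)
  rw [tailSize_add_ofReal]
  linarith

theorem volterraDomain_tailSize_sub : tailSize x * (97 / 100) ≤ tailSize (x - a) := by
  have := tailSize_sub_le x a
  have := volterraDomain_norm_le h
  linarith

theorem volterraDomain_sub_mem_slitPlane : x - a ∈ slitPlane := by
  refine mem_slitPlane_of_tailSize ?_
  have := volterraDomain_tailSize_sub h
  have := volterraDomain_tailSize_pos h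
  linarith

theorem volterraDomain_ne_zero : x ≠ 0 := by
  rintro rfl
  have := volterraDomain_tailSize_pos h
  simp [tailSize] at this

theorem volterraDomain_sub_ne_zero : x - a ≠ 0 :=
  slitPlane_ne_zero (volterraDomain_sub_mem_slitPlane h)

theorem volterraDomain_norm_div_le : ‖a / (x - a)‖ ≤ 1 / 2 := by
  have h1 := volterraDomain_tailSize_sub h
  have h2 := tailSize_le (x - a)
  have h3 := volterraDomain_norm_le h
  have h4 := volterraDomain_tailSize_pos h
  rw [norm_div, div_le_iff₀ (norm_pos_iff.2 (volterraDomain_sub_ne_zero h))]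
  linarith

theorem norm_div_cube_le {t : ℝ} (ht : 0 ≤ t) :
    ‖a / (x + t) ^ 3‖ ≤ 27 * ‖a‖ / (tailSize x + t) ^ 3 := by
  have h1 := tailSize_add_le_norm x t
  have h2 := volterraDomain_tailSize_pos h
  rw [norm_div, norm_pow]
  calc ‖a‖ / ‖x + t‖ ^ 3 ≤ ‖a‖ / ((tailSize x + t) / 3) ^ 3 := by gcongr
    _ = _ := by field_simp; norm_num

end Domain

/-- The phase `s + a log (s - a)`. -/
noncomputable def jostPhase (a s : ℂ) : ℂ := s + a * log (s - a)

section Phase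

variable {x a : ℂ} (h : (x, a) ∈ volterraDomain)
include h

theorem hasDerivAt_jostPhase : HasDerivAt (jostPhase a) (x / (x - a)) x := by
  have := (hasDerivAt_id x).add ((((hasDerivAt_id x).sub_const a).clog
    (volterraDomain_sub_mem_slitPlane h)).const_mul a)
  refine this.congr_deriv ?_
  have h0 := volterraDomain_sub_ne_zero h
  simp only [id]
  field_simp
  ring

theorem hasDerivAt_jostPhase_ofReal {t : ℝ} (ht : 0 ≤ t) :
    HasDerivAt (fun t : ℝ => jostPhase a (x + t)) ((x + t) / (x + t - a)) t := by
  have h1 := hasDerivAt_jostPhase (volterraDomain_add h ht)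
  have h2 : HasDerivAt (fun t : ℝ => x + (t : ℂ)) 1 t := by
    simpa using (hasDerivAt_id t).ofReal_comp.const_add x
  have h3 := h1.scomp t h2
  rw [one_smul] at h3
  exact h3

/-- The phase has derivative 1 + a/(x + t - a) along the ray, and the perturbation is at most 1/2 on
the domain. Hence the real part of the phase does not decrease. -/
theorem norm_jostPhase_sub_le {t : ℝ} (ht : 0 ≤ t) :
    ‖jostPhase a (x + t) - jostPhase a x - t‖ ≤ t / 2 := by
  have := Convex.norm_image_sub_le_of_norm_hasDerivWithin_le (𝕜 := ℝ) (s := Set.Ici 0)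
    (f := fun t : ℝ => jostPhase a (x + t) - t) (C := 1 / 2) (x := 0) (y := t)
    (fun s hs => ((hasDerivAt_jostPhase_ofReal h hs).sub
      (hasDerivAt_id s).ofReal_comp).hasDerivWithinAt)
    (fun s hs => ?_) (convex_Ici 0) (by simp) ht
  · simp only [ofReal_zero, add_zero, sub_zero, Real.norm_eq_abs, abs_of_nonneg ht] at this
    calc _ = ‖jostPhase a (x + t) - t - jostPhase a x‖ := by congr 1; ring
      _ ≤ _ := by linarith
  · have hD := volterraDomain_add h hs
    have h0 := volterraDomain_sub_ne_zero hD
    have : (x + s) / (x + s - a) - ((1 : ℝ) : ℂ) = a / (x + s - a) := by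
      push_cast
      field_simp
      ring
    rw [this]
    exact volterraDomain_norm_div_le hD

theorem norm_exp_jostPhase_le {t : ℝ} (ht : 0 ≤ t) :
    ‖cexp (jostPhase a x - jostPhase a (x + t))‖ ≤ 1 := by
  rw [norm_exp, Real.exp_le_one_iff]
  have h1 := (Complex.abs_re_le_norm _).trans (norm_jostPhase_sub_le h ht)
  simp only [sub_re, ofReal_re] at h1 ⊢
  have := (abs_le.1 h1).1
  linarith

/-- Vanishing at t = 0 is decisive for small x: the extra factor t reduces a/(x + t)³ to size |a|/(m
+ t)², with m = `tailSize x`, whose integral |a|/m is bounded on the domain. The integral of |a|/(m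
+ t)³ alone would be of order |a|/m². -/
theorem norm_one_sub_exp_jostPhase_le {t : ℝ} (ht : 0 ≤ t) :
    ‖1 - cexp (jostPhase a x - jostPhase a (x + t))‖ ≤ 3 / 2 * t := by
  have := Convex.norm_image_sub_le_of_norm_hasDerivWithin_le (𝕜 := ℝ) (s := Set.Ici 0)
    (f := fun t : ℝ => cexp (jostPhase a x - jostPhase a (x + t))) (C := 3 / 2) (x := 0) (y := t)
    (fun s hs => ((hasDerivAt_jostPhase_ofReal h hs).const_sub _).cexp.hasDerivWithinAt)
    (fun s hs => ?_) (convex_Ici 0) (by simp) ht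
  · rw [norm_sub_rev]
    simpa [Real.norm_eq_abs, abs_of_nonneg ht] using this
  · have hD := volterraDomain_add h hs
    have h0 := volterraDomain_sub_ne_zero hD
    have h1 : (x + s) / (x + s - a) = 1 + a / (x + s - a) := by
      field_simp
      ring
    rw [norm_mul, norm_neg, h1]
    have h2 := norm_add_le (1 : ℂ) (a / (x + s - a))
    have h3 := volterraDomain_norm_div_le hD
    rw [norm_one] at h2
    calc _ ≤ 1 * ‖1 + a / (x + s - a)‖ := by gcongr; exact norm_exp_jostPhase_le h hs
      _ ≤ _ := by linarith

end Phase

/-- `f` is bounded by `C` on the Volterra domain, and holomorphic along every holomorphic curve in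
it. -/
structure IsVolterraBounded (f : ℂ → ℂ → ℂ) (C : ℝ) : Prop where
  norm_le : ∀ x a, (x, a) ∈ volterraDomain → ‖f x a‖ ≤ C
  differentiableOn : ∀ (U : Set ℂ), IsOpen U → ∀ x a : ℂ → ℂ, DifferentiableOn ℂ x U →
    DifferentiableOn ℂ a U → (∀ w ∈ U, (x w, a w) ∈ volterraDomain) →
    DifferentiableOn ℂ (fun w => f (x w) (a w)) U

/-- Holomorphy along curves replaces holomorphy in two variables. The curves finally needed are: `a`
fixed (here), `x` fixed, and z ↦ (Rz, 2Mz). -/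
theorem IsVolterraBounded.differentiableAt {f : ℂ → ℂ → ℂ} {C : ℝ} (hf : IsVolterraBounded f C)
    {x a : ℂ} (h : (x, a) ∈ volterraDomain) : DifferentiableAt ℂ (fun x => f x a) x := by
  have hU : IsOpen {x | (x, a) ∈ volterraDomain} :=
    isOpen_volterraDomain.preimage (by fun_prop)
  exact (hf.differentiableOn _ hU id (fun _ => a) differentiableOn_id
    (differentiableOn_const a) fun w hw => hw).differentiableAt (hU.mem_nhds h)

theorem IsVolterraBounded.continuousOn {f : ℂ → ℂ → ℂ} {C : ℝ} (hf : IsVolterraBounded f C)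
    {x a : ℂ} (h : (x, a) ∈ volterraDomain) :
    ContinuousOn (fun t : ℝ => f (x + t) a) (Set.Ici 0) := fun t ht => by
  have h1 : ContinuousAt (fun x => f x a) (x + t) :=
    (hf.differentiableAt (volterraDomain_add h ht)).continuousAt
  exact (h1.comp (f := fun t : ℝ => x + (t : ℂ)) (by fun_prop)).continuousWithinAt

/-- A kernel dominated by `(m + 1) / (m + t)²`, `m = tailSize x`. -/
structure IsVolterraKernel (K : ℂ → ℂ → ℝ → ℂ) : Prop where
  norm_le : ∀ x a, (x, a) ∈ volterraDomain → ∀ t : ℝ, 0 ≤ t →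
    ‖K x a t‖ ≤ (tailSize x + 1) * (1 / (tailSize x + t) ^ 2)
  continuousOn : ∀ x a, (x, a) ∈ volterraDomain → ContinuousOn (K x a) (Set.Ici 0)
  differentiableOn : ∀ (U : Set ℂ), IsOpen U → ∀ x a : ℂ → ℂ, DifferentiableOn ℂ x U →
    DifferentiableOn ℂ a U → (∀ w ∈ U, (x w, a w) ∈ volterraDomain) → ∀ t : ℝ, 0 ≤ t →
    DifferentiableOn ℂ (fun w => K (x w) (a w) t) U

namespace IsVolterraKernel

variable {K : ℂ → ℂ → ℝ → ℂ} (hK : IsVolterraKernel K) {f : ℂ → ℂ → ℂ} {C : ℝ}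
  (hf : IsVolterraBounded f C)
include hK hf

theorem norm_mul_le {x a : ℂ} (h : (x, a) ∈ volterraDomain) {t : ℝ} (ht : 0 ≤ t) :
    ‖K x a t * f (x + t) a‖ ≤ C * (tailSize x + 1) * (1 / (tailSize x + t) ^ 2) := by
  rw [norm_mul, mul_assoc, mul_comm C]
  exact mul_le_mul (hK.norm_le x a h t ht) (hf.norm_le _ _ (volterraDomain_add h ht))
    (norm_nonneg _) ((norm_nonneg _).trans (hK.norm_le x a h t ht))

theorem aestronglyMeasurable {x a : ℂ} (h : (x, a) ∈ volterraDomain) :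
    AEStronglyMeasurable (fun t : ℝ => K x a t * f (x + t) a) (volume.restrict (Set.Ioi 0)) :=
  (((hK.continuousOn x a h).mul (hf.continuousOn h)).mono
    Set.Ioi_subset_Ici_self).aestronglyMeasurable measurableSet_Ioi

theorem integrableOn {x a : ℂ} (h : (x, a) ∈ volterraDomain) :
    IntegrableOn (fun t : ℝ => K x a t * f (x + t) a) (Set.Ioi 0) := by
  refine Integrable.mono' (((integrableOn_inv_add_sq
    (volterraDomain_tailSize_pos h)).1).const_mul (C * (tailSize x + 1)))
    (hK.aestronglyMeasurable hf h) ?_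
  filter_upwards [ae_restrict_mem measurableSet_Ioi] with t ht
  exact hK.norm_mul_le hf h (le_of_lt ht)

theorem differentiableOn_integral (U : Set ℂ) (hU : IsOpen U) (x a : ℂ → ℂ)
    (hx : DifferentiableOn ℂ x U) (ha : DifferentiableOn ℂ a U)
    (hD : ∀ w ∈ U, (x w, a w) ∈ volterraDomain) :
    DifferentiableOn ℂ (fun w => ∫ t in Set.Ioi (0 : ℝ), K (x w) (a w) t * f (x w + t) (a w))
      U := by
  refine differentiableOn_integral_of_locally_dominated hU
    (fun w hw => hK.aestronglyMeasurable hf (hD w hw)) ?_ fun w₀ hw₀ => ?_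
  · filter_upwards [ae_restrict_mem measurableSet_Ioi] with t ht
    have ht' : 0 ≤ t := le_of_lt ht
    exact (hK.differentiableOn U hU x a hx ha hD t ht').mul
      (hf.differentiableOn U hU (fun w => x w + t) a (hx.add_const _) ha
        fun w hw => volterraDomain_add (hD w hw) ht')
  · set m := tailSize (x w₀) with hm
    have hm0 : 0 < m := volterraDomain_tailSize_pos (hD w₀ hw₀)
    have hcont : ContinuousAt (fun w => tailSize (x w)) w₀ :=
      continuous_tailSize.continuousAt.comp
        (hx.differentiableAt (hU.mem_nhds hw₀)).continuousAt
    have hC : 0 ≤ C := (norm_nonneg _).trans (hf.norm_le _ _ (hD w₀ hw₀))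
    refine ⟨{w | m / 2 < tailSize (x w) ∧ tailSize (x w) < 2 * m} ∩ U,
      inter_mem (hcont.preimage_mem_nhds (Ioo_mem_nhds (by linarith) (by linarith)))
        (hU.mem_nhds hw₀), fun t => C * (2 * m + 1) * (1 / (m / 2 + t) ^ 2),
      ((integrableOn_inv_add_sq (half_pos hm0)).1).const_mul _, ?_⟩
    filter_upwards [ae_restrict_mem measurableSet_Ioi] with t ht w hw
    have ht' : 0 < t := ht
    refine (hK.norm_mul_le hf (hD w hw.2) ht'.le).trans ?_
    have h1 := hw.1.1
    have h2 := hw.1.2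
    have h3 := volterraDomain_tailSize_pos (hD w hw.2)
    gcongr

end IsVolterraKernel

theorem norm_div_cube_le_sq {x a : ℂ} (h : (x, a) ∈ volterraDomain) {t : ℝ} (ht : 0 ≤ t) :
    ‖a / (x + t) ^ 3‖ ≤ 27 / 100 * (1 / (tailSize x + t) ^ 2) := by
  have h0 := volterraDomain_tailSize_pos h
  have h1 := volterraDomain_norm_le h
  calc _ ≤ 27 * ‖a‖ / (tailSize x + t) ^ 3 := norm_div_cube_le h ht
    _ ≤ 27 * ((tailSize x + t) / 100) / (tailSize x + t) ^ 3 := by gcongr; linarith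
    _ = _ := by field_simp

theorem differentiableOn_div_cube {U : Set ℂ} {x a : ℂ → ℂ} (hx : DifferentiableOn ℂ x U)
    (ha : DifferentiableOn ℂ a U) (hD : ∀ w ∈ U, (x w, a w) ∈ volterraDomain) {t : ℝ}
    (ht : 0 ≤ t) : DifferentiableOn ℂ (fun w => a w / (x w + t) ^ 3) U :=
  ha.div ((hx.add_const _).pow 3) fun w hw =>
    pow_ne_zero 3 (volterraDomain_ne_zero (volterraDomain_add (hD w hw) ht))

theorem differentiableOn_jostPhase {U : Set ℂ} {x a : ℂ → ℂ} (hx : DifferentiableOn ℂ x U)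
    (ha : DifferentiableOn ℂ a U) (hD : ∀ w ∈ U, (x w, a w) ∈ volterraDomain) {t : ℝ}
    (ht : 0 ≤ t) : DifferentiableOn ℂ (fun w => jostPhase (a w) (x w + t)) U :=
  (hx.add_const _).add (ha.mul (((hx.add_const _).sub ha).clog fun w hw =>
    volterraDomain_sub_mem_slitPlane (volterraDomain_add (hD w hw) ht)))

theorem continuousOn_div_cube {x a : ℂ} (h : (x, a) ∈ volterraDomain) :
    ContinuousOn (fun t : ℝ => a / (x + t) ^ 3) (Set.Ici 0) :=
  continuousOn_const.div (by fun_prop) fun t ht =>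
    pow_ne_zero 3 (volterraDomain_ne_zero (volterraDomain_add h ht))

theorem continuousOn_jostPhase {x a : ℂ} (h : (x, a) ∈ volterraDomain) :
    ContinuousOn (fun t : ℝ => jostPhase a (x + t)) (Set.Ici 0) := fun _ ht =>
  (hasDerivAt_jostPhase_ofReal h ht).continuousAt.continuousWithinAt

theorem isVolterraKernel_div_cube : IsVolterraKernel fun x a t => a / (x + t) ^ 3 where
  norm_le x a h t ht := by
    refine (norm_div_cube_le_sq h ht).trans ?_
    have := volterraDomain_tailSize_pos h
    gcongr
    linarith
  continuousOn x a h := continuousOn_div_cube h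
  differentiableOn U _ x a hx ha hD t ht := differentiableOn_div_cube hx ha hD ht

theorem isVolterraKernel_exp_mul : IsVolterraKernel fun x a t =>
    cexp (jostPhase a x - jostPhase a (x + t)) * (a / (x + t) ^ 3) where
  norm_le x a h t ht := by
    have h1 := isVolterraKernel_div_cube.norm_le x a h t ht
    rw [norm_mul]
    calc _ ≤ 1 * ‖a / (x + t) ^ 3‖ := by gcongr; exact norm_exp_jostPhase_le h ht
      _ ≤ _ := by rwa [one_mul]
  continuousOn x a h :=
    (continuous_exp.comp_continuousOn (continuousOn_const.sub (continuousOn_jostPhase h))).mul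
      (continuousOn_div_cube h)
  differentiableOn U _ x a hx ha hD t ht := by
    have h0 := differentiableOn_jostPhase hx ha hD le_rfl
    simp only [ofReal_zero, add_zero] at h0
    exact ((h0.sub (differentiableOn_jostPhase hx ha hD ht)).cexp).mul
      (differentiableOn_div_cube hx ha hD ht)

theorem norm_one_sub_exp_mul_le {x a : ℂ} (h : (x, a) ∈ volterraDomain) {t : ℝ} (ht : 0 ≤ t) :
    ‖(1 - cexp (jostPhase a x - jostPhase a (x + t))) * (a / (x + t) ^ 3)‖
      ≤ 41 * ‖a‖ * (1 / (tailSize x + t) ^ 2) := by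
  have h0 := volterraDomain_tailSize_pos h
  rw [norm_mul]
  calc _ ≤ 3 / 2 * t * (27 * ‖a‖ / (tailSize x + t) ^ 3) := by
        gcongr
        · exact norm_one_sub_exp_jostPhase_le h ht
        · exact norm_div_cube_le h ht
    _ ≤ 3 / 2 * (tailSize x + t) * (27 * ‖a‖ / (tailSize x + t) ^ 3) := by gcongr; linarith
    _ = 81 / 2 * ‖a‖ * (1 / (tailSize x + t) ^ 2) := by field_simp; ring
    _ ≤ _ := by gcongr; norm_num

theorem isVolterraKernel_one_sub_exp_mul : IsVolterraKernel fun x a t =>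
    (1 - cexp (jostPhase a x - jostPhase a (x + t))) * (a / (x + t) ^ 3) where
  norm_le x a h t ht := by
    -- Here 41‖a‖ is at most a fraction of `tailSize x`, whereas the kernels without the difference
    -- are bounded with a constant below 1; the weight `tailSize x + 1` covers both kinds.
    refine (norm_one_sub_exp_mul_le h ht).trans ?_
    have := volterraDomain_norm_le h
    have := volterraDomain_tailSize_pos h
    gcongr
    linarith
  continuousOn x a h := by
    simp only [sub_mul, one_mul]
    exact (isVolterraKernel_div_cube.continuousOn x a h).sub
      (isVolterraKernel_exp_mul.continuousOn x a h)
  differentiableOn U hU x a hx ha hD t ht := by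
    simp only [sub_mul, one_mul]
    exact (isVolterraKernel_div_cube.differentiableOn U hU x a hx ha hD t ht).sub
      (isVolterraKernel_exp_mul.differentiableOn U hU x a hx ha hD t ht)

/-- The iterates of the Volterra equation of `e^{iωu} φ_ω(u)` as a function of `x = 2iωr` and
`a = 4iωM`. -/
noncomputable def jostVolterraIterate : ℕ → ℂ → ℂ → ℂ
  | 0, _, _ => 1
  | k + 1, x, a => ∫ t in Set.Ioi (0 : ℝ), (1 - cexp (jostPhase a x - jostPhase a (x + t))) *
      (a / (x + t) ^ 3) * jostVolterraIterate k (x + t) a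

/-- The function `e^{iωu} φ_ω(u)` as a function of `x = 2iωr` and `a = 4iωM`. -/
noncomputable def jostAmplitude (x a : ℂ) : ℂ := ∑' k, jostVolterraIterate k x a

/-- The function `(1 - a / x) ∂_x` of the amplitude. -/
noncomputable def jostAmplitudeDeriv (x a : ℂ) : ℂ :=
  -∫ t in Set.Ioi (0 : ℝ), cexp (jostPhase a x - jostPhase a (x + t)) *
      (a / (x + t) ^ 3) * jostAmplitude (x + t) a

theorem norm_integral_one_sub_exp_mul_le {f : ℂ → ℂ → ℂ} {C : ℝ} (hf : IsVolterraBounded f C)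
    {x a : ℂ} (h : (x, a) ∈ volterraDomain) :
    ‖∫ t in Set.Ioi (0 : ℝ), (1 - cexp (jostPhase a x - jostPhase a (x + t))) *
      (a / (x + t) ^ 3) * f (x + t) a‖ ≤ C * (41 * ‖a‖ / tailSize x) := by
  have h0 := volterraDomain_tailSize_pos h
  obtain ⟨h1, h2⟩ := integrableOn_inv_add_sq h0
  have h3 : C * (41 * ‖a‖ / tailSize x)
      = ∫ t in Set.Ioi (0 : ℝ), C * (41 * ‖a‖) * (1 / (tailSize x + t) ^ 2) := by
    rw [integral_const_mul, h2]
    ring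
  rw [h3]
  refine norm_integral_le_of_norm_le (h1.const_mul _) ?_
  filter_upwards [ae_restrict_mem measurableSet_Ioi] with t ht
  have ht' : 0 ≤ t := le_of_lt ht
  rw [norm_mul]
  have h4 := norm_one_sub_exp_mul_le h ht'
  have h5 := hf.norm_le _ _ (volterraDomain_add h ht')
  calc _ ≤ 41 * ‖a‖ * (1 / (tailSize x + t) ^ 2) * C :=
        mul_le_mul h4 h5 (norm_nonneg _) (by positivity)
    _ = _ := by ring

theorem isVolterraBounded_jostVolterraIterate (k : ℕ) :
    IsVolterraBounded (jostVolterraIterate k) ((1 / 2) ^ k) := by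
  induction k with
  | zero =>
    refine ⟨fun x a _ => by simp [jostVolterraIterate], fun U _ x a _ _ _ => ?_⟩
    simp only [jostVolterraIterate]
    exact differentiableOn_const 1
  | succ k ih =>
    refine ⟨fun x a h => ?_, fun U hU x a hx ha hD => ?_⟩
    · rw [jostVolterraIterate]
      refine (norm_integral_one_sub_exp_mul_le ih h).trans ?_
      have h0 := volterraDomain_tailSize_pos h
      have h1 := volterraDomain_norm_le h
      -- On the domain ‖a‖ ≤ `tailSize x` / 100, so the ratio is at most 41/100; this is the
      -- contraction.
      have : 41 * ‖a‖ / tailSize x ≤ 1 / 2 := by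
        rw [div_le_iff₀ h0]
        linarith
      rw [pow_succ]
      gcongr
    · simp only [jostVolterraIterate]
      exact isVolterraKernel_one_sub_exp_mul.differentiableOn_integral ih U hU x a hx ha hD

theorem summable_jostVolterraIterate {x a : ℂ} (h : (x, a) ∈ volterraDomain) :
    Summable fun k => jostVolterraIterate k x a :=
  Summable.of_norm_bounded summable_geometric_two
    fun k => (isVolterraBounded_jostVolterraIterate k).norm_le x a h

theorem isVolterraBounded_jostAmplitude : IsVolterraBounded jostAmplitude 2 := by
  refine ⟨fun x a h => ?_, fun U hU x a hx ha hD => ?_⟩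
  · exact tsum_of_norm_bounded hasSum_geometric_two
      fun k => (isVolterraBounded_jostVolterraIterate k).norm_le x a h
  · exact Complex.differentiableOn_tsum_of_summable_norm summable_geometric_two
      (fun k => (isVolterraBounded_jostVolterraIterate k).differentiableOn U hU x a hx ha hD) hU
      fun k w hw => (isVolterraBounded_jostVolterraIterate k).norm_le _ _ (hD w hw)

/-- Sum of the recursion. Sum and integral commute because the iterates decay like 2⁻ᵏ under a
common integrable majorant of the kernel. -/
theorem jostAmplitude_eq {x a : ℂ} (h : (x, a) ∈ volterraDomain) :
    jostAmplitude x a = 1 + ∫ t in Set.Ioi (0 : ℝ),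
      (1 - cexp (jostPhase a x - jostPhase a (x + t))) * (a / (x + t) ^ 3) *
        jostAmplitude (x + t) a := by
  have hK := isVolterraKernel_one_sub_exp_mul
  have h0 := volterraDomain_tailSize_pos h
  obtain ⟨h1, h2⟩ := integrableOn_inv_add_sq h0
  have hs := hasSum_integral_of_summable_integral_norm (μ := volume.restrict (Set.Ioi (0 : ℝ)))
    (F := fun k t => (1 - cexp (jostPhase a x - jostPhase a (x + t))) * (a / (x + t) ^ 3) *
        jostVolterraIterate k (x + t) a)
    (fun k => hK.integrableOn (isVolterraBounded_jostVolterraIterate k) h) (by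
      refine Summable.of_nonneg_of_le (fun k => integral_nonneg fun t => norm_nonneg _)
        (fun k => ?_) (summable_geometric_two.mul_right ((tailSize x + 1) * (1 / tailSize x)))
      rw [← mul_assoc, ← h2, ← integral_const_mul]
      refine integral_mono_ae
        (hK.integrableOn (isVolterraBounded_jostVolterraIterate k) h).norm (h1.const_mul _) ?_
      filter_upwards [ae_restrict_mem measurableSet_Ioi] with t ht
      exact hK.norm_mul_le (isVolterraBounded_jostVolterraIterate k) h (le_of_lt ht))
  rw [jostAmplitude, (summable_jostVolterraIterate h).tsum_eq_zero_add]
  congr 1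
  simp only [jostVolterraIterate]
  rw [hs.tsum_eq]
  refine setIntegral_congr_fun measurableSet_Ioi fun t ht => ?_
  simp only [jostAmplitude]
  rw [tsum_mul_left]

theorem norm_jostAmplitudeDeriv_le {x a : ℂ} (h : (x, a) ∈ volterraDomain) :
    ‖jostAmplitudeDeriv x a‖ ≤ 1 / tailSize x := by
  have h0 := volterraDomain_tailSize_pos h
  obtain ⟨h1, h2⟩ := integrableOn_inv_add_sq h0
  rw [jostAmplitudeDeriv, norm_neg, ← h2]
  refine norm_integral_le_of_norm_le h1 ?_
  filter_upwards [ae_restrict_mem measurableSet_Ioi] with t ht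
  have ht' : 0 ≤ t := le_of_lt ht
  have h3 := norm_exp_jostPhase_le h ht'
  have h4 := norm_div_cube_le_sq h ht'
  have h5 := isVolterraBounded_jostAmplitude.norm_le _ _ (volterraDomain_add h ht')
  rw [norm_mul, norm_mul]
  calc _ ≤ 1 * (27 / 100 * (1 / (tailSize x + t) ^ 2)) * 2 := by gcongr
    _ = 27 / 50 * (1 / (tailSize x + t) ^ 2) := by ring
    _ ≤ 1 * (1 / (tailSize x + t) ^ 2) := by gcongr; norm_num
    _ = _ := one_mul _

theorem differentiableOn_jostAmplitudeDeriv (U : Set ℂ) (hU : IsOpen U) (x a : ℂ → ℂ)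
    (hx : DifferentiableOn ℂ x U) (ha : DifferentiableOn ℂ a U)
    (hD : ∀ w ∈ U, (x w, a w) ∈ volterraDomain) :
    DifferentiableOn ℂ (fun w => jostAmplitudeDeriv (x w) (a w)) U :=
  (isVolterraKernel_exp_mul.differentiableOn_integral isVolterraBounded_jostAmplitude
    U hU x a hx ha hD).neg

theorem norm_jostAmplitude_sub_one_le {x a : ℂ} (h : (x, a) ∈ volterraDomain) :
    ‖jostAmplitude x a - 1‖ ≤ 82 * ‖a‖ / tailSize x := by
  rw [jostAmplitude_eq h, add_sub_cancel_left]
  refine (norm_integral_one_sub_exp_mul_le isVolterraBounded_jostAmplitude h).trans_eq ?_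
  ring

/-- Complex differentiability is assumed, so the derivative may be computed in the real direction
alone. There a translation turns the integral into one over (τ, ∞), and the fundamental theorem
applies. -/
theorem hasDerivAt_tail_integral {a : ℂ} {g : ℂ → ℂ} {x : ℂ} (h : (x, a) ∈ volterraDomain)
    (hg : ∀ y, (y, a) ∈ volterraDomain → DifferentiableAt ℂ g y)
    (hi : ∀ y, (y, a) ∈ volterraDomain → IntegrableOn (fun t : ℝ => g (y + t)) (Set.Ioi 0))
    (hF : DifferentiableAt ℂ (fun y => ∫ t in Set.Ioi (0 : ℝ), g (y + t)) x) :
    HasDerivAt (fun y => ∫ t in Set.Ioi (0 : ℝ), g (y + t)) (-g x) x := by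
  obtain ⟨δ, hδ, hδD⟩ : ∃ δ : ℝ, 0 < δ ∧ (x - δ, a) ∈ volterraDomain := by
    have h' : 100 * ‖a‖ < tailSize x := h
    refine ⟨(tailSize x - 100 * ‖a‖) / 2, by linarith, ?_⟩
    change 100 * ‖a‖ < tailSize _
    rw [sub_eq_add_neg, ← ofReal_neg, tailSize_add_ofReal]
    linarith
  have hmem : ∀ t : ℝ, -δ ≤ t → (x + t, a) ∈ volterraDomain := fun t ht => by
    have := volterraDomain_add hδD (t := t + δ) (by linarith)
    push_cast at this
    convert this using 2
    ring
  have h1 : HasDerivAt (fun τ : ℝ => ∫ t in Set.Ioi (0 : ℝ), g (x + τ + t))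
      (deriv (fun y => ∫ t in Set.Ioi (0 : ℝ), g (y + t)) x) 0 := by
    have h2 : HasDerivAt (fun t : ℝ => x + (t : ℂ)) 1 0 := by
      simpa using (hasDerivAt_id (0 : ℝ)).ofReal_comp.const_add x
    have h3 : HasDerivAt (fun y => ∫ t in Set.Ioi (0 : ℝ), g (y + t))
      (deriv (fun y => ∫ t in Set.Ioi (0 : ℝ), g (y + t)) x) (x + (0 : ℝ)) := by
      simpa using hF.hasDerivAt
    have h4 := h3.scomp (0 : ℝ) h2
    rw [one_smul] at h4
    exact h4
  have hshift : ∀ τ : ℝ, ∫ t in Set.Ioi (0 : ℝ), g (x + τ + t)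
      = ∫ t in Set.Ioi τ, g (x + t) := fun τ => by
    have hpre : (fun t : ℝ => t + τ) ⁻¹' Set.Ioi τ = Set.Ioi 0 := by
      ext t; simp
    rw [← (measurePreserving_add_right volume τ).setIntegral_preimage_emb
      (measurableEmbedding_addRight τ) (fun t : ℝ => g (x + t)) (Set.Ioi τ), hpre]
    refine setIntegral_congr_fun measurableSet_Ioi fun t _ => ?_
    push_cast
    ring_nf
  have h5 : HasDerivAt (fun τ : ℝ => ∫ t in Set.Ioi τ, g (x + t)) (-g (x + (0 : ℝ))) 0 := by
    refine hasDerivAt_setIntegral_Ioi (g := fun t : ℝ => g (x + t)) (a := -δ) ?_ (by linarith) ?_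
    · have hpre : (fun t : ℝ => t + δ) ⁻¹' Set.Ioi 0 = Set.Ioi (-δ) := by
        ext t; simp [neg_lt_iff_pos_add]
      have := ((measurePreserving_add_right volume δ).integrableOn_comp_preimage
        (measurableEmbedding_addRight δ)).2 (hi _ hδD)
      rw [hpre] at this
      refine IntegrableOn.congr_fun this (fun t _ => ?_) measurableSet_Ioi
      simp only [Function.comp]
      push_cast
      congr 1
      ring
    · intro t ht
      have h6 : ContinuousAt g (x + t) := (hg _ (hmem t (le_of_lt ht))).continuousAt
      exact (h6.comp (f := fun t : ℝ => x + (t : ℂ)) (by fun_prop)).continuousWithinAt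
  have h6 := (h1.congr_of_eventuallyEq (Eventually.of_forall fun τ => (hshift τ).symm)).unique h5
  rw [ofReal_zero, add_zero] at h6
  rw [← h6]
  exact hF.hasDerivAt

theorem differentiableAt_of_curves {F : ℂ → ℂ → ℂ}
    (hF : ∀ (U : Set ℂ), IsOpen U → ∀ x a : ℂ → ℂ, DifferentiableOn ℂ x U →
      DifferentiableOn ℂ a U → (∀ w ∈ U, (x w, a w) ∈ volterraDomain) →
      DifferentiableOn ℂ (fun w => F (x w) (a w)) U)
    {x a : ℂ} (h : (x, a) ∈ volterraDomain) : DifferentiableAt ℂ (fun x => F x a) x := by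
  have hU : IsOpen {x | (x, a) ∈ volterraDomain} :=
    isOpen_volterraDomain.preimage (by fun_prop)
  exact (hF _ hU id (fun _ => a) differentiableOn_id
    (differentiableOn_const a) fun w hw => hw).differentiableAt (hU.mem_nhds h)

/-- The factor e^{P(x)} comes out of the integral, leaving a pure tail integral; the two terms are
the derivatives of these two factors, with P' = x/(x - a). -/
theorem hasDerivAt_jostAmplitudeDeriv {x a : ℂ} (h : (x, a) ∈ volterraDomain) :
    HasDerivAt (fun x => jostAmplitudeDeriv x a)
      (x / (x - a) * jostAmplitudeDeriv x a + a / x ^ 3 * jostAmplitude x a) x := by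
  set g : ℂ → ℂ := fun s => cexp (-jostPhase a s) * (a / s ^ 3 * jostAmplitude s a) with hg
  have hker : ∀ y : ℂ, ∀ t : ℝ, cexp (jostPhase a y - jostPhase a (y + t)) *
      (a / (y + t) ^ 3) * jostAmplitude (y + t) a = cexp (jostPhase a y) * g (y + t) :=
    fun y t => by
      rw [hg, sub_eq_add_neg, Complex.exp_add]
      ring
  have hF : ∀ y, jostAmplitudeDeriv y a
      = -(cexp (jostPhase a y) * ∫ t in Set.Ioi (0 : ℝ), g (y + t)) := fun y => by
    rw [jostAmplitudeDeriv, ← integral_const_mul]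
    simp only [hker]
  have hF' : ∀ y, ∫ t in Set.Ioi (0 : ℝ), g (y + t)
      = -cexp (-jostPhase a y) * jostAmplitudeDeriv y a := fun y => by
    rw [hF, neg_mul_neg, ← mul_assoc, ← Complex.exp_add]
    simp
  have hdA := fun {y : ℂ} (hy : (y, a) ∈ volterraDomain) =>
    differentiableAt_of_curves differentiableOn_jostAmplitudeDeriv hy
  have hdψ := fun {y : ℂ} (hy : (y, a) ∈ volterraDomain) =>
    differentiableAt_of_curves isVolterraBounded_jostAmplitude.differentiableOn hy
  have hP := fun {y : ℂ} (hy : (y, a) ∈ volterraDomain) => hasDerivAt_jostPhase hy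
  have h1 := hasDerivAt_tail_integral (g := g) h (fun y hy => ?_) (fun y hy => ?_) ?_
  · have h2 := ((hP h).cexp.mul h1).neg
    refine (h2.congr_of_eventuallyEq (Eventually.of_forall hF)).congr_deriv ?_
    rw [hF x, hg]
    have : cexp (jostPhase a x) * cexp (-jostPhase a x) = 1 := by
      rw [← Complex.exp_add]; simp
    linear_combination (a / x ^ 3 * jostAmplitude x a) * this
  · exact (hP hy).differentiableAt.neg.cexp.mul (((differentiableAt_const a).div
      ((differentiableAt_fun_id (x := y)).pow 3) (pow_ne_zero 3 (volterraDomain_ne_zero hy))).mul (hdψ hy))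
  · have := (isVolterraKernel_exp_mul.integrableOn isVolterraBounded_jostAmplitude hy).const_mul
      (cexp (-jostPhase a y))
    refine IntegrableOn.congr_fun this (fun t _ => ?_) measurableSet_Ioi
    simp only [hker]
    rw [← mul_assoc, ← Complex.exp_add]
    simp
  · simp only [hF']
    exact ((hP h).differentiableAt.neg.cexp.neg).mul (hdA h)

/-- Splitting 1 - e^{P(x) - P(x+t)} writes the amplitude as 1 plus a tail integral plus
`jostAmplitudeDeriv`; on differentiation the terms with a/x³ cancel. -/
theorem hasDerivAt_jostAmplitude {x a : ℂ} (h : (x, a) ∈ volterraDomain) :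
    HasDerivAt (fun x => jostAmplitude x a) (x / (x - a) * jostAmplitudeDeriv x a) x := by
  have hK := isVolterraKernel_div_cube
  have hψ := isVolterraBounded_jostAmplitude
  have hU : IsOpen {x | (x, a) ∈ volterraDomain} :=
    isOpen_volterraDomain.preimage (by fun_prop)
  have hdecomp : ∀ y, (y, a) ∈ volterraDomain → jostAmplitude y a
      = 1 + (∫ t in Set.Ioi (0 : ℝ), a / (y + t) ^ 3 * jostAmplitude (y + t) a)
        + jostAmplitudeDeriv y a := fun y hy => by
    rw [jostAmplitude_eq hy, jostAmplitudeDeriv, add_assoc, ← sub_eq_add_neg, ← integral_sub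
      (hK.integrableOn hψ hy) (isVolterraKernel_exp_mul.integrableOn hψ hy)]
    simp only [sub_mul, one_mul]
  have h1 := hasDerivAt_tail_integral (g := fun s => a / s ^ 3 * jostAmplitude s a) h
    (fun y hy => ?_) (fun y hy => hK.integrableOn hψ hy)
    (differentiableAt_of_curves (F := fun y a => ∫ t in Set.Ioi (0 : ℝ), a / (y + t) ^ 3 *
      jostAmplitude (y + t) a) (hK.differentiableOn_integral hψ) h)
  · have h2 := (h1.const_add 1).add (hasDerivAt_jostAmplitudeDeriv h)
    refine (h2.congr_of_eventuallyEq ?_).congr_deriv (by ring)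
    filter_upwards [hU.mem_nhds h] with y hy using hdecomp y hy
  · exact ((differentiableAt_const a).div (differentiableAt_pow 3)
      (pow_ne_zero 3 (volterraDomain_ne_zero hy))).mul
      (differentiableAt_of_curves hψ.differentiableOn hy)

/-! ### Convergent double power series and integration along x = e^t, y = a e^{-t} -/

/-- `f x y` is the sum of an absolutely convergent power series on the bidisc of radius `ρ`, away
from the axes. -/
def IsDoubleSeries (ρ : ℝ) (f : ℂ → ℂ → ℂ) : Prop :=
  ∃ (ι : Type) (c : ι → ℂ) (m n : ι → ℕ), Summable (fun i => ‖c i‖ * (ρ ^ m i * ρ ^ n i)) ∧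
    ∀ x y, x ≠ 0 → y ≠ 0 → ‖x‖ ≤ ρ → ‖y‖ ≤ ρ → HasSum (fun i => c i * (x ^ m i * y ^ n i)) (f x y)

theorem norm_double_monomial_le {ρ : ℝ} (c : ℂ) (m n : ℕ) {x y : ℂ} (hx : ‖x‖ ≤ ρ)
    (hy : ‖y‖ ≤ ρ) : ‖c * (x ^ m * y ^ n)‖ ≤ ‖c‖ * (ρ ^ m * ρ ^ n) := by
  have := (norm_nonneg x).trans hx
  rw [norm_mul, norm_mul, norm_pow, norm_pow]
  gcongr

namespace IsDoubleSeries

variable {ρ : ℝ} {f g : ℂ → ℂ → ℂ}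

theorem monomial (ρ : ℝ) (c : ℂ) (m n : ℕ) : IsDoubleSeries ρ fun x y => c * (x ^ m * y ^ n) :=
  ⟨Unit, fun _ => c, fun _ => m, fun _ => n, (hasSum_fintype _).summable,
    fun x y _ _ _ _ => by simp⟩

theorem const (ρ : ℝ) (c : ℂ) : IsDoubleSeries ρ fun _ _ => c := by
  simpa using monomial ρ c 0 0

theorem fst (ρ : ℝ) : IsDoubleSeries ρ fun x _ => x := by
  simpa using monomial ρ 1 1 0

theorem snd (ρ : ℝ) : IsDoubleSeries ρ fun _ y => y := by
  simpa using monomial ρ 1 0 1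

theorem add (hf : IsDoubleSeries ρ f) (hg : IsDoubleSeries ρ g) :
    IsDoubleSeries ρ fun x y => f x y + g x y := by
  obtain ⟨ι, c, m, n, hs, hf⟩ := hf
  obtain ⟨κ, d, p, q, ht, hg⟩ := hg
  refine ⟨ι ⊕ κ, Sum.elim c d, Sum.elim m p, Sum.elim n q, ?_, fun x y h1 h2 h3 h4 => ?_⟩
  · exact Summable.sum _ hs ht
  · exact HasSum.sum (hf x y h1 h2 h3 h4) (hg x y h1 h2 h3 h4)

/-- Index types are arbitrary and exponents may repeat, so the product is indexed by pairs and no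
coefficients have to be collected. -/
theorem mul (hf : IsDoubleSeries ρ f) (hg : IsDoubleSeries ρ g) :
    IsDoubleSeries ρ fun x y => f x y * g x y := by
  obtain ⟨ι, c, m, n, hs, hf⟩ := hf
  obtain ⟨κ, d, p, q, ht, hg⟩ := hg
  refine ⟨ι × κ, fun i => c i.1 * d i.2, fun i => m i.1 + p i.2, fun i => n i.1 + q i.2, ?_,
    fun x y h1 h2 h3 h4 => ?_⟩
  · refine (summable_mul_of_summable_norm hs.norm ht.norm).congr fun i => ?_
    rw [norm_mul, pow_add, pow_add]
    ring
  · have h5 : Summable fun i => ‖c i * (x ^ m i * y ^ n i)‖ :=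
      Summable.of_nonneg_of_le (fun _ => norm_nonneg _)
        (fun i => norm_double_monomial_le (c i) (m i) (n i) h3 h4) hs
    have h6 : Summable fun i => ‖d i * (x ^ p i * y ^ q i)‖ :=
      Summable.of_nonneg_of_le (fun _ => norm_nonneg _)
        (fun i => norm_double_monomial_le (d i) (p i) (q i) h3 h4) ht
    have h7 := summable_mul_of_summable_norm h5 h6
    have h8 := (hf x y h1 h2 h3 h4).mul (hg x y h1 h2 h3 h4) h7
    refine h8.congr_fun fun i => ?_
    rw [pow_add, pow_add]
    ring

theorem const_mul (c : ℂ) (hf : IsDoubleSeries ρ f) : IsDoubleSeries ρ fun x y => c * f x y :=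
  (const ρ c).mul hf

theorem neg (hf : IsDoubleSeries ρ f) : IsDoubleSeries ρ fun x y => -f x y := by
  simpa using hf.const_mul (-1)

theorem sub (hf : IsDoubleSeries ρ f) (hg : IsDoubleSeries ρ g) :
    IsDoubleSeries ρ fun x y => f x y - g x y := by
  simpa [sub_eq_add_neg] using hf.add hg.neg

theorem pow (hf : IsDoubleSeries ρ f) (k : ℕ) : IsDoubleSeries ρ fun x y => f x y ^ k := by
  induction k with
  | zero => simpa using const ρ 1
  | succ k ih => simpa [pow_succ] using ih.mul hf

theorem sum {κ : Type*} (s : Finset κ) {f : κ → ℂ → ℂ → ℂ} (hf : ∀ j ∈ s, IsDoubleSeries ρ (f j)) :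
    IsDoubleSeries ρ fun x y => ∑ j ∈ s, f j x y := by
  classical
  induction s using Finset.induction_on with
  | empty => simpa using const ρ 0
  | insert j s hj ih =>
    simp only [Finset.sum_insert hj]
    exact (hf j (Finset.mem_insert_self j s)).add
      (ih fun i hi => hf i (Finset.mem_insert_of_mem hi))

theorem of_fst {h : ℂ → ℂ} {c : ℕ → ℂ} (hc : Summable fun k => ‖c k‖ * ρ ^ k)
    (hh : ∀ x, x ≠ 0 → ‖x‖ ≤ ρ → HasSum (fun k => c k * x ^ k) (h x)) :
    IsDoubleSeries ρ fun x _ => h x :=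
  ⟨ℕ, c, id, fun _ => 0, by simpa using hc, fun x y h1 _ h3 _ => by simpa using hh x h1 h3⟩

theorem of_snd {h : ℂ → ℂ} {c : ℕ → ℂ} (hc : Summable fun k => ‖c k‖ * ρ ^ k)
    (hh : ∀ x, x ≠ 0 → ‖x‖ ≤ ρ → HasSum (fun k => c k * x ^ k) (h x)) :
    IsDoubleSeries ρ fun _ y => h y :=
  ⟨ℕ, c, fun _ => 0, id, by simpa using hc, fun x y _ h2 _ h4 => by simpa using hh y h2 h4⟩

theorem bounded (hf : IsDoubleSeries ρ f) : ∃ C, 0 ≤ C ∧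
    ∀ x y, x ≠ 0 → y ≠ 0 → ‖x‖ ≤ ρ → ‖y‖ ≤ ρ → ‖f x y‖ ≤ C := by
  obtain ⟨ι, c, m, n, hs, hf⟩ := hf
  refine ⟨max 0 (∑' i, ‖c i‖ * (ρ ^ m i * ρ ^ n i)), le_max_left _ _,
    fun x y h1 h2 h3 h4 => le_trans ?_ (le_max_right _ _)⟩
  rw [← (hf x y h1 h2 h3 h4).tsum_eq]
  exact tsum_of_norm_bounded hs.hasSum fun i => norm_double_monomial_le _ _ _ h3 h4

/-- Along a curve in the open bidisc, a double series is given by a holomorphic function. -/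
theorem exists_differentiableOn (hf : IsDoubleSeries ρ f) {U : Set ℂ} (hU : IsOpen U)
    {x y : ℂ → ℂ} (hx : DifferentiableOn ℂ x U) (hy : DifferentiableOn ℂ y U)
    (hxρ : ∀ w ∈ U, ‖x w‖ ≤ ρ) (hyρ : ∀ w ∈ U, ‖y w‖ ≤ ρ) :
    ∃ h : ℂ → ℂ, DifferentiableOn ℂ h U ∧
      ∀ w ∈ U, x w ≠ 0 → y w ≠ 0 → f (x w) (y w) = h w := by
  obtain ⟨ι, c, m, n, hs, hf⟩ := hf
  refine ⟨fun w => ∑' i, c i * (x w ^ m i * y w ^ n i),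
    Complex.differentiableOn_tsum_of_summable_norm hs
      (fun i => ((hx.pow _).mul (hy.pow _)).const_mul _) hU
      fun i w hw => norm_double_monomial_le _ _ _ (hxρ w hw) (hyρ w hw),
    fun w hw h1 h2 => (hf _ _ h1 h2 (hxρ w hw) (hyρ w hw)).tsum_eq.symm⟩

end IsDoubleSeries

/-- The points `t` with `(e^t, a e^{-t})` in the open bidisc of radius `ρ`. -/
def bidiscStrip (ρ : ℝ) (a : ℂ) : Set ℂ := {t | ‖cexp t‖ < ρ ∧ ‖a * cexp (-t)‖ < ρ}

theorem isOpen_bidiscStrip (ρ : ℝ) (a : ℂ) : IsOpen (bidiscStrip ρ a) :=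
  (isOpen_lt (f := fun t => ‖cexp t‖) (by fun_prop) continuous_const).inter
    (isOpen_lt (f := fun t => ‖a * cexp (-t)‖) (by fun_prop) continuous_const)

/-- Along `t ↦ (e^t, a e^{-t})` a double series `f` is, up to a resonant part `f₀`, in the range of
the derivation minus `l`, for an integer `l`. -/
theorem IsDoubleSeries.exists_primitive {ρ : ℝ} {f : ℂ → ℂ → ℂ} (hf : IsDoubleSeries ρ f)
    (l : ℕ) : ∃ f₁ f₀ : ℂ → ℂ → ℂ, IsDoubleSeries ρ f₁ ∧ IsDoubleSeries ρ f₀ ∧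
      ∀ a t : ℂ, a ≠ 0 → t ∈ bidiscStrip ρ a →
        HasDerivAt (fun t => f₁ (cexp t) (a * cexp (-t)))
          (l * f₁ (cexp t) (a * cexp (-t)) + f (cexp t) (a * cexp (-t))
            - f₀ (cexp t) (a * cexp (-t))) t ∧
        HasDerivAt (fun t => f₀ (cexp t) (a * cexp (-t))) (l * f₀ (cexp t) (a * cexp (-t))) t := by
  obtain ⟨ι, c, m, n, hs, hf⟩ := hf
  -- Along the curve xᵐyⁿ = aⁿ e^{(m-n)t}, so `d` is the eigenvalue of ∂_t - l. A nonzero `d` is an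
  -- integer, hence |d| ≥ 1 and division by it preserves summability (no small divisors); the terms
  -- with `d = 0` form the resonant part.
  set d : ι → ℤ := fun i => m i - n i - l with hd
  have hdc : ∀ i, (d i : ℂ) = m i - n i - l := fun i => by simp [hd]
  have key : ∀ b : ι → ℂ, (∀ i, ‖b i‖ ≤ ‖c i‖) →
      IsDoubleSeries ρ (fun x y => ∑' i, b i * (x ^ m i * y ^ n i)) ∧
      ∀ a t : ℂ, t ∈ bidiscStrip ρ a → HasSum (fun i => (m i - n i : ℂ) *
          (b i * (cexp t ^ m i * (a * cexp (-t)) ^ n i)))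
        (deriv (fun t => ∑' i, b i * (cexp t ^ m i * (a * cexp (-t)) ^ n i)) t) ∧
        DifferentiableAt ℂ (fun t => ∑' i, b i * (cexp t ^ m i * (a * cexp (-t)) ^ n i)) t := by
    intro b hb
    have hbs : ∀ i x y, ‖x‖ ≤ ρ → ‖y‖ ≤ ρ → ‖b i * (x ^ m i * y ^ n i)‖
        ≤ ‖c i‖ * (ρ ^ m i * ρ ^ n i) := fun i x y hx hy => by
      have := (norm_nonneg x).trans hx
      refine (norm_double_monomial_le _ _ _ hx hy).trans ?_
      gcongr
      exact hb i
    refine ⟨?_, fun a t ht => ?_⟩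
    · by_cases hρ : 0 ≤ ρ
      · refine ⟨ι, b, m, n, Summable.of_nonneg_of_le (fun i => by positivity) (fun i => ?_) hs,
          fun x y _ _ hx hy => (Summable.of_norm_bounded hs fun i => hbs i x y hx hy).hasSum⟩
        gcongr
        exact hb i
      · exact ⟨Empty, Empty.elim, Empty.elim, Empty.elim, summable_empty,
          fun x y _ _ hx _ => absurd ((norm_nonneg x).trans hx) hρ⟩
    · have hbound : ∀ i, ∀ t ∈ bidiscStrip ρ a, ‖b i * (cexp t ^ m i * (a * cexp (-t)) ^ n i)‖
          ≤ ‖c i‖ * (ρ ^ m i * ρ ^ n i) := fun i t ht => hbs i _ _ ht.1.le ht.2.le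
      have hdm : ∀ i t, HasDerivAt (fun t => b i * (cexp t ^ m i * (a * cexp (-t)) ^ n i))
          ((m i - n i : ℂ) * (b i * (cexp t ^ m i * (a * cexp (-t)) ^ n i))) t := fun i t => by
        have h1 : (fun t => b i * (cexp t ^ m i * (a * cexp (-t)) ^ n i))
            = fun t => b i * a ^ n i * cexp ((m i - n i) * t) := by
          funext t
          rw [mul_pow, ← Complex.exp_nat_mul, ← Complex.exp_nat_mul, mul_left_comm _ (a ^ n i),
            ← Complex.exp_add, ← mul_assoc]
          congr 2
          ring
        rw [h1]
        have h2 := congrFun h1 t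
        rw [h2]
        refine ((((hasDerivAt_id t).const_mul (m i - n i : ℂ)).cexp).const_mul
          (b i * a ^ n i)).congr_deriv ?_
        simp only [id]
        ring
      have hdiff : ∀ i, DifferentiableOn ℂ (fun t => b i * (cexp t ^ m i * (a * cexp (-t)) ^ n i))
          (bidiscStrip ρ a) := fun i t _ => (hdm i t).differentiableAt.differentiableWithinAt
      refine ⟨?_, (Complex.differentiableOn_tsum_of_summable_norm hs hdiff
        (isOpen_bidiscStrip ρ a) hbound).differentiableAt ((isOpen_bidiscStrip ρ a).mem_nhds ht)⟩
      have := Complex.hasSum_deriv_of_summable_norm hs hdiff (isOpen_bidiscStrip ρ a) hbound ht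
      simpa only [(hdm _ _).deriv] using this
  set b₁ : ι → ℂ := fun i => if d i = 0 then 0 else c i / d i with hb₁
  set b₀ : ι → ℂ := fun i => if d i = 0 then c i else 0 with hb₀
  have hn₁ : ∀ i, ‖b₁ i‖ ≤ ‖c i‖ := fun i => by
    by_cases h : d i = 0
    · simp [hb₁, h]
    · simp only [hb₁, h, if_false, norm_div]
      refine div_le_self (norm_nonneg _) ?_
      rw [Complex.norm_intCast]
      exact_mod_cast Int.one_le_abs h
  have hn₀ : ∀ i, ‖b₀ i‖ ≤ ‖c i‖ := fun i => by
    by_cases h : d i = 0 <;> simp [hb₀, h]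
  obtain ⟨h1, h1'⟩ := key b₁ hn₁
  obtain ⟨h0, h0'⟩ := key b₀ hn₀
  refine ⟨_, _, h1, h0, fun a t ha ht => ?_⟩
  have hsum : ∀ b : ι → ℂ, (∀ i, ‖b i‖ ≤ ‖c i‖) → HasSum (fun i => b i *
      (cexp t ^ m i * (a * cexp (-t)) ^ n i))
      (∑' i, b i * (cexp t ^ m i * (a * cexp (-t)) ^ n i)) := fun b hb => by
    refine (Summable.of_norm_bounded hs fun i => ?_).hasSum
    refine (norm_double_monomial_le _ _ _ ht.1.le ht.2.le).trans ?_
    have := (norm_nonneg _).trans ht.1.le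
    gcongr
    exact hb i
  have hf' := hf (cexp t) (a * cexp (-t)) (exp_ne_zero _) (mul_ne_zero ha (exp_ne_zero _))
    ht.1.le ht.2.le
  constructor
  · obtain ⟨h2, h3⟩ := h1' a t ht
    have h4 := (((hsum b₁ hn₁).mul_left (l : ℂ)).add hf').sub (hsum b₀ hn₀)
    have h5 := h2.unique (h4.congr_fun fun i => by
      by_cases h : d i = 0
      · simp [hb₁, hb₀, h]
      · have hne : (d i : ℂ) ≠ 0 := Int.cast_ne_zero.2 h
        have h6 : (m i - n i : ℂ) = d i + l := by rw [hdc]; ring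
        simp only [hb₁, hb₀, h, if_false, zero_mul, sub_zero, h6]
        field_simp
        ring)
    rw [← h5]
    exact h3.hasDerivAt
  · obtain ⟨h2, h3⟩ := h0' a t ht
    have h4 := (hsum b₀ hn₀).mul_left (l : ℂ)
    have h5 := h2.unique (h4.congr_fun fun i => by
      by_cases h : d i = 0
      · have h6 : (m i - n i : ℂ) = l := by
          have := hdc i
          rw [h, Int.cast_zero] at this
          linear_combination -this
        rw [h6]
      · simp [hb₀, h])
    rw [← h5]
    exact h3.hasDerivAt

/-- Finite sums `∑ⱼ (a (t - c))ʲ fⱼ(e^t, a e^{-t})` with double series `fⱼ`. -/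
def IsLogSeries (ρ : ℝ) (c : ℂ) (F : ℂ → ℂ → ℂ) : Prop :=
  ∃ (J : ℕ) (f : ℕ → ℂ → ℂ → ℂ), (∀ j, IsDoubleSeries ρ (f j)) ∧ ∀ a t, F a t =
    ∑ j ∈ Finset.range J, (a * (t - c)) ^ j * f j (cexp t) (a * cexp (-t))

namespace IsLogSeries

variable {ρ : ℝ} {c : ℂ} {F G : ℂ → ℂ → ℂ}

theorem log_pow_mul {f : ℂ → ℂ → ℂ} (hf : IsDoubleSeries ρ f) (c : ℂ) (j : ℕ) :
    IsLogSeries ρ c fun a t => (a * (t - c)) ^ j * f (cexp t) (a * cexp (-t)) := by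
  refine ⟨j + 1, fun i => if i = j then f else fun _ _ => 0, fun i => ?_, fun a t => ?_⟩
  · by_cases h : i = j
    · simpa [h] using hf
    · simpa [h] using IsDoubleSeries.const ρ 0
  · rw [Finset.sum_eq_single_of_mem j (Finset.self_mem_range_succ j)]
    · simp
    · intro i _ hij
      simp [hij]

theorem of_doubleSeries {f : ℂ → ℂ → ℂ} (hf : IsDoubleSeries ρ f) (c : ℂ) :
    IsLogSeries ρ c fun a t => f (cexp t) (a * cexp (-t)) := by
  simpa using log_pow_mul hf c 0

theorem add (hF : IsLogSeries ρ c F) (hG : IsLogSeries ρ c G) :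
    IsLogSeries ρ c fun a t => F a t + G a t := by
  obtain ⟨J, f, hf, hF⟩ := hF
  obtain ⟨K, g, hg, hG⟩ := hG
  refine ⟨max J K, fun i x y => (if i < J then f i x y else 0) + (if i < K then g i x y else 0),
    fun i => ?_, fun a t => ?_⟩
  · refine IsDoubleSeries.add ?_ ?_
    · by_cases h : i < J
      · simpa [h] using hf i
      · simpa [h] using IsDoubleSeries.const ρ 0
    · by_cases h : i < K
      · simpa [h] using hg i
      · simpa [h] using IsDoubleSeries.const ρ 0
  · simp only [mul_add, Finset.sum_add_distrib, mul_ite, mul_zero]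
    rw [← Finset.sum_filter, ← Finset.sum_filter, hF, hG]
    congr 2 <;> (ext i; simp; omega)

theorem mul_doubleSeries (hF : IsLogSeries ρ c F) {g : ℂ → ℂ → ℂ} (hg : IsDoubleSeries ρ g) :
    IsLogSeries ρ c fun a t => g (cexp t) (a * cexp (-t)) * F a t := by
  obtain ⟨J, f, hf, hF⟩ := hF
  refine ⟨J, fun i x y => g x y * f i x y, fun i => hg.mul (hf i), fun a t => ?_⟩
  simp only [hF, Finset.mul_sum]
  refine Finset.sum_congr rfl fun i _ => ?_
  ring

theorem const_mul (hF : IsLogSeries ρ c F) (b : ℂ) : IsLogSeries ρ c fun a t => b * F a t :=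
  hF.mul_doubleSeries (IsDoubleSeries.const ρ b)

/-- The parameter is itself a double series along the curve, a = xy. -/
theorem param_mul (hF : IsLogSeries ρ c F) : IsLogSeries ρ c fun a t => a * F a t := by
  have := hF.mul_doubleSeries ((IsDoubleSeries.fst ρ).mul (IsDoubleSeries.snd ρ))
  have he : ∀ a t : ℂ, cexp t * (a * cexp (-t)) = a := fun a t => by
    rw [mul_left_comm, ← Complex.exp_add]; simp
  simpa only [he] using this

theorem zero (ρ : ℝ) (c : ℂ) : IsLogSeries ρ c fun _ _ => 0 := of_doubleSeries (.const ρ 0) c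

theorem sub (hF : IsLogSeries ρ c F) (hG : IsLogSeries ρ c G) :
    IsLogSeries ρ c fun a t => F a t - G a t := by
  simpa [sub_eq_add_neg] using hF.add (hG.const_mul (-1))

/-- `∂_t - l` is onto `a` times the log series. -/
theorem exists_primitive_log_pow (l : ℕ) (c : ℂ) (j : ℕ) :
    ∀ {f : ℂ → ℂ → ℂ}, IsDoubleSeries ρ f → ∃ G, IsLogSeries ρ c G ∧
      ∀ a t : ℂ, a ≠ 0 → t ∈ bidiscStrip ρ a → HasDerivAt (G a)
        (l * G a t + a * ((a * (t - c)) ^ j * f (cexp t) (a * cexp (-t)))) t := by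
  have hlog : ∀ (a t : ℂ) (j : ℕ), HasDerivAt (fun t => (a * (t - c)) ^ (j + 1))
      ((j + 1) * a * (a * (t - c)) ^ j) t := fun a t j => by
    refine ((((hasDerivAt_id t).sub_const c).const_mul a).pow (j + 1)).congr_deriv ?_
    simp
    ring
  induction j with
  | zero =>
    intro f hf
    obtain ⟨f₁, f₀, h1, h0, hd⟩ := hf.exists_primitive l
    -- The resonant part integrates to a factor t - c, and the prefactor a makes this the admissible
    -- a(t - c).
    refine ⟨fun a t => a * f₁ (cexp t) (a * cexp (-t)) + (a * (t - c)) ^ 1 *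
      f₀ (cexp t) (a * cexp (-t)), (of_doubleSeries h1 c).param_mul.add (log_pow_mul h0 c 1),
      fun a t ha ht => ?_⟩
    obtain ⟨hd1, hd0⟩ := hd a t ha ht
    refine ((hd1.const_mul a).add ((hlog a t 0).mul hd0)).congr_deriv ?_
    simp
    ring
  | succ j ih =>
    intro f hf
    obtain ⟨f₁, f₀, h1, h0, hd⟩ := hf.exists_primitive l
    obtain ⟨G, hG, hGd⟩ := ih h1
    -- Integration by parts: the resonant part raises the power of a(t - c) by one, and the
    -- derivative of that power, falling on the nonresonant primitive `f₁`, leaves a term of lower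
    -- power that the induction hypothesis removes through `G`.
    refine ⟨fun a t => a * ((a * (t - c)) ^ (j + 1) * f₁ (cexp t) (a * cexp (-t))) +
      1 / ((j : ℂ) + 2) * ((a * (t - c)) ^ (j + 1 + 1) * f₀ (cexp t) (a * cexp (-t)))
      - (j + 1) * (a * G a t), ((log_pow_mul h1 c (j + 1)).param_mul.add
        ((log_pow_mul h0 c (j + 1 + 1)).const_mul _)).sub (hG.param_mul.const_mul _),
      fun a t ha ht => ?_⟩
    obtain ⟨hd1, hd0⟩ := hd a t ha ht
    have h2 : (j : ℂ) + 2 ≠ 0 := by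
      have : ((j + 2 : ℕ) : ℂ) ≠ 0 := Nat.cast_ne_zero.2 (by omega)
      exact_mod_cast this
    refine (((((hlog a t j).mul hd1).const_mul a).add
      (((hlog a t (j + 1)).mul hd0).const_mul (1 / ((j : ℂ) + 2)))).sub
      (((hGd a t ha ht).const_mul a).const_mul ((j : ℂ) + 1))).congr_deriv ?_
    push_cast
    field_simp
    ring

theorem exists_primitive (hF : IsLogSeries ρ c F) (l : ℕ) : ∃ G, IsLogSeries ρ c G ∧
    ∀ a t : ℂ, a ≠ 0 → t ∈ bidiscStrip ρ a → HasDerivAt (G a) (l * G a t + a * F a t) t := by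
  obtain ⟨J, f, hf, hF⟩ := hF
  obtain rfl : F = fun a t => ∑ j ∈ Finset.range J, (a * (t - c)) ^ j *
      f j (cexp t) (a * cexp (-t)) := by
    funext a t; exact hF a t
  clear hF
  induction J with
  | zero =>
    refine ⟨_, zero ρ c, fun a t _ _ => ?_⟩
    simpa using hasDerivAt_const t (0 : ℂ)
  | succ J ih =>
    obtain ⟨G, hG, hGd⟩ := ih
    obtain ⟨H, hH, hHd⟩ := exists_primitive_log_pow (ρ := ρ) l c J (hf J)
    refine ⟨_, hG.add hH, fun a t ha ht => ?_⟩
    refine ((hGd a t ha ht).add (hHd a t ha ht)).congr_deriv ?_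
    simp only [Finset.sum_range_succ]
    ring

end IsLogSeries

/-! ### The change of unknowns and its coefficients -/

/-- The entire function `(1 - e^{-x}) / x`. -/
noncomputable def expQuot (x : ℂ) : ℂ := (1 - cexp (-x)) / x

/-- The entire function `(x - 1 + e^{-x}) / x²`. -/
noncomputable def expQuot₂ (x : ℂ) : ℂ := (1 - expQuot x) / x

/-- The function `1 + (1 - y) log (1 - y) / y = ∑ yⁿ / (n (n + 1))`. -/
noncomputable def logQuot (y : ℂ) : ℂ := 1 + (1 - y) * log (1 - y) / y

theorem hasSum_exp (x : ℂ) : HasSum (fun k : ℕ => x ^ k / (k.factorial : ℂ)) (cexp x) := by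
  rw [Complex.exp_eq_exp_ℂ]
  exact NormedSpace.expSeries_div_hasSum_exp x

theorem summable_inv_factorial_add (ρ : ℝ) (hρ : 0 ≤ ρ) (c : ℕ → ℂ) (s : ℕ)
    (hc : ∀ k, ‖c k‖ = ((k + s).factorial : ℝ)⁻¹) : Summable fun k => ‖c k‖ * ρ ^ k := by
  refine Summable.of_nonneg_of_le (fun k => by positivity) (fun k => ?_)
    (Real.summable_pow_div_factorial ρ)
  rw [hc, div_eq_inv_mul]
  gcongr
  omega

theorem isDoubleSeries_exp {ρ : ℝ} (hρ : 0 ≤ ρ) : IsDoubleSeries ρ fun x _ => cexp x := by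
  refine IsDoubleSeries.of_fst (c := fun k => (k.factorial : ℂ)⁻¹)
    (summable_inv_factorial_add ρ hρ _ 0 fun k => by simp) fun x _ _ => ?_
  simpa [div_eq_inv_mul] using hasSum_exp x

theorem isDoubleSeries_exp_neg {ρ : ℝ} (hρ : 0 ≤ ρ) : IsDoubleSeries ρ fun x _ => cexp (-x) := by
  refine IsDoubleSeries.of_fst (c := fun k => (-1) ^ k * (k.factorial : ℂ)⁻¹)
    (summable_inv_factorial_add ρ hρ _ 0 fun k => by simp) fun x _ _ => ?_
  refine (hasSum_exp (-x)).congr_fun fun k => ?_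
  rw [neg_pow]
  ring

theorem hasSum_expQuot {x : ℂ} (hx : x ≠ 0) :
    HasSum (fun k : ℕ => (-1) ^ k * ((k + 1).factorial : ℂ)⁻¹ * x ^ k) (expQuot x) := by
  have h := ((hasSum_nat_add_iff' 1).2 (hasSum_exp (-x))).mul_left (-x⁻¹)
  convert! h using 1
  · funext k
    rw [neg_pow]
    field_simp
    ring
  · simp [expQuot]
    field_simp
    ring

theorem hasSum_expQuot₂ {x : ℂ} (hx : x ≠ 0) :
    HasSum (fun k : ℕ => (-1) ^ k * ((k + 2).factorial : ℂ)⁻¹ * x ^ k) (expQuot₂ x) := by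
  have h := ((hasSum_nat_add_iff' 1).2 (hasSum_expQuot hx)).mul_left (-x⁻¹)
  convert! h using 1
  · funext k
    field_simp
    ring
  · simp [expQuot₂]
    field_simp
    ring

/-- The exclusion of the axes in `IsDoubleSeries` matters here: at x = 0 the quotient has the value
0, while its power series has the value 1. -/
theorem isDoubleSeries_expQuot {ρ : ℝ} (hρ : 0 ≤ ρ) : IsDoubleSeries ρ fun x _ => expQuot x :=
  IsDoubleSeries.of_fst (summable_inv_factorial_add ρ hρ _ 1 fun k => by simp)
    fun _ hx _ => hasSum_expQuot hx

theorem isDoubleSeries_expQuot₂ {ρ : ℝ} (hρ : 0 ≤ ρ) : IsDoubleSeries ρ fun x _ => expQuot₂ x :=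
  IsDoubleSeries.of_fst (summable_inv_factorial_add ρ hρ _ 2 fun k => by simp)
    fun _ hx _ => hasSum_expQuot₂ hx

theorem isDoubleSeries_inv_one_sub {ρ : ℝ} (hρ : 0 ≤ ρ) (hρ1 : ρ < 1) :
    IsDoubleSeries ρ fun _ y => (1 - y)⁻¹ := by
  refine IsDoubleSeries.of_snd (c := fun _ => 1) ?_ fun y _ hy => ?_
  · simpa using summable_geometric_of_lt_one hρ hρ1
  · simpa using hasSum_geometric_of_norm_lt_one (hy.trans_lt hρ1)

theorem isDoubleSeries_logQuot {ρ : ℝ} (hρ : 0 ≤ ρ) (hρ1 : ρ < 1) :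
    IsDoubleSeries ρ fun _ y => logQuot y := by
  -- For k ≥ 1 this is 1/k - 1/(k+1) = 1/(k(k+1)). At k = 0 the convention 0⁻¹ = 0 gives -1, which
  -- the added 1 corrects.
  refine IsDoubleSeries.of_snd (c := fun k => (k : ℂ)⁻¹ - ((k + 1 : ℕ) : ℂ)⁻¹ +
    if k = 0 then 1 else 0) ?_ fun y hy0 hy => ?_
  · refine Summable.of_nonneg_of_le (fun k => by positivity) (fun k => ?_)
      ((summable_geometric_of_lt_one hρ hρ1).mul_left 3)
    gcongr
    refine (norm_add_le _ _).trans ?_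
    have h1 : ∀ k : ℕ, ‖(k : ℂ)⁻¹‖ ≤ 1 := fun k => by
      rw [norm_inv, Complex.norm_natCast]
      exact Nat.cast_inv_le_one k
    have h2 := norm_sub_le (k : ℂ)⁻¹ ((k + 1 : ℕ) : ℂ)⁻¹
    have h3 := h1 k
    have h4 := h1 (k + 1)
    have h5 : ‖(if k = 0 then 1 else 0 : ℂ)‖ ≤ 1 := by split_ifs <;> simp
    linarith
  · have hL := hasSum_taylorSeries_neg_log (hy.trans_lt hρ1)
    have hL1 := ((hasSum_nat_add_iff' 1).2 hL).mul_left y⁻¹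
    have h1 : HasSum (fun k : ℕ => (if k = 0 then (1 : ℂ) else 0)) 1 := by
      simpa using hasSum_ite_eq (0 : ℕ) (1 : ℂ)
    convert! (hL.sub hL1).add h1 using 1
    · funext k
      by_cases hk : k = 0
      · simp [hk]
        field_simp
        ring
      · simp only [hk, if_false, add_zero]
        have : (k : ℂ) ≠ 0 := Nat.cast_ne_zero.2 hk
        field_simp
        ring
    · simp [logQuot]
      field_simp
      ring

theorem hasDerivAt_expQuot_exp (t : ℂ) : HasDerivAt (fun t => expQuot (cexp t))
    (cexp (-cexp t) - expQuot (cexp t)) t := by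
  have h := (((Complex.hasDerivAt_exp t).neg.cexp).const_sub 1).div (Complex.hasDerivAt_exp t)
    (exp_ne_zero t)
  refine h.congr_deriv ?_
  have := exp_ne_zero t
  simp only [expQuot, Pi.neg_apply]
  field_simp

theorem hasDerivAt_mul_exp_neg (a t : ℂ) :
    HasDerivAt (fun t => a * cexp (-t)) (-(a * cexp (-t))) t :=
  (((hasDerivAt_id t).neg.cexp).const_mul a).congr_deriv (by simp)

theorem hasDerivAt_logQuot_exp {a t : ℂ} (ha : a ≠ 0) (hy : ‖a * cexp (-t)‖ < 1) :
    HasDerivAt (fun t => logQuot (a * cexp (-t)))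
      ((logQuot (a * cexp (-t)) - a * cexp (-t)) / (1 - a * cexp (-t))) t := by
  have hd := hasDerivAt_mul_exp_neg a t
  have h0 : a * cexp (-t) ≠ 0 := mul_ne_zero ha (exp_ne_zero _)
  have h1 : 1 - a * cexp (-t) ∈ slitPlane := by
    rw [sub_eq_add_neg]
    exact Complex.mem_slitPlane_of_norm_lt_one (by rwa [norm_neg])
  have h := (((hd.const_sub 1).mul ((hd.const_sub 1).clog h1)).div hd h0).const_add 1
  refine h.congr_deriv ?_
  have := slitPlane_ne_zero h1
  simp only [logQuot, Pi.mul_apply]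
  field_simp
  ring

/-- The static and asymptotic gauge: in the variables `α = (1 - y) ψ - E κ` and
`γ = g ψ + (e^{-x} - g E) / (1 - y) κ` the system `ψ' = κ / (1 - y)`,
`κ' = κ + x κ / (1 - y) + y ψ` along `x = e^t`, `y = a e^{-t}` is diagonal up to terms of size `a`. -/
theorem hasDerivAt_gauge {a t : ℂ} {ψ κ : ℂ → ℂ} {x y E E₂ g : ℂ}
    (hx : x = cexp t) (hy : y = a * cexp (-t)) (hE : E = expQuot x) (hE₂ : E₂ = expQuot₂ x)
    (hg : g = logQuot y) (ha : a ≠ 0) (hy1 : ‖y‖ < 1)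
    (hψ : HasDerivAt ψ (κ t * (1 - y)⁻¹) t)
    (hκ : HasDerivAt κ (κ t + x * κ t * (1 - y)⁻¹ + y * ψ t) t) :
    HasDerivAt (fun t => (1 - a * cexp (-t)) * ψ t - expQuot (cexp t) * κ t)
        (a * (E₂ * ψ t - E * (1 - y)⁻¹ * κ t)) t ∧
      HasDerivAt (fun t => logQuot (a * cexp (-t)) * ψ t + (cexp (-cexp t)
          - logQuot (a * cexp (-t)) * expQuot (cexp t)) * (1 - a * cexp (-t))⁻¹ * κ t)
        (g * ψ t + (cexp (-x) - g * E) * (1 - y)⁻¹ * κ t +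
          a * ((g * E₂ - E) * (1 - y)⁻¹ * ψ t +
            (cexp (-x) + E - E₂ - g * E) * (1 - y)⁻¹ ^ 2 * κ t)) t := by
  subst hx hy
  have hx0 : cexp t ≠ 0 := exp_ne_zero t
  have hxy : cexp t * (a * cexp (-t)) = a := by
    rw [mul_left_comm, ← Complex.exp_add]; simp
  have h1y : 1 - a * cexp (-t) ≠ 0 := by
    rw [sub_ne_zero]
    rintro h
    rw [← h, norm_one] at hy1
    exact lt_irrefl _ hy1
  have hd := hasDerivAt_mul_exp_neg a t
  have hdE := hasDerivAt_expQuot_exp t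
  have hdg := hasDerivAt_logQuot_exp ha hy1
  have hde := (Complex.hasDerivAt_exp t).neg.cexp
  -- The relations e^{-x} = 1 - xE and E = 1 - xE₂ extract factors of x, so that every term that
  -- does not cancel carries the product xy = a.
  have hEx : cexp (-cexp t) = 1 - cexp t * E := by
    rw [hE, expQuot]; field_simp; ring
  have hE₂x : E = 1 - cexp t * E₂ := by
    rw [hE, hE₂, expQuot₂]; field_simp; ring
  rw [← hE] at hdE
  rw [← hg] at hdg
  simp only [Pi.neg_apply] at hde
  constructor
  · refine (((hd.const_sub 1).mul hψ).sub (hdE.mul hκ)).congr_deriv ?_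
    rw [← hE, hEx]
    generalize cexp t = x at *
    generalize a * cexp (-t) = y at *
    rw [← hxy]
    field_simp
    rw [hE₂x]
    ring
  · refine ((hdg.mul hψ).add (((hde.sub (hdg.mul hdE)).mul
      ((hd.const_sub 1).inv h1y)).mul hκ)).congr_deriv ?_
    simp only [Pi.mul_apply, Pi.sub_apply, Pi.inv_apply]
    rw [← hE, ← hg, hEx]
    generalize cexp t = x at *
    generalize a * cexp (-t) = y at *
    rw [← hxy]
    field_simp
    rw [hE₂x]
    ring

/-- Taylor polynomials with remainder. -/
theorem AnalyticAt.exists_taylor {h : ℂ → ℂ} (hh : AnalyticAt ℂ h 0) (k : ℕ) :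
    ∃ (p : ℕ → ℂ) (C δ : ℝ), 0 ≤ C ∧ 0 < δ ∧ ∀ a : ℂ, ‖a‖ < δ →
      ‖h a - ∑ i ∈ Finset.range k, p i * a ^ i‖ ≤ C * ‖a‖ ^ k := by
  obtain ⟨q, hq⟩ := hh
  obtain ⟨C, hC⟩ := (hq.isBigO_sub_partialSum_pow k).bound
  obtain ⟨δ, hδ, hδC⟩ := Metric.eventually_nhds_iff.1 hC
  refine ⟨q.coeff, max C 0, δ, le_max_right _ _, hδ, fun a ha => ?_⟩
  have := hδC (y := a) (by simpa using ha)
  rw [zero_add, norm_pow, norm_norm] at this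
  have hsum : q.partialSum k a = ∑ i ∈ Finset.range k, q.coeff i * a ^ i := by
    rw [FormalMultilinearSeries.partialSum]
    refine Finset.sum_congr rfl fun i _ => ?_
    rw [FormalMultilinearSeries.apply_eq_pow_smul_coeff, smul_eq_mul, mul_comm]
  rw [← hsum]
  refine this.trans ?_
  gcongr
  exact le_max_left _ _

/-- At a fixed point `t₀` a log series is analytic in the parameter. -/
theorem IsLogSeries.analyticAt_param {ρ : ℝ} {c : ℂ} {F : ℂ → ℂ → ℂ} (hF : IsLogSeries ρ c F)
    (hρ : 0 < ρ) {t₀ : ℂ} (ht₀ : ‖cexp t₀‖ ≤ ρ) :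
    ∃ h : ℂ → ℂ, AnalyticAt ℂ h 0 ∧ ∃ δ > 0, ∀ a, a ≠ 0 → ‖a‖ < δ → F a t₀ = h a := by
  obtain ⟨J, f, hf, hF⟩ := hF
  set δ : ℝ := ρ / ‖cexp (-t₀)‖ with hδ
  have hn : 0 < ‖cexp (-t₀)‖ := norm_pos_iff.2 (exp_ne_zero _)
  have hδ0 : 0 < δ := by positivity
  choose h hh hfh using fun j => (hf j).exists_differentiableOn (U := Metric.ball 0 δ)
    Metric.isOpen_ball (x := fun _ => cexp t₀) (y := fun a => a * cexp (-t₀))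
    (differentiableOn_const _) (differentiableOn_id.mul_const _) (fun _ _ => ht₀)
    (fun a ha => by
      rw [norm_mul]
      rw [mem_ball_zero_iff, hδ, lt_div_iff₀ hn] at ha
      exact ha.le)
  refine ⟨fun a => ∑ j ∈ Finset.range J, (a * (t₀ - c)) ^ j * h j a, ?_, δ, hδ0,
    fun a ha had => ?_⟩
  · refine DifferentiableOn.analyticAt (s := Metric.ball 0 δ) ?_ (Metric.ball_mem_nhds _ hδ0)
    exact DifferentiableOn.fun_sum fun j _ => ((differentiableOn_id.mul_const _).pow j).mul (hh j)
  · rw [hF]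
    refine Finset.sum_congr rfl fun j _ => ?_
    rw [hfh j a (mem_ball_zero_iff.2 had) (exp_ne_zero _) (mul_ne_zero ha (exp_ne_zero _))]

/-! ### Expansions modulo powers of a log a on logarithmic rectangles -/

/-- The points `t` with `500 |a| ≤ |e^t| ≤ 1/4` and `|Im t| ≤ 3π/4`. -/
def logRectangle (a : ℂ) : Set ℂ :=
  {t | Real.log (500 * ‖a‖) ≤ t.re ∧ t.re ≤ Real.log (1 / 4) ∧ |t.im| ≤ 3 * Real.pi / 4}

theorem convex_logRectangle (a : ℂ) : Convex ℝ (logRectangle a) := by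
  have h1 : Convex ℝ {t : ℂ | Real.log (500 * ‖a‖) ≤ t.re} := convex_halfSpace_re_ge _
  have h2 : Convex ℝ {t : ℂ | t.re ≤ Real.log (1 / 4)} := convex_halfSpace_re_le _
  have h3 : Convex ℝ {t : ℂ | -(3 * Real.pi / 4) ≤ t.im} := convex_halfSpace_im_ge _
  have h4 : Convex ℝ {t : ℂ | t.im ≤ 3 * Real.pi / 4} := convex_halfSpace_im_le _
  convert! h1.inter (h2.inter (h3.inter h4)) using 1
  ext t
  simp [logRectangle, abs_le]

/-- The size of `a log a`. -/
noncomputable def logSize (a : ℂ) : ℝ := ‖a‖ * (20 + |Real.log ‖a‖|)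

theorem norm_le_logSize (a : ℂ) : ‖a‖ ≤ logSize a := by
  unfold logSize
  nlinarith [norm_nonneg a, abs_nonneg (Real.log ‖a‖)]

theorem logSize_nonneg (a : ℂ) : 0 ≤ logSize a := (norm_nonneg a).trans (norm_le_logSize a)

section Rectangle

variable {a t : ℂ} (ha : a ≠ 0) (ht : t ∈ logRectangle a)
include ht

theorem logRectangle_norm_exp_le : ‖cexp t‖ ≤ 1 / 4 := by
  rw [norm_exp, ← Real.le_log_iff_exp_le (by norm_num)]
  exact ht.2.1

theorem logRectangle_base : ((Real.log (1 / 4) : ℝ) : ℂ) ∈ logRectangle a := by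
  refine ⟨?_, ?_, ?_⟩
  · rw [ofReal_re]; exact ht.1.trans ht.2.1
  · rw [ofReal_re]
  · rw [ofReal_im, abs_zero]; positivity

include ha

theorem logRectangle_le_norm_exp : 500 * ‖a‖ ≤ ‖cexp t‖ := by
  rw [norm_exp, ← Real.log_le_iff_le_exp (by positivity)]
  exact ht.1

theorem logRectangle_norm_mul_exp_le : ‖a * cexp (-t)‖ ≤ 1 / 500 := by
  rw [Complex.exp_neg, norm_mul, norm_inv, ← div_eq_mul_inv,
    div_le_iff₀ (norm_pos_iff.2 (exp_ne_zero t))]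
  linarith [logRectangle_le_norm_exp ha ht]

theorem logRectangle_subset_bidiscStrip : t ∈ bidiscStrip (1 / 2) a :=
  ⟨(logRectangle_norm_exp_le ht).trans_lt (by norm_num),
    (logRectangle_norm_mul_exp_le ha ht).trans_lt (by norm_num)⟩

/-- The distance to the right end is at most |log ‖a‖| + 3π/4. This length times the prefactor a is
the gain of one integration. -/
theorem norm_mul_norm_sub_le_logSize : ‖a‖ * ‖t - (Real.log (1 / 4) : ℝ)‖ ≤ logSize a := by
  unfold logSize
  gcongr
  refine (norm_le_abs_re_add_abs_im _).trans ?_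
  rw [sub_re, sub_im, ofReal_re, ofReal_im, sub_zero, abs_of_nonpos (by linarith [ht.2.1])]
  have h1 := ht.1
  have h3 := ht.2.2
  rw [Real.log_mul (by norm_num) (norm_ne_zero_iff.2 ha)] at h1
  have h4 : 0 ≤ Real.log 500 := Real.log_nonneg (by norm_num)
  have h5 : Real.log (1 / 4) ≤ 0 := Real.log_nonpos (by norm_num) (by norm_num)
  have h6 := neg_abs_le (Real.log ‖a‖)
  linarith [Real.pi_lt_four]

end Rectangle

/-- `Φ a t` agrees with a log series up to `O((a log a)ᵏ)`, uniformly on the rectangles. -/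
def HasLogExpansion (c : ℂ) (k : ℕ) (Φ : ℂ → ℂ → ℂ) : Prop :=
  ∃ F, IsLogSeries (1 / 2) c F ∧ ∃ C δ : ℝ, 0 ≤ C ∧ 0 < δ ∧ ∀ a t, a ≠ 0 → ‖a‖ < δ →
    t ∈ logRectangle a → ‖Φ a t - F a t‖ ≤ C * logSize a ^ k

namespace HasLogExpansion

variable {c : ℂ} {k : ℕ} {Φ Ψ : ℂ → ℂ → ℂ}

theorem add (hΦ : HasLogExpansion c k Φ) (hΨ : HasLogExpansion c k Ψ) :
    HasLogExpansion c k fun a t => Φ a t + Ψ a t := by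
  obtain ⟨F, hF, C, δ, hC, hδ, hb⟩ := hΦ
  obtain ⟨G, hG, D, ε, hD, hε, hb'⟩ := hΨ
  refine ⟨_, hF.add hG, C + D, min δ ε, by positivity, by positivity, fun a t ha haδ ht => ?_⟩
  have h1 := hb a t ha (haδ.trans_le (min_le_left _ _)) ht
  have h2 := hb' a t ha (haδ.trans_le (min_le_right _ _)) ht
  calc _ = ‖(Φ a t - F a t) + (Ψ a t - G a t)‖ := by congr 1; ring
    _ ≤ _ := (norm_add_le _ _).trans (by linarith)

theorem mul_doubleSeries (hΦ : HasLogExpansion c k Φ) {f : ℂ → ℂ → ℂ}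
    (hf : IsDoubleSeries (1 / 2) f) :
    HasLogExpansion c k fun a t => f (cexp t) (a * cexp (-t)) * Φ a t := by
  obtain ⟨F, hF, C, δ, hC, hδ, hb⟩ := hΦ
  obtain ⟨B, hB, hfB⟩ := hf.bounded
  refine ⟨_, hF.mul_doubleSeries hf, B * C, δ, by positivity, hδ, fun a t ha haδ ht => ?_⟩
  have hs := logRectangle_subset_bidiscStrip ha ht
  rw [← mul_sub, norm_mul, mul_assoc]
  exact mul_le_mul (hfB _ _ (exp_ne_zero _) (mul_ne_zero ha (exp_ne_zero _)) hs.1.le hs.2.le)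
    (hb a t ha haδ ht) (norm_nonneg _) hB

/-- Integrating `∂_t Φ = l Φ + a R` from the right end of the rectangle improves the expansion by
one order. -/
theorem integrate {R : ℂ → ℂ → ℂ} (hR : HasLogExpansion c k R) (l : ℕ) {δ₀ : ℝ} (hδ₀ : 0 < δ₀)
    (hd : ∀ a t, a ≠ 0 → ‖a‖ < δ₀ → t ∈ logRectangle a →
      HasDerivAt (Φ a) (l * Φ a t + a * R a t) t)
    {h : ℂ → ℂ} (hh : AnalyticAt ℂ h 0)
    (hΦ : ∀ a, a ≠ 0 → ‖a‖ < δ₀ → Φ a (Real.log (1 / 4) : ℝ) = h a) :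
    HasLogExpansion c (k + 1) Φ := by
  obtain ⟨F, hF, C, δ, hC, hδ, hb⟩ := hR
  obtain ⟨G, hG, hGd⟩ := hF.exists_primitive l
  set t₀ : ℂ := ((Real.log (1 / 4) : ℝ) : ℂ) with ht₀
  have het₀ : ‖cexp t₀‖ ≤ 1 / 2 := by
    rw [ht₀, ← ofReal_exp, norm_real, Real.exp_log (by norm_num)]
    norm_num
  obtain ⟨g, hg, δ₁, hδ₁, hGg⟩ := hG.analyticAt_param (by norm_num) het₀
  obtain ⟨p, D, δ₂, hD, hδ₂, hp⟩ := (hh.sub hg).exists_taylor (k + 1)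
  have hxy : ∀ a t : ℂ, cexp t * (a * cexp (-t)) = a := fun a t => by
    rw [mul_left_comm, ← Complex.exp_add]; simp
  -- The primitive `G` has the wrong value at the base point. The correction is e^{l(t - t₀)} times
  -- a Taylor polynomial of the difference, and it is again a log series because a = xy.
  have hpoly : IsLogSeries (1 / 2) c fun a t => cexp t ^ l * (cexp (-(l * t₀)) *
      ∑ i ∈ Finset.range (k + 1), p i * a ^ i) := by
    have h1 : IsDoubleSeries (1 / 2) fun x y => x ^ l * (cexp (-(l * t₀)) *
        ∑ i ∈ Finset.range (k + 1), p i * (x * y) ^ i) :=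
      ((IsDoubleSeries.fst _).pow l).mul ((IsDoubleSeries.sum _ fun i _ =>
        (((IsDoubleSeries.fst _).mul (.snd _)).pow i).const_mul (p i)).const_mul _)
    simpa only [hxy] using IsLogSeries.of_doubleSeries h1 c
  refine ⟨_, hG.add hpoly, C + D, min δ₀ (min δ (min δ₁ δ₂)), by positivity, by positivity,
    fun a t ha haδ ht => ?_⟩
  have ha₀ : ‖a‖ < δ₀ := haδ.trans_le (min_le_left _ _)
  have haδ' : ‖a‖ < δ := haδ.trans_le ((min_le_right _ _).trans (min_le_left _ _))
  have ha₁ : ‖a‖ < δ₁ :=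
    haδ.trans_le ((min_le_right _ _).trans ((min_le_right _ _).trans (min_le_left _ _)))
  have ha₂ : ‖a‖ < δ₂ :=
    haδ.trans_le ((min_le_right _ _).trans ((min_le_right _ _).trans (min_le_right _ _)))
  have hbase : t₀ ∈ logRectangle a := logRectangle_base ht
  have hη := logSize_nonneg a
  -- Only points to the right of t are used: there the integrating factor e^{-ls} is at most e^{-l
  -- Re t}, which is exactly undone by multiplication with e^{lt}.
  set S : Set ℂ := logRectangle a ∩ {s | t.re ≤ s.re} with hS
  have hSc : Convex ℝ S := (convex_logRectangle a).inter (convex_halfSpace_re_ge _)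
  have hder : ∀ s ∈ S, HasDerivWithinAt (fun s => cexp (-(l * s)) * (Φ a s - G a s))
      (cexp (-(l * s)) * (a * (R a s - F a s))) S s := fun s hs => by
    have h1 : HasDerivAt (fun s : ℂ => cexp (-(l * s))) (cexp (-(l * s)) * -l) s := by
      simpa using ((hasDerivAt_id s).const_mul (l : ℂ)).neg.cexp
    refine ((h1.mul ((hd a s ha ha₀ hs.1).sub
      (hGd a s ha (logRectangle_subset_bidiscStrip ha hs.1)))).congr_deriv ?_).hasDerivWithinAt
    simp only [Pi.sub_apply]
    ring
  have hexp : ∀ s : ℂ, ‖cexp (-(l * s))‖ = Real.exp (-(l * s.re)) := fun s => by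
    rw [norm_exp]; simp
  have hbound : ∀ s ∈ S, ‖cexp (-(l * s)) * (a * (R a s - F a s))‖
      ≤ Real.exp (-(l * t.re)) * (‖a‖ * (C * logSize a ^ k)) := fun s hs => by
    rw [norm_mul, norm_mul, hexp]
    have h1 := hb a s ha haδ' hs.1
    have h2 : t.re ≤ s.re := hs.2
    gcongr
  have htS : t ∈ S := ⟨ht, le_refl t.re⟩
  have hbS : t₀ ∈ S := ⟨hbase, by
    change t.re ≤ t₀.re
    rw [ht₀, ofReal_re]
    exact ht.2.1⟩
  have hmv := Convex.norm_image_sub_le_of_norm_hasDerivWithin_le hder hbound hSc hbS htS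
  rw [hΦ a ha ha₀, hGg a ha ha₁] at hmv
  have hcancel : cexp (l * t) * cexp (-(l * t)) = 1 := by rw [← Complex.exp_add]; simp
  have hpow : cexp t ^ l = cexp (l * t) := by rw [Complex.exp_nat_mul]
  have hdec : Φ a t - (G a t + cexp t ^ l * (cexp (-(l * t₀)) *
      ∑ i ∈ Finset.range (k + 1), p i * a ^ i))
      = cexp (l * t) * (cexp (-(l * t)) * (Φ a t - G a t) - cexp (-(l * t₀)) * (h a - g a))
        + cexp (l * t) * cexp (-(l * t₀)) *
          ((h - g) a - ∑ i ∈ Finset.range (k + 1), p i * a ^ i) := by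
    rw [hpow, Pi.sub_apply]
    linear_combination -(Φ a t - G a t) * hcancel
  have hn1 : ‖cexp (l * t)‖ = Real.exp (l * t.re) := by rw [norm_exp]; simp
  have hn2 : ‖cexp (l * t) * cexp (-(l * t₀))‖ ≤ 1 := by
    rw [norm_mul, hn1, hexp, ← Real.exp_add, Real.exp_le_one_iff]
    have h2 : t.re ≤ t₀.re := hbS.2
    have : (l : ℝ) * t.re ≤ l * t₀.re := by gcongr
    linarith
  rw [hdec]
  refine (norm_add_le _ _).trans ?_
  rw [norm_mul, norm_mul (cexp (l * t) * _), add_mul]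
  have hlog := norm_mul_norm_sub_le_logSize ha ht
  refine add_le_add ?_ ?_
  · calc _ ≤ Real.exp (l * t.re) * (Real.exp (-(l * t.re)) * (‖a‖ * (C * logSize a ^ k))
          * ‖t - t₀‖) := by rw [hn1]; gcongr
      _ = (Real.exp (l * t.re) * Real.exp (-(l * t.re))) * (C * logSize a ^ k
          * (‖a‖ * ‖t - t₀‖)) := by ring
      _ = C * logSize a ^ k * (‖a‖ * ‖t - t₀‖) := by
          rw [← Real.exp_add]; simp
      _ ≤ C * logSize a ^ k * logSize a := by gcongr
      _ = _ := by ring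
  · calc _ ≤ 1 * (D * ‖a‖ ^ (k + 1)) := by
          gcongr
          exact hp a ha₂
      _ ≤ _ := by
          rw [one_mul]
          gcongr
          exact norm_le_logSize a

end HasLogExpansion

/-- Solutions of a system `α' = a (A₁₁ α + A₁₂ γ)`, `γ' = γ + a (A₂₁ α + A₂₂ γ)` have log
expansions of every order. -/
theorem hasLogExpansion_of_system {α γ : ℂ → ℂ → ℂ} {A₁₁ A₁₂ A₂₁ A₂₂ : ℂ → ℂ → ℂ}
    (h₁₁ : IsDoubleSeries (1 / 2) A₁₁) (h₁₂ : IsDoubleSeries (1 / 2) A₁₂)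
    (h₂₁ : IsDoubleSeries (1 / 2) A₂₁) (h₂₂ : IsDoubleSeries (1 / 2) A₂₂)
    {δ₀ : ℝ} (hδ₀ : 0 < δ₀)
    (hα : ∀ a t, a ≠ 0 → ‖a‖ < δ₀ → t ∈ logRectangle a → HasDerivAt (α a)
      (a * (A₁₁ (cexp t) (a * cexp (-t)) * α a t + A₁₂ (cexp t) (a * cexp (-t)) * γ a t)) t)
    (hγ : ∀ a t, a ≠ 0 → ‖a‖ < δ₀ → t ∈ logRectangle a → HasDerivAt (γ a)
      (γ a t + a * (A₂₁ (cexp t) (a * cexp (-t)) * α a t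
        + A₂₂ (cexp t) (a * cexp (-t)) * γ a t)) t)
    {C : ℝ} (hC : 0 ≤ C) (hαC : ∀ a t, a ≠ 0 → ‖a‖ < δ₀ → t ∈ logRectangle a → ‖α a t‖ ≤ C)
    (hγC : ∀ a t, a ≠ 0 → ‖a‖ < δ₀ → t ∈ logRectangle a → ‖γ a t‖ ≤ C)
    {h₁ h₂ : ℂ → ℂ} (hh₁ : AnalyticAt ℂ h₁ 0) (hh₂ : AnalyticAt ℂ h₂ 0)
    (hα₀ : ∀ a, a ≠ 0 → ‖a‖ < δ₀ → α a (Real.log (1 / 4) : ℝ) = h₁ a)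
    (hγ₀ : ∀ a, a ≠ 0 → ‖a‖ < δ₀ → γ a (Real.log (1 / 4) : ℝ) = h₂ a) (c : ℂ) (k : ℕ) :
    HasLogExpansion c k α ∧ HasLogExpansion c k γ := by
  induction k with
  | zero =>
    have : ∀ {Φ : ℂ → ℂ → ℂ}, (∀ a t, a ≠ 0 → ‖a‖ < δ₀ → t ∈ logRectangle a → ‖Φ a t‖ ≤ C) →
        HasLogExpansion c 0 Φ := fun h =>
      ⟨_, .zero _ c, C, δ₀, hC, hδ₀, fun a t ha had ht => by simpa using h a t ha had ht⟩
    exact ⟨this hαC, this hγC⟩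
  | succ k ih =>
    obtain ⟨ih1, ih2⟩ := ih
    constructor
    · refine ((ih1.mul_doubleSeries h₁₁).add (ih2.mul_doubleSeries h₁₂)).integrate 0 hδ₀
        (fun a t ha had ht => ?_) hh₁ hα₀
      simpa using hα a t ha had ht
    · refine ((ih1.mul_doubleSeries h₂₁).add (ih2.mul_doubleSeries h₂₂)).integrate 1 hδ₀
        (fun a t ha had ht => ?_) hh₂ hγ₀
      simpa using hγ a t ha had ht

/-- This is the sector |arg x| ≤ 3π/4, which contains a neighbourhood of both imaginary half-lines;
the weight 2 on |Im x| outweighs a negative real part there. -/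
theorem norm_div_two_le_tailSize {x : ℂ} (hx : -|x.im| ≤ x.re) : ‖x‖ / 2 ≤ tailSize x := by
  have h0 : 0 ≤ |x.im| + tailSize x := by unfold tailSize; linarith [abs_nonneg x.im]
  have h1 : 0 ≤ tailSize x := by unfold tailSize; linarith [abs_nonneg x.im]
  refine (div_le_iff₀ two_pos).2 ((Complex.norm_le_abs_re_add_abs_im x).trans ?_)
  unfold tailSize
  rcases le_total 0 x.re with h | h
  · rw [abs_of_nonneg h]; linarith [abs_nonneg x.im]
  · rw [abs_of_nonpos h]
    linarith [abs_nonneg x.im]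

theorem neg_abs_sin_le_cos {θ : ℝ} (hθ : |θ| ≤ 3 * Real.pi / 4) : -|Real.sin θ| ≤ Real.cos θ := by
  have hp := Real.pi_pos
  have h1 : 0 ≤ Real.sin (|θ| + Real.pi / 4) :=
    Real.sin_nonneg_of_nonneg_of_le_pi (by positivity) (by linarith)
  rw [Real.sin_add, Real.cos_pi_div_four, Real.sin_pi_div_four, Real.cos_abs, ← add_mul] at h1
  have h2 : 0 ≤ Real.sin |θ| + Real.cos θ := nonneg_of_mul_nonneg_left h1 (by positivity)
  have h3 : Real.sin |θ| ≤ |Real.sin θ| := by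
    rcases abs_choice θ with h | h <;> rw [h]
    · exact le_abs_self _
    · rw [Real.sin_neg]; exact neg_le_abs _
  linarith

theorem logRectangle_norm_div_two_le {a t : ℂ} (ht : t ∈ logRectangle a) :
    ‖cexp t‖ / 2 ≤ tailSize (cexp t) := by
  refine norm_div_two_le_tailSize ?_
  rw [exp_re, exp_im, abs_mul, abs_of_pos (Real.exp_pos _), ← mul_neg]
  exact mul_le_mul_of_nonneg_left (neg_abs_sin_le_cos ht.2.2) (Real.exp_pos _).le

theorem logRectangle_mem_volterraDomain {a t : ℂ} (ha : a ≠ 0) (ht : t ∈ logRectangle a) :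
    (cexp t, a) ∈ volterraDomain := by
  change 100 * ‖a‖ < tailSize (cexp t)
  have h1 := logRectangle_norm_div_two_le ht
  have h2 := logRectangle_le_norm_exp ha ht
  have h3 : 0 < ‖a‖ := norm_pos_iff.2 ha
  linarith

namespace HasLogExpansion

variable {c : ℂ} {k : ℕ} {Φ Ψ : ℂ → ℂ → ℂ}

theorem congr (hΦ : HasLogExpansion c k Φ) {δ₀ : ℝ} (hδ₀ : 0 < δ₀)
    (h : ∀ a t, a ≠ 0 → ‖a‖ < δ₀ → t ∈ logRectangle a → Φ a t = Ψ a t) :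
    HasLogExpansion c k Ψ := by
  obtain ⟨F, hF, C, δ, hC, hδ, hb⟩ := hΦ
  refine ⟨F, hF, C, min δ δ₀, hC, by positivity, fun a t ha had ht => ?_⟩
  rw [← h a t ha (had.trans_le (min_le_right _ _)) ht]
  exact hb a t ha (had.trans_le (min_le_left _ _)) ht

end HasLogExpansion

theorem hasDerivAt_jostAmplitude_exp {a t : ℂ} (h : (cexp t, a) ∈ volterraDomain) :
    HasDerivAt (fun t => jostAmplitude (cexp t) a)
        (cexp t * jostAmplitudeDeriv (cexp t) a * (1 - a * cexp (-t))⁻¹) t ∧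
      HasDerivAt (fun t => cexp t * jostAmplitudeDeriv (cexp t) a)
        (cexp t * jostAmplitudeDeriv (cexp t) a + cexp t * (cexp t * jostAmplitudeDeriv (cexp t) a)
          * (1 - a * cexp (-t))⁻¹ + a * cexp (-t) * jostAmplitude (cexp t) a) t := by
  have h0 := exp_ne_zero t
  have h1 := volterraDomain_sub_ne_zero h
  have h2 : (1 - a * cexp (-t))⁻¹ = cexp t / (cexp t - a) := by
    have : 1 - a * cexp (-t) = (cexp t - a) / cexp t := by
      rw [Complex.exp_neg]; field_simp
    rw [this, inv_div]
  rw [h2]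
  have he := Complex.hasDerivAt_exp t
  constructor
  · refine ((hasDerivAt_jostAmplitude h).comp t he).congr_deriv ?_
    ring
  · refine (he.mul ((hasDerivAt_jostAmplitudeDeriv h).comp t he)).congr_deriv ?_
    rw [Complex.exp_neg]
    simp only [Function.comp]
    field_simp
    ring

theorem analyticAt_jostAmplitude_param {x : ℂ} (hx : 0 < tailSize x) :
    AnalyticAt ℂ (fun a => jostAmplitude x a) 0 ∧
      AnalyticAt ℂ (fun a => jostAmplitudeDeriv x a) 0 := by
  have hδ : 0 < tailSize x / 100 := by positivity
  have hD : ∀ a ∈ Metric.ball (0 : ℂ) (tailSize x / 100), (x, a) ∈ volterraDomain :=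
    fun a ha => by
      rw [mem_ball_zero_iff] at ha
      change 100 * ‖a‖ < tailSize x
      linarith
  exact ⟨(isVolterraBounded_jostAmplitude.differentiableOn _ Metric.isOpen_ball (fun _ => x) id
    (differentiableOn_const _) differentiableOn_id hD).analyticAt (Metric.ball_mem_nhds _ hδ),
    (differentiableOn_jostAmplitudeDeriv _ Metric.isOpen_ball (fun _ => x) id
    (differentiableOn_const _) differentiableOn_id hD).analyticAt (Metric.ball_mem_nhds _ hδ)⟩

/-- The amplitude of the Jost solution and `x (1 - a / x) ∂_x` of it have log expansions of every
order as `a → 0`. -/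
theorem hasLogExpansion_jostAmplitude (c : ℂ) (k : ℕ) :
    HasLogExpansion c k (fun a t => jostAmplitude (cexp t) a) ∧
      HasLogExpansion c k (fun a t => cexp t * jostAmplitudeDeriv (cexp t) a) := by
  have hρ : (0 : ℝ) ≤ 1 / 2 := by norm_num
  have hX := isDoubleSeries_exp hρ
  have hX' := isDoubleSeries_exp_neg hρ
  have hE := isDoubleSeries_expQuot hρ
  have hE₂ := isDoubleSeries_expQuot₂ hρ
  have hg := isDoubleSeries_logQuot hρ (by norm_num)
  have hi := isDoubleSeries_inv_one_sub hρ (by norm_num)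
  have h1 : IsDoubleSeries (1 / 2) fun _ y => 1 - y := (IsDoubleSeries.const _ 1).sub (.snd _)
  have hp := (hX'.sub (hg.mul hE)).mul hi
  have hc₁ := ((hg.mul hE₂).sub hE).mul hi
  have hc₂ := (((hX'.add hE).sub hE₂).sub (hg.mul hE)).mul (hi.pow 2)
  set ψ : ℂ → ℂ → ℂ := fun a t => jostAmplitude (cexp t) a with hψ
  set κ : ℂ → ℂ → ℂ := fun a t => cexp t * jostAmplitudeDeriv (cexp t) a with hκ
  set α : ℂ → ℂ → ℂ := fun a t => (1 - a * cexp (-t)) * ψ a t - expQuot (cexp t) * κ a t with hα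
  set γ : ℂ → ℂ → ℂ := fun a t => logQuot (a * cexp (-t)) * ψ a t + (cexp (-cexp t)
    - logQuot (a * cexp (-t)) * expQuot (cexp t)) * (1 - a * cexp (-t))⁻¹ * κ a t with hγ
  have hne : ∀ {a t : ℂ}, a ≠ 0 → t ∈ logRectangle a → 1 - a * cexp (-t) ≠ 0 :=
    fun {a t} ha ht => by
      have := logRectangle_norm_mul_exp_le ha ht
      rw [sub_ne_zero]
      intro h
      rw [← h, norm_one] at this
      norm_num at this
  have hee : ∀ t : ℂ, cexp (cexp t) * cexp (-cexp t) = 1 := fun t => by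
    rw [← Complex.exp_add]; simp
  -- The change of unknowns has determinant e^{-x}, so its inverse is e^x times the adjugate and
  -- again has double-series coefficients.
  have hψ' : ∀ {a t : ℂ}, a ≠ 0 → t ∈ logRectangle a → ψ a t = cexp (cexp t) *
      ((cexp (-cexp t) - logQuot (a * cexp (-t)) * expQuot (cexp t)) * (1 - a * cexp (-t))⁻¹
        * α a t + expQuot (cexp t) * γ a t) := fun {a t} ha ht => by
    simp only [hα, hγ]
    have hinv := mul_inv_cancel₀ (hne ha ht)
    linear_combination (-ψ a t) * hee t - cexp (cexp t) * (cexp (-cexp t)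
      - logQuot (a * cexp (-t)) * expQuot (cexp t)) * ψ a t * hinv
  have hκ' : ∀ {a t : ℂ}, a ≠ 0 → t ∈ logRectangle a → κ a t = cexp (cexp t) *
      ((1 - a * cexp (-t)) * γ a t - logQuot (a * cexp (-t)) * α a t) := fun {a t} ha ht => by
    simp only [hα, hγ]
    have hinv := mul_inv_cancel₀ (hne ha ht)
    linear_combination (-κ a t) * hee t - cexp (cexp t) * (cexp (-cexp t)
      - logQuot (a * cexp (-t)) * expQuot (cexp t)) * κ a t * hinv
  have hgauge : ∀ {a t : ℂ}, a ≠ 0 → t ∈ logRectangle a → _ := fun {a t} ha ht =>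
    hasDerivAt_gauge (ψ := ψ a) (κ := κ a) (x := cexp t) (y := a * cexp (-t)) rfl rfl rfl rfl rfl
      ha ((logRectangle_norm_mul_exp_le ha ht).trans_lt (by norm_num))
      (hasDerivAt_jostAmplitude_exp (logRectangle_mem_volterraDomain ha ht)).1
      (hasDerivAt_jostAmplitude_exp (logRectangle_mem_volterraDomain ha ht)).2
  have hψ2 : ∀ {a t : ℂ}, a ≠ 0 → t ∈ logRectangle a → ‖ψ a t‖ ≤ 2 := fun {a t} ha ht =>
    isVolterraBounded_jostAmplitude.norm_le _ _ (logRectangle_mem_volterraDomain ha ht)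
  have hκ2 : ∀ {a t : ℂ}, a ≠ 0 → t ∈ logRectangle a → ‖κ a t‖ ≤ 2 := fun {a t} ha ht => by
    have hD := logRectangle_mem_volterraDomain ha ht
    have h2 := norm_jostAmplitudeDeriv_le hD
    have h3 := logRectangle_norm_div_two_le ht
    have h4 := volterraDomain_tailSize_pos hD
    rw [hκ, norm_mul]
    calc _ ≤ ‖cexp t‖ * (1 / tailSize (cexp t)) := by gcongr
      _ ≤ 2 := by rw [mul_one_div, div_le_iff₀ h4]; linarith
  obtain ⟨C₁, hC₁, hb₁⟩ := h1.bounded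
  obtain ⟨C₂, hC₂, hb₂⟩ := hE.bounded
  obtain ⟨C₃, hC₃, hb₃⟩ := hg.bounded
  obtain ⟨C₄, hC₄, hb₄⟩ := hp.bounded
  have hlin : ∀ {p q u v : ℂ} {C D : ℝ}, ‖p‖ ≤ C → ‖q‖ ≤ D → ‖u‖ ≤ 2 → ‖v‖ ≤ 2 →
      ‖p * u‖ + ‖q * v‖ ≤ C * 2 + D * 2 := fun hp hq hu hv => by
    rw [norm_mul, norm_mul]
    have := (norm_nonneg _).trans hp
    have := (norm_nonneg _).trans hq
    gcongr
  set t₀ : ℂ := ((Real.log (1 / 4) : ℝ) : ℂ) with ht₀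
  have het₀ : cexp t₀ = ((1 / 4 : ℝ) : ℂ) := by
    rw [ht₀, ← ofReal_exp, Real.exp_log (by norm_num)]
  have het₀' : ‖cexp t₀‖ ≤ 1 / 2 := by rw [het₀, norm_real]; norm_num
  have hparam : ∀ {f : ℂ → ℂ → ℂ}, IsDoubleSeries (1 / 2) f → _ := fun {f} hf =>
    (IsLogSeries.of_doubleSeries hf c).analyticAt_param (by norm_num) het₀'
  obtain ⟨k₁, hk₁, δ₁, hδ₁, he₁⟩ := hparam h1
  obtain ⟨k₂, hk₂, δ₂, hδ₂, he₂⟩ := hparam hE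
  obtain ⟨k₃, hk₃, δ₃, hδ₃, he₃⟩ := hparam hg
  obtain ⟨k₄, hk₄, δ₄, hδ₄, he₄⟩ := hparam hp
  obtain ⟨hψa, hχa⟩ := analyticAt_jostAmplitude_param (x := cexp t₀) (by
    rw [het₀]; simp [tailSize])
  have hκa : AnalyticAt ℂ (fun a => κ a t₀) 0 := analyticAt_const.mul hχa
  -- The coefficients arise by inserting this inverse into the right-hand sides of
  -- `hasDerivAt_gauge`; the leading factor e^x is the reciprocal of the determinant. The bounds by
  -- 2 on ψ and κ start the induction at order zero.
  obtain ⟨eα, eγ⟩ := hasLogExpansion_of_system (α := α) (γ := γ)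
    (hX.mul ((hE₂.mul hp).add ((hE.mul hi).mul hg)))
    (hX.mul ((hE₂.mul hE).sub ((hE.mul hi).mul h1)))
    (hX.mul ((hc₁.mul hp).sub (hc₂.mul hg)))
    (hX.mul ((hc₁.mul hE).add (hc₂.mul h1)))
    (δ₀ := min (min δ₁ δ₂) (min δ₃ δ₄)) (by positivity)
    (fun a t ha _ ht => (hgauge ha ht).1.congr_deriv (by
      rw [hψ' ha ht, hκ' ha ht]; ring))
    (fun a t ha _ ht => (hgauge ha ht).2.congr_deriv (by
      conv_lhs => enter [2]; rw [hψ' ha ht, hκ' ha ht]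
      simp only [hγ]
      ring))
    (C := (C₁ * 2 + C₂ * 2) + (C₃ * 2 + C₄ * 2)) (by positivity)
    (fun a t ha _ ht => by
      have hs := logRectangle_subset_bidiscStrip ha ht
      have hy := mul_ne_zero ha (exp_ne_zero (-t))
      refine (norm_sub_le _ _).trans ((hlin (hb₁ _ _ (exp_ne_zero t) hy hs.1.le hs.2.le)
        (hb₂ _ _ (exp_ne_zero t) hy hs.1.le hs.2.le) (hψ2 ha ht) (hκ2 ha ht)).trans ?_)
      have : 0 ≤ C₃ * 2 + C₄ * 2 := by positivity
      linarith)
    (fun a t ha _ ht => by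
      have hs := logRectangle_subset_bidiscStrip ha ht
      have hy := mul_ne_zero ha (exp_ne_zero (-t))
      refine (norm_add_le _ _).trans ((hlin (hb₃ _ _ (exp_ne_zero t) hy hs.1.le hs.2.le)
        (hb₄ _ _ (exp_ne_zero t) hy hs.1.le hs.2.le) (hψ2 ha ht) (hκ2 ha ht)).trans ?_)
      have : 0 ≤ C₁ * 2 + C₂ * 2 := by positivity
      linarith)
    ((hk₁.mul hψa).sub (hk₂.mul hκa)) ((hk₃.mul hψa).add (hk₄.mul hκa))
    (fun a ha had => by
      have h2 := he₁ a ha (had.trans_le ((min_le_left _ _).trans (min_le_left _ _)))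
      have h3 := he₂ a ha (had.trans_le ((min_le_left _ _).trans (min_le_right _ _)))
      simp only [hα, Pi.sub_apply, Pi.mul_apply, ← h2, ← h3]
      rfl)
    (fun a ha had => by
      have h2 := he₃ a ha (had.trans_le ((min_le_right _ _).trans (min_le_left _ _)))
      have h3 := he₄ a ha (had.trans_le ((min_le_right _ _).trans (min_le_right _ _)))
      simp only [hγ, Pi.add_apply, Pi.mul_apply, ← h2, ← h3]
      rfl) c k
  constructor
  · refine ((eα.mul_doubleSeries (hX.mul hp)).add (eγ.mul_doubleSeries (hX.mul hE))).congr
      one_pos fun a t ha _ ht => ?_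
    rw [hψ' ha ht]
    ring
  · refine ((eγ.mul_doubleSeries (hX.mul h1)).add
      (eα.mul_doubleSeries (hX.mul hg.neg))).congr one_pos fun a t ha _ ht => ?_
    rw [hκ' ha ht]
    ring

/-! ### A solution with fixed data at u, entire in the frequency -/

theorem norm_intervalIntegral_le_pow {f : ℝ → ℂ} {u v D : ℝ} (k : ℕ)
    (hf : ∀ s, |s - u| ≤ |v - u| → ‖f s‖ ≤ D * |s - u| ^ k) :
    ‖∫ s in u..v, f s‖ ≤ D * (|v - u| ^ (k + 1) / (k + 1)) := by
  have h1 : ∀ s ∈ Set.uIoc u v, ‖f s‖ ≤ D * |s - u| ^ k := fun s hs => by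
    refine hf s ?_
    exact Set.abs_sub_left_of_mem_uIcc (Set.uIoc_subset_uIcc hs)
  rw [intervalIntegral.norm_integral_eq_norm_integral_uIoc]
  have h2 : ∫ s in Set.uIoc u v, D * |s - u| ^ k = D * (|v - u| ^ (k + 1) / (k + 1)) := by
    rw [integral_const_mul, integral_pow_abs_sub_uIoc]
  rw [← h2]
  refine norm_integral_le_of_norm_le ?_ ?_
  · have : Continuous fun s : ℝ => D * |s - u| ^ k := by fun_prop
    exact (this.integrableOn_Icc (a := min u v) (b := max u v)).mono_set
      Set.Ioc_subset_Icc_self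
  · filter_upwards [ae_restrict_mem measurableSet_uIoc] with s hs using h1 s hs

/-- Picard iterates of `θ'' = (V - w²) θ`, `θ(u) = 1`, `θ'(u) = 0`. -/
noncomputable def picardIterate (V : ℝ → ℝ) (u : ℝ) (w : ℂ) : ℕ → ℝ → ℂ
  | 0, _ => 1
  | k + 1, v => ∫ s in u..v, ∫ r in u..s, ((V r : ℂ) - w ^ 2) * picardIterate V u w k r

/-- The derivative of `picardIterate`. -/
noncomputable def picardIterateDeriv (V : ℝ → ℝ) (u : ℝ) (w : ℂ) : ℕ → ℝ → ℂ
  | 0, _ => 0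
  | k + 1, v => ∫ r in u..v, ((V r : ℂ) - w ^ 2) * picardIterate V u w k r

section Picard

variable {V : ℝ → ℝ} (hV : Continuous V) {u : ℝ}
include hV

theorem hasDerivAt_picardIterate (w : ℂ) (k : ℕ) : Continuous (picardIterate V u w k) ∧
    (∀ v, HasDerivAt (picardIterate V u w k) (picardIterateDeriv V u w k v) v) ∧
    ∀ v, HasDerivAt (picardIterateDeriv V u w (k + 1))
      (((V v : ℂ) - w ^ 2) * picardIterate V u w k v) v := by
  have hη : ∀ k, Continuous (picardIterate V u w k) → ∀ v,
      HasDerivAt (picardIterateDeriv V u w (k + 1))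
        (((V v : ℂ) - w ^ 2) * picardIterate V u w k v) v := fun k hk v => by
    have h1 : picardIterateDeriv V u w (k + 1) = fun v => ∫ r in u..v,
        ((V r : ℂ) - w ^ 2) * picardIterate V u w k r := by funext v; rw [picardIterateDeriv]
    rw [h1]
    have h2 : Continuous fun r => ((V r : ℂ) - w ^ 2) * picardIterate V u w k r :=
      ((continuous_ofReal.comp hV).sub continuous_const).mul hk
    exact (h2.integral_hasStrictDerivAt u v).hasDerivAt
  have hθ : ∀ k, Continuous (picardIterate V u w k) → ∀ v,
      HasDerivAt (picardIterate V u w (k + 1)) (picardIterateDeriv V u w (k + 1) v) v :=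
    fun k hk v => by
      have h1 : picardIterate V u w (k + 1) = fun v => ∫ s in u..v,
          picardIterateDeriv V u w (k + 1) s := by
        funext v; rw [picardIterate]; simp only [picardIterateDeriv]
      rw [h1]
      have h2 : Continuous (picardIterateDeriv V u w (k + 1)) :=
        continuous_iff_continuousAt.2 fun s => (hη k hk s).continuousAt
      exact (h2.integral_hasStrictDerivAt u v).hasDerivAt
  have h0 : picardIterate V u w 0 = fun _ => 1 := by funext; rw [picardIterate]
  have hc : ∀ k, Continuous (picardIterate V u w k) := fun k => by
    induction k with
    | zero => rw [h0]; exact continuous_const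
    | succ k ih => exact continuous_iff_continuousAt.2 fun s => (hθ k ih s).continuousAt
  refine ⟨hc k, ?_, hη k (hc k)⟩
  cases k with
  | zero =>
    intro v
    rw [h0, picardIterateDeriv]
    exact hasDerivAt_const v 1
  | succ k => exact hθ k (hc k)

omit hV in
-- The inner of the two integrations supplies the factorial; the gain of the outer one is wasted
-- into a factor `L`, so that iterates and derivatives obey bounds of the same kind.
theorem norm_picardIterate_le {L W B : ℝ} (hL : 1 ≤ L)
    (hB : ∀ r, |r - u| ≤ L → |V r| + W ^ 2 ≤ B) {w : ℂ} (hw : ‖w‖ ≤ W) (k : ℕ) :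
    (∀ v, |v - u| ≤ L → ‖picardIterate V u w k v‖ ≤ (B * L) ^ k / k.factorial * |v - u| ^ k) ∧
    ∀ v, |v - u| ≤ L → ‖picardIterateDeriv V u w (k + 1) v‖
      ≤ B * ((B * L) ^ k / (k + 1).factorial) * |v - u| ^ (k + 1) := by
  have hB0 : 0 ≤ B := le_trans (by positivity) (hB u (by simpa using by linarith))
  have hη : ∀ k, (∀ v, |v - u| ≤ L → ‖picardIterate V u w k v‖
      ≤ (B * L) ^ k / k.factorial * |v - u| ^ k) → ∀ v, |v - u| ≤ L →
      ‖picardIterateDeriv V u w (k + 1) v‖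
        ≤ B * ((B * L) ^ k / (k + 1).factorial) * |v - u| ^ (k + 1) := fun k hk v hv => by
    rw [picardIterateDeriv]
    refine (norm_intervalIntegral_le_pow (D := B * ((B * L) ^ k / k.factorial)) k
      fun s hs => ?_).trans_eq ?_
    · have hs' := hs.trans hv
      have h1 : ‖(V s : ℂ) - w ^ 2‖ ≤ B := by
        refine (norm_sub_le _ _).trans (le_trans ?_ (hB s hs'))
        rw [norm_real, norm_pow, Real.norm_eq_abs]
        gcongr
      rw [norm_mul, mul_assoc]
      exact mul_le_mul h1 (hk s hs') (norm_nonneg _) hB0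
    · rw [Nat.factorial_succ]
      push_cast
      field_simp
  have hθ : ∀ v, |v - u| ≤ L → ‖picardIterate V u w k v‖
      ≤ (B * L) ^ k / k.factorial * |v - u| ^ k := by
    induction k with
    | zero => intro v _; simp [picardIterate]
    | succ k ih =>
      intro v hv
      have h1 : picardIterate V u w (k + 1) v = ∫ s in u..v,
          picardIterateDeriv V u w (k + 1) s := by
        rw [picardIterate]; simp only [picardIterateDeriv]
      rw [h1]
      refine (norm_intervalIntegral_le_pow (k + 1) fun s hs => hη k ih s (hs.trans hv)).trans ?_
      have h2 : |v - u| ^ (k + 1 + 1) / (((k + 1 : ℕ) : ℝ) + 1) ≤ |v - u| ^ (k + 1) * L := by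
        rw [pow_succ]
        refine (div_le_self (by positivity) ?_).trans (by gcongr)
        linarith [Nat.cast_nonneg (α := ℝ) (k + 1)]
      calc _ ≤ B * ((B * L) ^ k / (k + 1).factorial) * (|v - u| ^ (k + 1) * L) := by gcongr
        _ = _ := by ring
  exact ⟨hθ, hη k hθ⟩

theorem exists_potential_bound (u L W : ℝ) : ∃ B, ∀ r, |r - u| ≤ L → |V r| + W ^ 2 ≤ B := by
  obtain ⟨C, hC⟩ := (isCompact_Icc (a := u - L) (b := u + L)).exists_bound_of_continuousOn
    hV.continuousOn
  refine ⟨C + W ^ 2, fun r hr => ?_⟩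
  have := hC r ⟨by linarith [(abs_le.1 hr).1], by linarith [(abs_le.1 hr).2]⟩
  rw [Real.norm_eq_abs] at this
  linarith

/-- Uniform bounds for the Picard iterates. -/
theorem exists_picardIterate_bound (u : ℝ) {L : ℝ} (hL : 1 ≤ L) (W : ℝ) : ∃ B q : ℝ, 0 ≤ B ∧
    0 ≤ q ∧ ∀ (w : ℂ), ‖w‖ ≤ W → ∀ v, |v - u| ≤ L → ∀ k, ‖(V v : ℂ) - w ^ 2‖ ≤ B ∧
      ‖picardIterate V u w k v‖ ≤ q ^ k / k.factorial ∧
      ‖picardIterateDeriv V u w k v‖ ≤ q ^ k / k.factorial := by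
  obtain ⟨B, hB⟩ := exists_potential_bound hV u L W
  have hB0 : 0 ≤ B := le_trans (by positivity) (hB u (by simpa using by linarith))
  refine ⟨B, B * L * L, hB0, by positivity, fun w hw v hv k => ⟨?_, ?_, ?_⟩⟩
  · refine (norm_sub_le _ _).trans (le_trans ?_ (hB v hv))
    rw [norm_real, norm_pow, Real.norm_eq_abs]
    gcongr
  · refine ((norm_picardIterate_le hL hB hw k).1 v hv).trans ?_
    rw [mul_pow (B * L), mul_div_right_comm]
    gcongr
  · cases k with
    | zero => simp [picardIterateDeriv]
    | succ k =>
      refine ((norm_picardIterate_le hL hB hw k).2 v hv).trans ?_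
      calc _ ≤ B * ((B * L) ^ k / (k + 1).factorial) * L ^ (k + 1) := by gcongr
        _ ≤ B * ((B * L) ^ k / (k + 1).factorial) * L ^ (k + 1) * L :=
            le_mul_of_one_le_right (by positivity) hL
        _ = _ := by ring

/-- Entire in w, since the integrations run over compact intervals on which the integrands are
bounded locally uniformly in w. -/
theorem differentiable_picardIterate (k : ℕ) :
    (∀ v, Differentiable ℂ fun w => picardIterate V u w k v) ∧
      ∀ v, Differentiable ℂ fun w => picardIterateDeriv V u w k v := by
  have hint : ∀ (f : ℂ → ℝ → ℂ), (∀ w, Continuous (f w)) → (∀ s, Differentiable ℂ fun w => f w s) →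
      (∀ L, 1 ≤ L → ∀ W, ∃ C, ∀ w, ‖w‖ ≤ W → ∀ s, |s - u| ≤ L → ‖f w s‖ ≤ C) →
      ∀ v, Differentiable ℂ fun w => ∫ s in u..v, f w s := fun f hc hd hb v => by
    simp only [intervalIntegral.intervalIntegral_eq_integral_uIoc]
    refine Differentiable.const_smul (?_ : Differentiable ℂ _) (if u ≤ v then (1 : ℝ) else -1)
    rw [← differentiableOn_univ]
    refine differentiableOn_integral_of_locally_dominated isOpen_univ
      (fun w _ => (hc w).aestronglyMeasurable)
      (Eventually.of_forall fun s => (hd s).differentiableOn) fun w₀ _ => ?_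
    obtain ⟨C, hC⟩ := hb (max 1 |v - u|) (le_max_left _ _) (‖w₀‖ + 1)
    refine ⟨Metric.ball w₀ 1, Metric.ball_mem_nhds _ one_pos, fun _ => C, ?_, ?_⟩
    · refine integrableOn_const ?_
      rw [Set.uIoc, Real.volume_Ioc]
      exact ENNReal.ofReal_ne_top
    · filter_upwards [ae_restrict_mem measurableSet_uIoc] with s hs w hw
      refine hC w ?_ s ?_
      · rw [mem_ball_iff_norm] at hw
        have := norm_sub_norm_le w w₀
        linarith
      · exact (Set.abs_sub_left_of_mem_uIcc (Set.uIoc_subset_uIcc hs)).trans (le_max_right _ _)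
  have hη : ∀ k, (∀ v, Differentiable ℂ fun w => picardIterate V u w k v) →
      ∀ v, Differentiable ℂ fun w => picardIterateDeriv V u w (k + 1) v := fun k hk v => by
    simp only [picardIterateDeriv]
    refine hint (fun w r => ((V r : ℂ) - w ^ 2) * picardIterate V u w k r) (fun w => ?_)
      (fun s => ?_) (fun L hL W => ?_) v
    · exact ((continuous_ofReal.comp hV).sub continuous_const).mul
        (hasDerivAt_picardIterate hV w k).1
    · exact ((differentiable_const _).sub (differentiable_id.pow 2)).mul (hk s)
    · obtain ⟨B, q, hB, hq, hb⟩ := exists_picardIterate_bound hV u hL W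
      refine ⟨B * (q ^ k / k.factorial), fun w hw s hs => ?_⟩
      rw [norm_mul]
      have := hb w hw s hs k
      exact mul_le_mul this.1 this.2.1 (norm_nonneg _) hB
  have hθ : ∀ k v, Differentiable ℂ fun w => picardIterate V u w k v := fun k => by
    induction k with
    | zero => intro v; simp only [picardIterate]; exact differentiable_const 1
    | succ k ih =>
      intro v
      have h1 : (fun w => picardIterate V u w (k + 1) v) = fun w => ∫ s in u..v,
          picardIterateDeriv V u w (k + 1) s := by
        funext w; rw [picardIterate]; simp only [picardIterateDeriv]
      rw [h1]
      refine hint (fun w s => picardIterateDeriv V u w (k + 1) s) (fun w => ?_)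
        (fun s => hη k ih s) (fun L hL W => ?_) v
      · exact continuous_iff_continuousAt.2 fun s =>
          ((hasDerivAt_picardIterate hV w k).2.2 s).continuousAt
      · obtain ⟨B, q, hB, hq, hb⟩ := exists_picardIterate_bound hV u hL W
        exact ⟨_, fun w hw s hs => (hb w hw s hs (k + 1)).2.2⟩
  refine ⟨hθ k, ?_⟩
  cases k with
  | zero => intro v; simp only [picardIterateDeriv]; exact differentiable_const 0
  | succ k => exact hη k (hθ k)

omit hV in
theorem picardIterate_self (w : ℂ) (k : ℕ) :
    picardIterate V u w k u = (if k = 0 then 1 else 0) ∧ picardIterateDeriv V u w k u = 0 := by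
  cases k <;> simp [picardIterate, picardIterateDeriv]

end Picard

/-- The solution of `θ'' = (V - w²) θ` with `θ(u) = 1` and `θ'(u) = 0`. -/
noncomputable def cosineSolution (V : ℝ → ℝ) (u : ℝ) (w : ℂ) (v : ℝ) : ℂ :=
  ∑' k, picardIterate V u w k v

/-- The derivative of `cosineSolution`. -/
noncomputable def cosineSolutionDeriv (V : ℝ → ℝ) (u : ℝ) (w : ℂ) (v : ℝ) : ℂ :=
  ∑' k, picardIterateDeriv V u w k v

theorem cosineSolution_self (V : ℝ → ℝ) (u : ℝ) (w : ℂ) :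
    cosineSolution V u w u = 1 ∧ cosineSolutionDeriv V u w u = 0 := by
  unfold cosineSolution cosineSolutionDeriv
  simp [picardIterate_self]

section Picard

variable {V : ℝ → ℝ} (hV : Continuous V) {u : ℝ}
include hV

theorem hasDerivAt_cosineSolution (w : ℂ) (v : ℝ) :
    HasDerivAt (cosineSolution V u w) (cosineSolutionDeriv V u w v) v ∧
      HasDerivAt (cosineSolutionDeriv V u w) (((V v : ℂ) - w ^ 2) * cosineSolution V u w v) v := by
  obtain ⟨B, q, hB, hq, hb⟩ := exists_picardIterate_bound hV u (L := |v - u| + 1)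
    (by linarith [abs_nonneg (v - u)]) ‖w‖
  set s := Metric.ball u (|v - u| + 1) with hs
  have hsu : Summable fun k : ℕ => q ^ k / (k.factorial : ℝ) := Real.summable_pow_div_factorial q
  have hbs : ∀ x ∈ s, ∀ k, ‖(V x : ℂ) - w ^ 2‖ ≤ B ∧
      ‖picardIterate V u w k x‖ ≤ q ^ k / k.factorial ∧
      ‖picardIterateDeriv V u w k x‖ ≤ q ^ k / k.factorial := fun x hx =>
    hb w le_rfl x (by rw [hs, Metric.mem_ball, Real.dist_eq] at hx; exact hx.le)
  have hvs : v ∈ s := by rw [hs, Metric.mem_ball, Real.dist_eq]; linarith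
  have hso : IsOpen s := Metric.isOpen_ball
  have hsc : IsPreconnected s := (convex_ball _ _).isPreconnected
  have hsθ : Summable fun k => picardIterate V u w k v :=
    Summable.of_norm_bounded hsu fun k => (hbs v hvs k).2.1
  have hsη : Summable fun k => picardIterateDeriv V u w k v :=
    Summable.of_norm_bounded hsu fun k => (hbs v hvs k).2.2
  constructor
  · exact hasDerivAt_tsum_of_isPreconnected hsu hso hsc
      (fun k x _ => (hasDerivAt_picardIterate hV w k).2.1 x) (fun k x hx => (hbs x hx k).2.2)
      hvs hsθ hvs
  · have h0 : ∀ k x, HasDerivAt (picardIterateDeriv V u w k)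
        (if k = 0 then 0 else ((V x : ℂ) - w ^ 2) * picardIterate V u w (k - 1) x) x := by
      intro k x
      cases k with
      | zero =>
        have : picardIterateDeriv V u w 0 = fun _ => 0 := by funext; rw [picardIterateDeriv]
        rw [this, if_pos rfl]
        exact hasDerivAt_const _ _
      | succ k => simpa using (hasDerivAt_picardIterate hV w k).2.2 x
    have h1 := hasDerivAt_tsum_of_isPreconnected (u := fun k : ℕ => B * (q ^ (k - 1) / (k - 1).factorial))
      ?_ hso hsc (fun k x _ => h0 k x) (fun k x hx => ?_) hvs hsη hvs
    · refine h1.congr_deriv ?_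
      rw [cosineSolution, ← tsum_mul_left, Summable.tsum_eq_zero_add]
      · simp
      · rw [← summable_nat_add_iff 1]
        simpa using hsθ.mul_left _
    · refine Summable.mul_left B ?_
      rw [← summable_nat_add_iff 1]
      simpa using hsu
    · split_ifs with hk
      · rw [norm_zero]; positivity
      · rw [norm_mul]
        have := hbs x hx (k - 1)
        exact mul_le_mul this.1 this.2.1 (norm_nonneg _) hB

theorem differentiable_cosineSolution (v : ℝ) :
    (Differentiable ℂ fun w => cosineSolution V u w v) ∧
      Differentiable ℂ fun w => cosineSolutionDeriv V u w v := by
  have key : ∀ f : ℕ → ℂ → ℂ, (∀ k, Differentiable ℂ (f k)) →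
      (∀ W, ∃ q : ℝ, ∀ w, ‖w‖ ≤ W → ∀ k, ‖f k w‖ ≤ q ^ k / k.factorial) →
      Differentiable ℂ fun w => ∑' k, f k w := fun f hf hb w₀ => by
    obtain ⟨q, hq⟩ := hb (‖w₀‖ + 1)
    refine (differentiableOn_tsum_of_summable_norm (U := Metric.ball 0 (‖w₀‖ + 1))
      (Real.summable_pow_div_factorial q) (fun k => (hf k).differentiableOn) Metric.isOpen_ball
      fun k w hw => hq w (by simpa using (mem_ball_zero_iff.1 hw).le) k).differentiableAt
      (Metric.isOpen_ball.mem_nhds (by simp))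
  have hb := fun W => exists_picardIterate_bound hV u (L := max 1 |v - u|) (le_max_left _ _) W
  constructor
  · refine key _ (fun k => (differentiable_picardIterate hV k).1 v) fun W => ?_
    obtain ⟨B, q, -, -, h⟩ := hb W
    exact ⟨q, fun w hw k => (h w hw v (le_max_right _ _) k).2.1⟩
  · refine key _ (fun k => (differentiable_picardIterate hV k).2 v) fun W => ?_
    obtain ⟨B, q, -, -, h⟩ := hb W
    exact ⟨q, fun w hw k => (h w hw v (le_max_right _ _) k).2.2⟩

/-- The derivative at `u` of a solution on the line, in terms of its data at `v`. -/
theorem solution_deriv_eq {w : ℂ} {f f' : ℝ → ℂ}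
    (hf : ∀ v, HasDerivAt f (f' v) v ∧ HasDerivAt f' (((V v : ℂ) - w ^ 2) * f v) v) (v : ℝ) :
    f' u = cosineSolution V u w v * f' v - cosineSolutionDeriv V u w v * f v := by
  have hθ := hasDerivAt_cosineSolution hV (u := u) w
  -- The Wronskian with the cosine solution is constant, and at `u` it equals f'(u).
  have hd : ∀ x, HasDerivAt (fun x => cosineSolution V u w x * f' x
      - cosineSolutionDeriv V u w x * f x) 0 x := fun x =>
    (((hθ x).1.mul (hf x).2).sub ((hθ x).2.mul (hf x).1)).congr_deriv (by ring)
  have := is_const_of_deriv_eq_zero (fun x => (hd x).differentiableAt) (fun x => (hd x).deriv) u v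
  simp only [(cosineSolution_self V u w).1, (cosineSolution_self V u w).2] at this
  rw [← this]
  ring

end Picard

/-! ### Expansions in z and log z on a cone around the imaginary axis -/

section Expansion

open Asymptotics

/-- The double cone around the imaginary axis. -/
def imagCone : Set ℂ := {z | |z.re| < |z.im|}

theorem isOpen_imagCone : IsOpen imagCone :=
  isOpen_lt (f := fun w : ℂ => |w.re|) (g := fun w : ℂ => |w.im|) (by fun_prop) (by fun_prop)

theorem imagCone_ne_zero {z : ℂ} (hz : z ∈ imagCone) : z ≠ 0 := by
  rintro rfl
  simp [imagCone] at hz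

theorem imagCone_subset_slitPlane : imagCone ⊆ slitPlane := fun z hz => by
  refine Or.inr fun h => ?_
  have h1 : |z.re| < |z.im| := hz
  rw [h, abs_zero] at h1
  exact (abs_nonneg _).not_gt h1

theorem abs_arg_le_of_neg_abs_im_le_re {z : ℂ} (hz : z ≠ 0) (h : -|z.im| ≤ z.re) :
    |arg z| ≤ 3 * Real.pi / 4 := by
  by_contra hlt
  rw [not_le] at hlt
  have h0 : 0 < ‖z‖ := norm_pos_iff.2 hz
  have h1 : Real.cos |arg z| < Real.cos (3 * Real.pi / 4) :=
    Real.cos_lt_cos_of_nonneg_of_le_pi (by positivity) (abs_arg_le_pi z) hlt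
  have h2 : Real.cos (3 * Real.pi / 4) = -(√2 / 2) := by
    rw [show 3 * Real.pi / 4 = Real.pi - Real.pi / 4 by ring, Real.cos_pi_sub, Real.cos_pi_div_four]
  rw [h2, Real.cos_abs, Complex.cos_arg hz] at h1
  have h3 : z.re ^ 2 + z.im ^ 2 = ‖z‖ ^ 2 := by rw [Complex.sq_norm, normSq_apply]; ring
  have h4 : z.re < -(√2 / 2) * ‖z‖ := by rwa [div_lt_iff₀ h0] at h1
  have h5 : √2 ^ 2 = 2 := Real.sq_sqrt two_pos.le
  have h6 : 0 < √2 := Real.sqrt_pos.2 two_pos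
  have h7 : z.re ^ 2 ≤ z.im ^ 2 := by
    rw [← sq_abs z.im]
    have : 0 < √2 / 2 * ‖z‖ := by positivity
    nlinarith [abs_nonneg z.im]
  have h8 : (√2 / 2 * ‖z‖) ^ 2 < z.re ^ 2 := by
    have : 0 < √2 / 2 * ‖z‖ := by positivity
    nlinarith
  nlinarith

/-- The gauge `|z|^(n+1/2)`. -/
noncomputable def halfPow (n : ℕ) (z : ℂ) : ℝ := ‖z‖ ^ n * √‖z‖

theorem isBigO_pow_succ_halfPow (n : ℕ) :
    (fun z : ℂ => ‖z‖ ^ (n + 1)) =O[𝓝[imagCone] 0] halfPow n := by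
  refine IsBigO.of_bound 1 ?_
  filter_upwards [nhdsWithin_le_nhds (Metric.ball_mem_nhds (0 : ℂ) one_pos)] with z hz
  rw [mem_ball_zero_iff] at hz
  rw [halfPow, Real.norm_of_nonneg (by positivity), Real.norm_of_nonneg (by positivity), one_mul,
    pow_succ]
  gcongr
  exact Real.le_sqrt_of_sq_le (by nlinarith [norm_nonneg z])

theorem tendsto_norm_imagCone : Tendsto (fun z : ℂ => ‖z‖) (𝓝[imagCone] 0) (𝓝[>] 0) := by
  rw [tendsto_nhdsWithin_iff]
  refine ⟨(continuous_norm.tendsto' _ _ norm_zero).mono_left nhdsWithin_le_nhds, ?_⟩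
  filter_upwards [self_mem_nhdsWithin] with z hz
  exact norm_pos_iff.2 (imagCone_ne_zero hz)

theorem isBigO_const_add_abs_log_pow (c : ℝ) (j : ℕ) :
    (fun x : ℝ => (c + |Real.log x|) ^ j) =O[𝓝[>] 0] fun x => (√x)⁻¹ := by
  -- The exponent is chosen so that its j-th multiple stays above -1/2, also for j = 0.
  have hs : -(1 / (2 * ((j : ℝ) + 1))) < 0 := by
    rw [neg_lt_zero]; positivity
  have h1 : (fun x : ℝ => c + |Real.log x|) =O[𝓝[>] 0] fun x => x ^ (-(1 / (2 * ((j : ℝ) + 1)))) := by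
    refine IsBigO.add ?_ (isLittleO_log_rpow_nhdsGT_zero hs).isBigO.abs_left
    refine ((isBigO_const_const c (one_ne_zero (α := ℝ)) _).trans ?_)
    refine IsBigO.of_bound 1 ?_
    filter_upwards [Ioo_mem_nhdsGT (zero_lt_one' ℝ)] with x hx
    rw [norm_one, one_mul, Real.norm_of_nonneg (Real.rpow_nonneg hx.1.le _)]
    exact Real.one_le_rpow_of_pos_of_le_one_of_nonpos hx.1 hx.2.le hs.le
  refine (h1.pow j).trans (IsBigO.of_bound 1 ?_)
  filter_upwards [Ioo_mem_nhdsGT (zero_lt_one' ℝ)] with x hx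
  rw [one_mul, ← Real.rpow_natCast, ← Real.rpow_mul hx.1.le, Real.sqrt_eq_rpow,
    ← Real.rpow_neg hx.1.le, Real.norm_of_nonneg (Real.rpow_nonneg hx.1.le _),
    Real.norm_of_nonneg (Real.rpow_nonneg hx.1.le _)]
  refine Real.rpow_le_rpow_of_exponent_ge hx.1 hx.2.le ?_
  rw [neg_mul, neg_le_neg_iff, one_div, inv_mul_le_iff₀ (by positivity)]
  linarith

/-- The half power in `halfPow` is the room needed for logarithms: any power of the logarithm is
O(|z|^{-1/2}), at the cost of half of one factor |z|. -/
theorem isBigO_pow_mul_of_log (n : ℕ) (c : ℝ) (j : ℕ) :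
    (fun z : ℂ => ‖z‖ ^ (n + 1) * (c + |Real.log ‖z‖|) ^ j) =O[𝓝[imagCone] 0] halfPow n := by
  have h1 := (isBigO_const_add_abs_log_pow c j).comp_tendsto tendsto_norm_imagCone
  have h2 := (isBigO_refl (fun z : ℂ => ‖z‖ ^ (n + 1)) (𝓝[imagCone] 0)).mul h1
  refine h2.congr' (Eventually.of_forall fun z => rfl) ?_
  filter_upwards [self_mem_nhdsWithin] with z hz
  have h3 : 0 < ‖z‖ := norm_pos_iff.2 (imagCone_ne_zero hz)
  have h4 : 0 < √‖z‖ := Real.sqrt_pos.2 h3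
  have h5 := Real.mul_self_sqrt h3.le
  simp only [Function.comp, halfPow]
  rw [pow_succ]
  nth_rw 2 [← h5]
  field_simp

theorem norm_log_le (z : ℂ) : ‖log z‖ ≤ 4 + |Real.log ‖z‖| := by
  refine (norm_le_abs_re_add_abs_im _).trans ?_
  rw [log_re, log_im, add_comm]
  gcongr
  exact (abs_arg_le_pi z).trans Real.pi_le_four

theorem isBigO_pow_mul_log_pow (n i j : ℕ) (hi : n < i) :
    (fun z : ℂ => z ^ i * log z ^ j) =O[𝓝[imagCone] 0] halfPow n := by
  refine IsBigO.trans (IsBigO.of_bound 1 ?_) (isBigO_pow_mul_of_log n 4 j)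
  filter_upwards [nhdsWithin_le_nhds (Metric.ball_mem_nhds (0 : ℂ) one_pos)] with z hz
  rw [mem_ball_zero_iff] at hz
  rw [norm_mul, norm_pow, norm_pow, one_mul, Real.norm_of_nonneg (by positivity)]
  exact mul_le_mul (pow_le_pow_of_le_one (norm_nonneg _) hz.le hi)
    (pow_le_pow_left₀ (norm_nonneg _) (norm_log_le z) j) (by positivity) (by positivity)

theorem isBigO_mul_log_pow_one (j : ℕ) :
    (fun z : ℂ => (z * log z) ^ j) =O[𝓝[imagCone] 0] fun _ => (1 : ℝ) := by
  have h : (fun z : ℂ => z * log z) =O[𝓝[imagCone] 0] fun _ => (1 : ℝ) := by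
    have h1 := isBigO_pow_mul_log_pow 0 1 1 one_pos
    simp only [pow_one] at h1
    refine h1.trans (IsBigO.of_bound 1 ?_)
    filter_upwards [nhdsWithin_le_nhds (Metric.ball_mem_nhds (0 : ℂ) one_pos)] with z hz
    rw [mem_ball_zero_iff] at hz
    rw [halfPow, pow_zero, one_mul, norm_one, mul_one, Real.norm_of_nonneg (by positivity)]
    exact Real.sqrt_le_one.2 hz.le
  simpa using h.pow j

/-- `G` is, up to `O(|z|^(n+1/2))`, a polynomial in `z log z` with analytic coefficients. -/
def HasConeExpansion (n : ℕ) (G : ℂ → ℂ) : Prop :=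
  ∃ (J : ℕ) (g : ℕ → ℂ → ℂ), (∀ j, AnalyticAt ℂ (g j) 0) ∧
    (fun z => G z - ∑ j ∈ Finset.range J, (z * log z) ^ j * g j z) =O[𝓝[imagCone] 0] halfPow n

/-- The pairs `(i, j)` with `j ≤ i ≤ n`. -/
def triangle (n : ℕ) : Finset (ℕ × ℕ) :=
  (Finset.range (n + 1) ×ˢ Finset.range (n + 1)).filter fun p => p.2 ≤ p.1

/-- `G` is, up to `O(|z|^(n+1/2))`, a combination of the `z^i log^j z` with `j ≤ i ≤ n`. -/
def HasPolyLogExpansion (n : ℕ) (G : ℂ → ℂ) : Prop :=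
  ∃ c : ℕ × ℕ → ℂ, (fun z => G z - ∑ p ∈ triangle n, c p * (z ^ p.1 * log z ^ p.2))
    =O[𝓝[imagCone] 0] halfPow n

namespace HasPolyLogExpansion

variable {n : ℕ} {G H : ℂ → ℂ}

theorem of_isBigO (hG : HasPolyLogExpansion n G)
    (h : (fun z => H z - G z) =O[𝓝[imagCone] 0] halfPow n) : HasPolyLogExpansion n H := by
  obtain ⟨c, hc⟩ := hG
  exact ⟨c, (hc.add h).congr_left fun z => by ring⟩

theorem add (hG : HasPolyLogExpansion n G) (hH : HasPolyLogExpansion n H) :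
    HasPolyLogExpansion n fun z => G z + H z := by
  obtain ⟨c, hc⟩ := hG
  obtain ⟨d, hd⟩ := hH
  refine ⟨c + d, (hc.add hd).congr_left fun z => ?_⟩
  simp only [Pi.add_apply, add_mul, Finset.sum_add_distrib]
  ring

theorem zero : HasPolyLogExpansion n fun _ => 0 :=
  ⟨0, (isBigO_zero _ _).congr_left fun z => by simp⟩

theorem sum {ι : Type*} (s : Finset ι) {G : ι → ℂ → ℂ} (h : ∀ i ∈ s, HasPolyLogExpansion n (G i)) :
    HasPolyLogExpansion n fun z => ∑ i ∈ s, G i z := by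
  classical
  induction s using Finset.induction_on with
  | empty => simpa using zero
  | insert i s hi ih =>
    simp only [Finset.sum_insert hi]
    exact (h i (Finset.mem_insert_self i s)).add
      (ih fun k hk => h k (Finset.mem_insert_of_mem hk))

theorem monomial (c : ℂ) {i j : ℕ} (hij : j ≤ i) :
    HasPolyLogExpansion n fun z => c * (z ^ i * log z ^ j) := by
  by_cases hi : i ≤ n
  · refine ⟨Pi.single (i, j) c, (isBigO_zero _ _).congr_left fun z => ?_⟩
    rw [Finset.sum_eq_single (i, j)]
    · simp
    · intro p _ hp
      simp [Pi.single_eq_of_ne hp]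
    · intro h
      refine absurd ?_ h
      simp only [triangle, Finset.mem_filter, Finset.mem_product, Finset.mem_range]
      omega
  · exact zero.of_isBigO (((isBigO_pow_mul_log_pow n i j (not_le.1 hi)).const_mul_left c).congr_left
      fun z => by ring)

end HasPolyLogExpansion

theorem isBigO_sub_taylor {g : ℂ → ℂ} (hg : AnalyticAt ℂ g 0) (n : ℕ) : ∃ p : ℕ → ℂ,
    (fun z => g z - ∑ i ∈ Finset.range (n + 1), p i * z ^ i) =O[𝓝[imagCone] 0] halfPow n := by
  obtain ⟨p, C, δ, hC, hδ, h⟩ := hg.exists_taylor (n + 1)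
  refine ⟨p, IsBigO.trans (IsBigO.of_bound C ?_) (isBigO_pow_succ_halfPow n)⟩
  filter_upwards [nhdsWithin_le_nhds (Metric.ball_mem_nhds (0 : ℂ) hδ)] with z hz
  rw [Real.norm_of_nonneg (by positivity)]
  exact h z (by simpa using hz)

namespace HasConeExpansion

variable {n : ℕ} {G H : ℂ → ℂ}

/-- Taylor expansion of the coefficients turns (z log z)ʲ gⱼ into terms z^{i+j} logʲ z. This is
where the restriction of the logarithmic power by the power of z comes from. -/
theorem hasPolyLogExpansion (hG : HasConeExpansion n G) : HasPolyLogExpansion n G := by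
  obtain ⟨J, g, hg, hO⟩ := hG
  refine HasPolyLogExpansion.of_isBigO ?_ hO
  refine HasPolyLogExpansion.sum _ fun j _ => ?_
  obtain ⟨p, hp⟩ := isBigO_sub_taylor (hg j) n
  refine HasPolyLogExpansion.of_isBigO (G := fun z => ∑ i ∈ Finset.range (n + 1),
    p i * (z ^ (i + j) * log z ^ j)) (HasPolyLogExpansion.sum _ fun i _ =>
      HasPolyLogExpansion.monomial _ (Nat.le_add_left j i)) ?_
  have := (isBigO_mul_log_pow_one j).mul hp
  simp only [one_mul] at this
  refine this.congr_left fun z => ?_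
  rw [mul_sub, Finset.mul_sum]
  congr 1
  refine Finset.sum_congr rfl fun i _ => ?_
  ring

theorem mul_analytic (hG : HasConeExpansion n G) {f : ℂ → ℂ} (hf : AnalyticAt ℂ f 0) :
    HasConeExpansion n fun z => f z * G z := by
  obtain ⟨J, g, hg, hO⟩ := hG
  refine ⟨J, fun j z => f z * g j z, fun j => hf.mul (hg j), ?_⟩
  have h1 : f =O[𝓝[imagCone] 0] fun _ => (1 : ℝ) :=
    (hf.continuousAt.tendsto.isBigO_one ℝ).mono nhdsWithin_le_nhds
  have := h1.mul hO
  simp only [one_mul] at this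
  refine this.congr_left fun z => ?_
  rw [mul_sub, Finset.mul_sum]
  congr 1
  refine Finset.sum_congr rfl fun i _ => ?_
  ring

theorem add (hG : HasConeExpansion n G) (hH : HasConeExpansion n H) :
    HasConeExpansion n fun z => G z + H z := by
  obtain ⟨J, g, hg, hO⟩ := hG
  obtain ⟨K, h, hh, hP⟩ := hH
  refine ⟨max J K, fun j z => (if j < J then g j z else 0) + (if j < K then h j z else 0),
    fun j => ?_, (hO.add hP).congr_left fun z => ?_⟩
  · refine AnalyticAt.add ?_ ?_
    · split_ifs
      exacts [hg j, analyticAt_const]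
    · split_ifs
      exacts [hh j, analyticAt_const]
  · have key : ∀ (N m : ℕ) (q : ℕ → ℂ), N ≤ m → ∑ j ∈ Finset.range m, (z * log z) ^ j *
        (if j < N then q j else 0) = ∑ j ∈ Finset.range N, (z * log z) ^ j * q j := by
      intro N m q hNm
      simp only [mul_ite, mul_zero]
      rw [← Finset.sum_filter]
      congr 1
      ext j
      simp only [Finset.mem_filter, Finset.mem_range]
      omega
    simp only [mul_add, Finset.sum_add_distrib]
    rw [key J _ (fun j => g j z) (le_max_left _ _), key K _ (fun j => h j z) (le_max_right _ _)]
    ring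

end HasConeExpansion

theorem logSize_pow_isBigO {A : ℝ} (hA : 0 < A) (n : ℕ) :
    (fun z : ℂ => logSize (A * z) ^ (n + 1)) =O[𝓝[imagCone] 0] halfPow n := by
  refine IsBigO.trans (IsBigO.of_bound (A ^ (n + 1)) ?_)
    (isBigO_pow_mul_of_log n (20 + |Real.log A|) (n + 1))
  filter_upwards [self_mem_nhdsWithin] with z hz
  have h0 : 0 < ‖z‖ := norm_pos_iff.2 (imagCone_ne_zero hz)
  rw [Real.norm_of_nonneg (pow_nonneg (logSize_nonneg _) _), Real.norm_of_nonneg (by positivity),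
    ← mul_pow, ← mul_pow]
  refine pow_le_pow_left₀ (logSize_nonneg _) ?_ _
  rw [logSize, norm_mul, norm_real, Real.norm_of_nonneg hA.le, mul_assoc,
    Real.log_mul hA.ne' h0.ne']
  have := abs_add_le (Real.log A) (Real.log ‖z‖)
  gcongr A * (‖z‖ * ?_)
  linarith

/-- An expansion on log-rectangles gives an expansion on the cone. -/
theorem HasLogExpansion.hasConeExpansion {M R : ℝ} (hM : 0 < M) (hR : 1000 * M ≤ R) {n : ℕ}
    {Φ : ℂ → ℂ → ℂ} (hΦ : HasLogExpansion (Real.log R : ℝ) (n + 1) Φ) :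
    HasConeExpansion n fun z => Φ (2 * M * z) (log z + (Real.log R : ℝ)) := by
  obtain ⟨F, ⟨J, f, hf, hF⟩, C, δ, hC, hδ, hb⟩ := hΦ
  have hR0 : 0 < R := by linarith
  -- At the radius `R` one has t = log z + log R, hence x = Rz, y = 2M/R independent of z, and, with
  -- c = log R, a(t - c) = 2M z log z.
  have hexp : ∀ z : ℂ, z ≠ 0 → cexp (log z + (Real.log R : ℝ)) = R * z := fun z hz => by
    rw [Complex.exp_add, exp_log hz, ← ofReal_exp, Real.exp_log hR0, mul_comm]
  have hexp' : ∀ z : ℂ, z ≠ 0 → 2 * M * z * cexp (-(log z + (Real.log R : ℝ))) = 2 * M / R :=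
    fun z hz => by
      have : (R : ℂ) ≠ 0 := ofReal_ne_zero.2 hR0.ne'
      rw [Complex.exp_neg, hexp z hz]
      field_simp
  have h2M : ‖(2 * M / R : ℂ)‖ ≤ 1 / 2 := by
    have : (2 * M / R : ℂ) = ((2 * M / R : ℝ) : ℂ) := by push_cast; rfl
    rw [this, norm_real, Real.norm_of_nonneg (by positivity), div_le_div_iff₀ hR0 two_pos]
    linarith
  have h2M0 : (2 * M / R : ℂ) ≠ 0 := by
    have h1 := ofReal_ne_zero.2 hR0.ne'
    have h2 := ofReal_ne_zero.2 hM.ne'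
    simp [h1, h2]
  choose g hg hfg using fun j => (hf j).exists_differentiableOn (U := Metric.ball 0 (1 / (2 * R)))
    Metric.isOpen_ball (x := fun z => R * z) (y := fun _ => (2 * M / R : ℂ))
    (differentiableOn_id.const_mul _) (differentiableOn_const _)
    (fun z hz => by
      rw [mem_ball_zero_iff, lt_div_iff₀ (by positivity)] at hz
      rw [norm_mul, norm_real, Real.norm_of_nonneg hR0.le]
      linarith) (fun _ _ => h2M)
  refine ⟨J, fun j z => (2 * M) ^ j * g j z, fun j => ?_, ?_⟩
  · exact analyticAt_const.mul ((hg j).analyticAt (Metric.ball_mem_nhds _ (by positivity)))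
  have hO := (logSize_pow_isBigO (A := 2 * M) (by positivity) n).const_mul_left C
  refine IsBigO.trans (IsBigO.of_bound 1 ?_) hO
  have hε : 0 < min (1 / (4 * R)) (δ / (2 * M)) := by positivity
  filter_upwards [self_mem_nhdsWithin, nhdsWithin_le_nhds (Metric.ball_mem_nhds (0 : ℂ) hε)]
    with z hz hzε
  have hz0 := imagCone_ne_zero hz
  have hzn : 0 < ‖z‖ := norm_pos_iff.2 hz0
  rw [mem_ball_zero_iff, lt_min_iff, lt_div_iff₀ (by positivity), lt_div_iff₀ (by positivity)]
    at hzε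
  have ha : (2 * M * z : ℂ) ≠ 0 := by
    have h2 := ofReal_ne_zero.2 hM.ne'
    simp [hz0, h2]
  have han : ‖(2 * M * z : ℂ)‖ = 2 * M * ‖z‖ := by
    rw [norm_mul, norm_mul, norm_real, Real.norm_of_nonneg hM.le]; simp
  have ht : log z + (Real.log R : ℝ) ∈ logRectangle (2 * M * z) := by
    have hre : (log z + (Real.log R : ℝ)).re = Real.log (‖z‖ * R) := by
      rw [add_re, log_re, ofReal_re, Real.log_mul hzn.ne' hR0.ne']
    refine ⟨?_, ?_, ?_⟩
    -- Left edge of the rectangle: 500‖a‖ = 1000 M‖z‖ ≤ R‖z‖, the reason for the constant in `hR`.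
    · rw [hre, han]
      refine Real.log_le_log (by positivity) ?_
      nlinarith
    · rw [hre]
      exact Real.log_le_log (by positivity) (by linarith)
    · rw [add_im, log_im, ofReal_im, add_zero]
      refine abs_arg_le_of_neg_abs_im_le_re hz0 ?_
      have : |z.re| < |z.im| := hz
      linarith [neg_abs_le z.re]
  have h1 := hb _ _ ha (by rw [han]; linarith) ht
  rw [hF] at h1
  have hls := logSize_nonneg (2 * M * z)
  push_cast
  rw [one_mul, Real.norm_of_nonneg (by positivity)]
  convert h1 using 3
  refine Finset.sum_congr rfl fun j _ => ?_
  rw [← hfg j z (by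
    rw [mem_ball_zero_iff, lt_div_iff₀ (by positivity)]; linarith)
    (mul_ne_zero (ofReal_ne_zero.2 hR0.ne') hz0) h2M0, hexp z hz0, hexp' z hz0]
  ring

end Expansion

/-! ### Smoothness at the vertex of a cone from flatness -/

/-- The double cone of aperture `c` around the real axis. -/
def realCone (c : ℝ) : Set ℂ := {w | |w.im| < c * |w.re|}

theorem isOpen_realCone (c : ℝ) : IsOpen (realCone c) :=
  isOpen_lt (f := fun w : ℂ => |w.im|) (g := fun w : ℂ => c * |w.re|)
    (by fun_prop) (by fun_prop)

theorem ofReal_mem_realCone {c ω : ℝ} (hc : 0 < c) (hω : ω ≠ 0) : (ω : ℂ) ∈ realCone c := by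
  have := abs_pos.2 hω
  change |(ω : ℂ).im| < c * |(ω : ℂ).re|
  rw [ofReal_im, ofReal_re, abs_zero]
  positivity

theorem realCone_ne_zero {c : ℝ} {w : ℂ} (hw : w ∈ realCone c) : w ≠ 0 := by
  rintro rfl
  simp [realCone] at hw

/-- Halving the aperture leaves room for discs of radius comparable with ‖w‖, so a Cauchy estimate
costs just one power of ‖w‖. -/
theorem closedBall_subset_realCone {c : ℝ} (hc : 0 < c) (hc1 : c ≤ 1) {w : ℂ}
    (hw : w ∈ realCone (c / 2)) : Metric.closedBall w (c / 16 * ‖w‖) ⊆ realCone c := by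
  intro v hv
  rw [mem_closedBall_iff_norm] at hv
  have h1 : |w.im| < c / 2 * |w.re| := hw
  have h2 := norm_le_abs_re_add_abs_im w
  have h3 := (abs_re_le_norm (v - w)).trans hv
  have h4 := (abs_im_le_norm (v - w)).trans hv
  rw [sub_re] at h3
  rw [sub_im] at h4
  have h5 : |v.im| ≤ |w.im| + |v.im - w.im| := by
    have := abs_add_le w.im (v.im - w.im); rwa [add_sub_cancel] at this
  have h6 : |w.re| ≤ |v.re| + |v.re - w.re| := by
    have := abs_add_le v.re (w.re - v.re)
    rwa [add_sub_cancel, abs_sub_comm] at this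
  change |v.im| < c * |v.re|
  have h7 : ‖w‖ ≤ 3 / 2 * |w.re| := by nlinarith [abs_nonneg w.re]
  have h8 : c / 16 * ‖w‖ ≤ c / 16 * (3 / 2 * |w.re|) := by gcongr
  have h9 : 0 < |w.re| := by
    by_contra h
    have : |w.re| = 0 := le_antisymm (not_lt.1 h) (abs_nonneg _)
    rw [this] at h1
    linarith [abs_nonneg w.im]
  have h10 : c * |w.re| ≤ c * |v.re| + c * (c / 16 * (3 / 2 * |w.re|)) := by
    rw [← mul_add]; gcongr; linarith
  have h11 : c * (c / 16 * (3 / 2 * |w.re|)) ≤ 1 * (c / 16 * (3 / 2 * |w.re|)) := by gcongr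
  nlinarith [mul_pos hc h9]

theorem norm_deriv_le_of_flat {c : ℝ} (hc : 0 < c) (hc1 : c ≤ 1) {n : ℕ} {f : ℂ → ℂ} {C δ : ℝ}
    (hC : 0 ≤ C) (hf : DifferentiableOn ℂ f (realCone c))
    (hb : ∀ w ∈ realCone c, ‖w‖ < δ → ‖f w‖ ≤ C * (‖w‖ ^ (n + 1) * √‖w‖)) {w : ℂ}
    (hw : w ∈ realCone (c / 2)) (hwδ : ‖w‖ < δ / 2) :
    ‖deriv f w‖ ≤ C * 2 ^ (n + 1) * √2 * (16 / c) * (‖w‖ ^ n * √‖w‖) := by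
  have hw0 : 0 < ‖w‖ := norm_pos_iff.2 (realCone_ne_zero hw)
  have hsub := closedBall_subset_realCone hc hc1 hw
  have hr : 0 < c / 16 * ‖w‖ := by positivity
  have hd : DiffContOnCl ℂ f (Metric.ball w (c / 16 * ‖w‖)) := by
    refine DifferentiableOn.diffContOnCl ?_
    rw [closure_ball w hr.ne']
    exact hf.mono hsub
  refine (Complex.norm_deriv_le_of_forall_mem_sphere_norm_le hr hd
    (C := C * ((2 * ‖w‖) ^ (n + 1) * √(2 * ‖w‖))) fun v hv => ?_).trans_eq ?_
  · have hv' := Metric.sphere_subset_closedBall hv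
    have h1 : ‖v‖ ≤ 2 * ‖w‖ := by
      rw [mem_closedBall_iff_norm] at hv'
      have := norm_sub_norm_le v w
      nlinarith
    refine (hb v (hsub hv') (by linarith)).trans ?_
    gcongr
  · rw [Real.sqrt_mul two_pos.le]
    field_simp
    rw [mul_pow]
    ring

/-- A holomorphic function on a double cone which is `O(|w|^(n+1/2))` at the vertex
is `n` times continuously differentiable on the axis. -/
theorem contDiff_of_flat {n : ℕ} : ∀ {f : ℂ → ℂ} {c : ℝ}, 0 < c → c ≤ 1 →
    DifferentiableOn ℂ f (realCone c) → (∃ C δ : ℝ, 0 ≤ C ∧ 0 < δ ∧ ∀ w ∈ realCone c, ‖w‖ < δ →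
      ‖f w‖ ≤ C * (‖w‖ ^ n * √‖w‖)) →
    ContDiff ℝ n fun ω : ℝ => if ω = 0 then 0 else f ω := by
  have hbound : ∀ {n : ℕ} {f : ℂ → ℂ} {c C δ : ℝ}, 0 < c → 0 ≤ C → 0 < δ →
      (∀ w ∈ realCone c, ‖w‖ < δ → ‖f w‖ ≤ C * (‖w‖ ^ n * √‖w‖)) →
      ∀ᶠ ω : ℝ in 𝓝 0, ‖if ω = 0 then 0 else f ω‖ ≤ C * (|ω| ^ n * √|ω|) :=
    fun {n f c C δ} hc hC hδ hb => by
      filter_upwards [Metric.ball_mem_nhds (0 : ℝ) hδ] with ω hω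
      split_ifs with h0
      · rw [norm_zero]; positivity
      · have := hb ω (ofReal_mem_realCone hc h0) (by simpa using hω)
        rwa [norm_real, Real.norm_eq_abs] at this
  have hne : ∀ {f : ℂ → ℂ} {ω : ℝ}, ω ≠ 0 →
      (fun ω : ℝ => if ω = 0 then 0 else f ω) =ᶠ[𝓝 ω] fun ω : ℝ => f ω := fun {f ω} h0 => by
    filter_upwards [isOpen_ne.mem_nhds h0] with v hv
    rw [if_neg hv]
  have hat : ∀ {f : ℂ → ℂ} {c : ℝ}, 0 < c → DifferentiableOn ℂ f (realCone c) → ∀ {ω : ℝ},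
      ω ≠ 0 → HasDerivAt (fun ω : ℝ => if ω = 0 then 0 else f ω) (deriv f ω) ω :=
    fun {f c} hc hf {ω} h0 => by
      have h1 : HasDerivAt f (deriv f ω) ω := (hf.differentiableAt
        ((isOpen_realCone c).mem_nhds (ofReal_mem_realCone hc h0))).hasDerivAt
      exact h1.comp_ofReal.congr_of_eventuallyEq (hne h0)
  induction n with
  | zero =>
    intro f c hc hc1 hf ⟨C, δ, hC, hδ, hb⟩
    rw [Nat.cast_zero, contDiff_zero, continuous_iff_continuousAt]
    intro ω
    by_cases h0 : ω = 0
    · subst h0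
      have h1 : Tendsto (fun ω : ℝ => C * (|ω| ^ 0 * √|ω|)) (𝓝 0) (𝓝 0) := by
        have : Continuous fun ω : ℝ => C * (|ω| ^ 0 * √|ω|) := by fun_prop
        simpa using this.tendsto 0
      rw [ContinuousAt, if_pos rfl]
      exact squeeze_zero_norm' (hbound hc hC hδ hb) h1
    · exact (hat hc hf h0).continuousAt
  | succ n ih =>
    intro f c hc hc1 hf ⟨C, δ, hC, hδ, hb⟩
    have hd : ∀ ω : ℝ, HasDerivAt (fun ω : ℝ => if ω = 0 then 0 else f ω)
        (if ω = 0 then 0 else deriv f ω) ω := fun ω => by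
      by_cases h0 : ω = 0
      · subst h0
        rw [if_pos rfl, hasDerivAt_iff_isLittleO_nhds_zero]
        simp only [zero_add, if_true, sub_zero, smul_zero]
        have h1 : (fun ω : ℝ => |ω| ^ (n + 1) * √|ω|) =o[𝓝 0] fun ω : ℝ => ω := by
          have h2 : (fun ω : ℝ => |ω| ^ n * √|ω|) =o[𝓝 0] fun _ : ℝ => (1 : ℝ) := by
            rw [Asymptotics.isLittleO_one_iff]
            have : Continuous fun ω : ℝ => |ω| ^ n * √|ω| := by fun_prop
            simpa using this.tendsto 0
          have h3 := h2.mul_isBigO (Asymptotics.isBigO_refl (fun ω : ℝ => |ω|) (𝓝 0))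
          simp only [one_mul] at h3
          exact (h3.congr_left fun ω => by ring).trans_isBigO
            (Asymptotics.isBigO_refl _ _).abs_left
        refine Asymptotics.IsBigO.trans_isLittleO (Asymptotics.IsBigO.of_bound C ?_) h1
        filter_upwards [hbound hc hC hδ hb] with ω hω
        rwa [Real.norm_of_nonneg (by positivity)]
      · rw [if_neg h0]
        exact hat hc hf h0
    rw [Nat.cast_add, Nat.cast_one, contDiff_succ_iff_deriv]
    refine ⟨fun ω => (hd ω).differentiableAt, by simp, ?_⟩
    rw [funext fun ω => (hd ω).deriv]
    have hsub : realCone (c / 2) ⊆ realCone c := fun w hw =>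
      closedBall_subset_realCone hc hc1 hw (Metric.mem_closedBall_self (by positivity))
    -- The derivative satisfies the same hypotheses with one power less, on the cone of half the
    -- aperture.
    refine ih (c := c / 2) (by positivity) (by linarith)
      ((hf.deriv (isOpen_realCone c)).mono hsub)
      ⟨C * 2 ^ (n + 1) * √2 * (16 / c), δ / 2, by positivity, by positivity,
        fun w hw hwδ => norm_deriv_le_of_flat hc hc1 hC hf hb hw hwδ⟩

/-! ### The Jost solution in terms of the amplitude, and its continuation in the frequency -/

section Jost

variable {M : ℝ} (hM : 0 < M)
include hM

/-- The amplitude along the imaginary axis solves the radial equation. -/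
theorem isSolutionOn_jostAmplitude {ω : ℝ} (hω : ω ≠ 0) :
    IsSolutionOn (fun u => -(ω : ℂ) ^ 2 + potential M 0 u) (reggeWheeler M (100 * M))
      (fun u => cexp (-I * ω * u) * jostAmplitude (2 * I * ω * radius M u) (2 * M * (2 * I * ω)))
      (fun u => cexp (-I * ω * u) *
        (-I * ω * jostAmplitude (2 * I * ω * radius M u) (2 * M * (2 * I * ω))
          + 2 * I * ω * jostAmplitudeDeriv (2 * I * ω * radius M u) (2 * M * (2 * I * ω)))) := by
  intro u hu
  have hω' : (ω : ℂ) ≠ 0 := ofReal_ne_zero.2 hω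
  have hr : 100 * M < radius M u := by
    rw [← radius_reggeWheeler hM (by linarith : 2 * M < 100 * M)]
    exact strictMono_radius hM hu
  have hr0 : (radius M u : ℂ) ≠ 0 := ofReal_ne_zero.2 (radius_pos hM u).ne'
  have hr2 : (radius M u : ℂ) - 2 * M ≠ 0 := by
    have : ((radius M u - 2 * M : ℝ) : ℂ) ≠ 0 := ofReal_ne_zero.2 (by linarith)
    simpa using this
  set a : ℂ := 2 * M * (2 * I * ω) with ha
  have hD : (2 * I * ω * radius M u, a) ∈ volterraDomain := by
    change 100 * ‖a‖ < tailSize _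
    have h1 : ‖a‖ = 4 * M * |ω| := by
      rw [ha]; simp [abs_of_pos hM]; ring
    have h2 : tailSize (2 * I * ω * radius M u) = 4 * |ω| * radius M u := by
      simp [tailSize, abs_mul, abs_of_pos (radius_pos hM u)]; ring
    rw [h1, h2]
    have := abs_pos.2 hω
    nlinarith
  have hx : HasDerivAt (fun u : ℝ => 2 * I * ω * (radius M u : ℂ))
      (2 * I * ω * ((1 - 2 * M / radius M u : ℝ) : ℂ)) u :=
    (hasDerivAt_radius hM u).ofReal_comp.const_mul _
  have he : HasDerivAt (fun u : ℝ => cexp (-I * ω * u)) (cexp (-I * ω * u) * (-I * ω)) u := by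
    have h0 : HasDerivAt (fun u : ℝ => -I * ω * (u : ℂ)) (-I * ω) u := by
      simpa using (hasDerivAt_id (u : ℝ)).ofReal_comp.const_mul (-I * (ω : ℂ))
    exact h0.cexp
  have hψ := (hasDerivAt_jostAmplitude hD).comp u hx
  have hχ := (hasDerivAt_jostAmplitudeDeriv hD).comp u hx
  simp only [Function.comp_def] at hψ hχ
  have hxa : 2 * I * ω * radius M u - a = 2 * I * ω * (radius M u - 2 * M) := by rw [ha]; ring
  have hI := I_ne_zero
  constructor
  · refine (he.mul hψ).congr_deriv ?_
    rw [hxa]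
    push_cast
    field_simp
  · refine (he.mul ((hψ.const_mul (-I * ω)).add (hχ.const_mul (2 * I * ω)))).congr_deriv ?_
    simp only [Pi.add_apply]
    rw [hxa, ha, potential_zero]
    generalize jostAmplitude (2 * I * ω * radius M u) (2 * M * (2 * I * ω)) = p
    generalize jostAmplitudeDeriv (2 * I * ω * radius M u) (2 * M * (2 * I * ω)) = q
    push_cast
    field_simp
    linear_combination ((radius M u : ℂ) ^ 4 * ω ^ 2 * p) * I_sq

theorem tendsto_jostAmplitude {ω : ℝ} (hω : ω ≠ 0) :
    Tendsto (fun u => jostAmplitude (2 * I * ω * radius M u) (2 * M * (2 * I * ω))) atTop (𝓝 1) ∧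
      Tendsto (fun u => jostAmplitudeDeriv (2 * I * ω * radius M u) (2 * M * (2 * I * ω)))
        atTop (𝓝 0) := by
  set a : ℂ := 2 * M * (2 * I * ω) with ha
  have hω0 := abs_pos.2 hω
  have hsize : ∀ u, tailSize (2 * I * ω * radius M u) = 4 * |ω| * radius M u := fun u => by
    simp [tailSize, abs_mul, abs_of_pos (radius_pos hM u)]; ring
  have hlim : Tendsto (fun u => tailSize (2 * I * ω * radius M u)) atTop atTop := by
    simp only [hsize]
    exact (tendsto_radius hM).const_mul_atTop (by positivity)
  have hD : ∀ᶠ u in atTop, (2 * I * ω * radius M u, a) ∈ volterraDomain :=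
    hlim.eventually_gt_atTop (100 * ‖a‖)
  constructor
  · rw [tendsto_iff_norm_sub_tendsto_zero]
    refine squeeze_zero' (Eventually.of_forall fun _ => norm_nonneg _)
      (hD.mono fun u hu => norm_jostAmplitude_sub_one_le hu) ?_
    exact hlim.const_div_atTop _
  · rw [tendsto_zero_iff_norm_tendsto_zero]
    refine squeeze_zero' (Eventually.of_forall fun _ => norm_nonneg _)
      (hD.mono fun u hu => norm_jostAmplitudeDeriv_le hu) ?_
    exact hlim.const_div_atTop _

/-- The Jost solution and its derivative at large radius, in terms of the amplitude. -/
theorem jostSolution_eq_jostAmplitude {ω : ℝ} (hω : ω ≠ 0) {u : ℝ}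
    (hu : reggeWheeler M (100 * M) < u) :
    jostSolution (potential M 0) ω u =
        cexp (-I * ω * u) * jostAmplitude (2 * I * ω * radius M u) (2 * M * (2 * I * ω)) ∧
      ∑' k, jostIterateDeriv (potential M 0) ω k u = cexp (-I * ω * u) *
        (-I * ω * jostAmplitude (2 * I * ω * radius M u) (2 * M * (2 * I * ω))
          + 2 * I * ω * jostAmplitudeDeriv (2 * I * ω * radius M u) (2 * M * (2 * I * ω))) := by
  have hV := isTailPotential_potential hM
  have hB : ∃ B, ∀ u, potential M 0 u ≤ B := ⟨_, potential_zero_le hM⟩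
  have hJ := hV.isJostSolution hω hB
  have hd := hV.hasDerivAt_jostSolution hω
  have hexp : ∀ u : ℝ, cexp (I * ω * u) * cexp (-I * ω * u) = 1 := fun u => by
    rw [← Complex.exp_add]; simp
  obtain ⟨hψ, hχ⟩ := tendsto_jostAmplitude hM hω
  refine IsSolutionOn.jost_unique hω (fun u _ => ⟨hd u, hV.hasDerivAt_tsum_jostIterateDeriv hω hB u⟩)
    (isSolutionOn_jostAmplitude hM hω) hJ.tendsto_one ?_ ?_ ?_ hu
  · have h1 := hJ.tendsto_deriv_zero.sub (hJ.tendsto_one.const_mul (I * (ω : ℂ)))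
    rw [mul_one, zero_sub, ← neg_mul] at h1
    refine h1.congr fun u => ?_
    have h0 : HasDerivAt (fun u : ℝ => I * ω * (u : ℂ)) (I * ω) u := by
      simpa using (hasDerivAt_id (u : ℝ)).ofReal_comp.const_mul (I * (ω : ℂ))
    have h2 := (h0.cexp.mul (hd u)).deriv
    simp only [Pi.mul_def] at h2
    rw [h2]
    ring
  · refine hψ.congr fun u => ?_
    rw [← mul_assoc (cexp _), hexp, one_mul]
  · have h1 := (hψ.const_mul (-I * (ω : ℂ))).add (hχ.const_mul (2 * I * (ω : ℂ)))
    rw [mul_one, mul_zero, add_zero] at h1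
    refine h1.congr fun u => ?_
    rw [← mul_assoc (cexp _), hexp, one_mul]

end Jost

/-- The derivative at `u` of the Jost solution, continued to complex `z = 2iω` by transport from
the radius `R`. -/
noncomputable def jostDerivContinuation (M R u : ℝ) (z : ℂ) : ℂ :=
  let w := -I * z / 2
  let v := reggeWheeler M R
  cexp (-z / 2 * v) * (-z / 2 * cosineSolution (potential M 0) u w v
      - cosineSolutionDeriv (potential M 0) u w v) * jostAmplitude (R * z) (2 * M * z) +
    cexp (-z / 2 * v) * cosineSolution (potential M 0) u w v / R *
      (R * z * jostAmplitudeDeriv (R * z) (2 * M * z))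

section Continuation

variable {M : ℝ} (hM : 0 < M)
include hM

/-- Transport by `solution_deriv_eq` from the point of radius `R`, where the amplitude represents
the Jost data. The factor R/R in `jostDerivContinuation` produces x times `jostAmplitudeDeriv`, the
quantity that has a log expansion. -/
theorem deriv_jostSolution_eq_continuation {R : ℝ} (hR : 1000 * M ≤ R) (u : ℝ) {ω : ℝ}
    (hω : ω ≠ 0) : deriv (jostSolution (potential M 0) ω) u
      = jostDerivContinuation M R u (2 * I * ω) := by
  have hV := isTailPotential_potential hM
  have hB : ∃ B, ∀ u, potential M 0 u ≤ B := ⟨_, potential_zero_le hM⟩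
  have hd := hV.hasDerivAt_jostSolution hω
  have hlt : reggeWheeler M (100 * M) < reggeWheeler M R :=
    strictMonoOn_reggeWheeler hM (Set.mem_Ioi.2 (by linarith)) (Set.mem_Ioi.2 (by linarith))
      (by linarith)
  obtain ⟨h1, h2⟩ := jostSolution_eq_jostAmplitude hM hω hlt
  rw [radius_reggeWheeler hM (by linarith)] at h1 h2
  have hR0 : (R : ℂ) ≠ 0 := ofReal_ne_zero.2 (by linarith)
  have h3 := solution_deriv_eq (u := u) (w := ω) (f := jostSolution (potential M 0) ω) hV.continuous
    (fun v => ⟨hd v, (hV.hasDerivAt_tsum_jostIterateDeriv hω hB v).congr_deriv (by ring)⟩)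
    (reggeWheeler M R)
  have hw : -I * (2 * I * ω) / 2 = (ω : ℂ) := by linear_combination (-ω : ℂ) * I_sq
  have hz : -(2 * I * ω : ℂ) / 2 = -I * ω := by ring
  rw [(hd u).deriv, h3, h1, h2, jostDerivContinuation, hw, hz, mul_comm (R : ℂ)]
  field_simp
  ring

theorem imagCone_mem_volterraDomain {R : ℝ} (hR : 1000 * M ≤ R) {z : ℂ} (hz : z ∈ imagCone) :
    (R * z, 2 * M * z) ∈ volterraDomain := by
  have h1 : |z.re| < |z.im| := hz
  have hR0 : 0 < R := by linarith
  have hz0 : 0 < ‖z‖ := norm_pos_iff.2 (imagCone_ne_zero hz)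
  have h2 := norm_div_two_le_tailSize (x := R * z) (by
    rw [re_ofReal_mul, im_ofReal_mul, abs_mul, abs_of_pos hR0, ← mul_neg]
    gcongr
    linarith [neg_abs_le z.re])
  have h3 : ‖(R * z : ℂ)‖ = R * ‖z‖ := by rw [norm_mul, norm_real, Real.norm_of_nonneg hR0.le]
  have h4 : ‖(2 * M * z : ℂ)‖ = 2 * M * ‖z‖ := by
    rw [norm_mul, norm_mul, norm_real, Real.norm_of_nonneg hM.le]; simp
  change 100 * ‖(2 * M * z : ℂ)‖ < _
  rw [h3] at h2
  rw [h4]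
  nlinarith [mul_pos hM hz0]

theorem differentiable_continuation_coeff (R u : ℝ) :
    Differentiable ℂ (fun z : ℂ => cexp (-z / 2 * reggeWheeler M R) *
      (-z / 2 * cosineSolution (potential M 0) u (-I * z / 2) (reggeWheeler M R)
        - cosineSolutionDeriv (potential M 0) u (-I * z / 2) (reggeWheeler M R))) ∧
    Differentiable ℂ (fun z : ℂ => cexp (-z / 2 * reggeWheeler M R) *
      cosineSolution (potential M 0) u (-I * z / 2) (reggeWheeler M R) / R) := by
  have hV := isTailPotential_potential hM
  obtain ⟨h1, h2⟩ := differentiable_cosineSolution hV.continuous (u := u) (reggeWheeler M R)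
  have hw : Differentiable ℂ fun z : ℂ => -I * z / 2 := by fun_prop
  have h3 := h1.comp hw
  have h4 := h2.comp hw
  simp only [Function.comp_def] at h3 h4
  constructor <;> fun_prop

theorem differentiableOn_continuation {R : ℝ} (hR : 1000 * M ≤ R) (u : ℝ) :
    DifferentiableOn ℂ (jostDerivContinuation M R u) imagCone := by
  obtain ⟨h1, h2⟩ := differentiable_continuation_coeff hM R u
  have hx : DifferentiableOn ℂ (fun z : ℂ => R * z) imagCone := by fun_prop
  have ha : DifferentiableOn ℂ (fun z : ℂ => 2 * M * z) imagCone := by fun_prop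
  have hD := fun z hz => imagCone_mem_volterraDomain hM hR (z := z) hz
  have h3 := isVolterraBounded_jostAmplitude.differentiableOn _ isOpen_imagCone _ _ hx ha hD
  have h4 := differentiableOn_jostAmplitudeDeriv _ isOpen_imagCone _ _ hx ha hD
  exact (h1.differentiableOn.mul h3).add (h2.differentiableOn.mul (hx.mul h4))

theorem hasPolyLogExpansion_continuation {R : ℝ} (hR : 1000 * M ≤ R) (u : ℝ) (n : ℕ) :
    HasPolyLogExpansion n (jostDerivContinuation M R u) := by
  obtain ⟨h1, h2⟩ := differentiable_continuation_coeff hM R u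
  obtain ⟨h3, h4⟩ := hasLogExpansion_jostAmplitude (Real.log R : ℝ) (n + 1)
  have h5 := (h3.hasConeExpansion hM hR).mul_analytic (h1.analyticAt 0)
  have h6 := (h4.hasConeExpansion hM hR).mul_analytic (h2.analyticAt 0)
  refine (h5.add h6).hasPolyLogExpansion.of_isBigO ?_
  refine (Asymptotics.isBigO_zero _ _).congr' ?_ EventuallyEq.rfl
  filter_upwards [self_mem_nhdsWithin] with z hz
  have hexp : cexp (log z + (Real.log R : ℝ)) = R * z := by
    rw [Complex.exp_add, exp_log (imagCone_ne_zero hz), ← ofReal_exp, Real.exp_log (by linarith),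
      mul_comm]
  simp only [hexp, jostDerivContinuation]
  ring

/-- Expansion of the derivative of the Jost solution at zero frequency. -/
theorem exists_deriv_jostSolution_expansion (n : ℕ) (u : ℝ) :
    ∃ (c : ℕ × ℕ → ℂ) (h : ℝ → ℂ), ContDiff ℝ n h ∧ ∀ ω : ℝ, ω ≠ 0 →
      deriv (jostSolution (potential M 0) ω) u = h ω +
        ∑ p ∈ triangle n, c p * ((2 * I * ω) ^ p.1 * log (2 * I * ω) ^ p.2) := by
  set G := jostDerivContinuation M (1000 * M) u with hG
  obtain ⟨c, hc⟩ := hasPolyLogExpansion_continuation hM le_rfl u n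
  set f : ℂ → ℂ := fun z => G z - ∑ p ∈ triangle n, c p * (z ^ p.1 * log z ^ p.2) with hf
  have hfd : DifferentiableOn ℂ f imagCone := by
    refine (differentiableOn_continuation hM le_rfl u).sub (DifferentiableOn.fun_sum fun p _ => ?_)
    -- Both halves of the cone avoid the negative real axis, so the principal logarithm is
    -- holomorphic on all of it and one logarithm serves both signs of ω.
    have hlog : DifferentiableOn ℂ log imagCone := fun z hz =>
      (differentiableAt_log (imagCone_subset_slitPlane hz)).differentiableWithinAt
    exact ((differentiableOn_id.pow _).mul (hlog.pow _)).const_mul _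
  obtain ⟨C, hC, hb⟩ := hc.exists_nonneg
  obtain ⟨δ, hδ, hb⟩ := Metric.mem_nhdsWithin_iff.1 hb.bound
  have hmaps : Set.MapsTo (fun w : ℂ => 2 * I * w) (realCone 1) imagCone := fun w hw => by
    have h1 : |w.im| < 1 * |w.re| := hw
    change |(2 * I * w).re| < |(2 * I * w).im|
    simp [abs_mul] at h1 ⊢
    exact h1
  refine ⟨c, fun ω => if ω = 0 then 0 else f (2 * I * ω), ?_, fun ω hω => ?_⟩
  · refine contDiff_of_flat (f := fun w => f (2 * I * w)) one_pos le_rfl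
      (hfd.comp (by fun_prop) hmaps) ⟨C * 2 ^ n * √2, δ / 2, by positivity, by positivity,
        fun w hw hwδ => ?_⟩
    have hn : ‖2 * I * w‖ = 2 * ‖w‖ := by simp
    have h1 := hb ⟨show 2 * I * w ∈ Metric.ball 0 δ by
      rw [mem_ball_zero_iff, hn]; linarith, hmaps hw⟩
    change ‖f (2 * I * w)‖ ≤ C * ‖halfPow n (2 * I * w)‖ at h1
    rw [halfPow, hn, Real.norm_of_nonneg (by positivity), Real.sqrt_mul two_pos.le] at h1
    refine h1.trans_eq ?_
    ring
  · simp only [if_neg hω]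
    rw [deriv_jostSolution_eq_continuation hM le_rfl u hω]
    simp only [hf, hG]
    ring

end Continuation

/-- The terms with j = 0 are a polynomial in z and are split off; the rest is the slice k = 0 of the
index triples, on which `l'` occurs only to the power zero. -/
theorem sum_triangle_eq (n : ℕ) (c : ℕ × ℕ → ℂ) (z l l' : ℂ) :
    ∑ p ∈ triangle n, c p * (z ^ p.1 * l ^ p.2) =
      ∑ i ∈ Finset.range (n + 1), c (i, 0) * z ^ i +
        ∑ p ∈ expansionIndices n, z ^ p.1 * l ^ p.2.1 * l' ^ p.2.2 *
          (if p.2.2 = 0 then c (p.1, p.2.1) else 0) := by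
  rw [triangle, expansionIndices, Finset.sum_filter, Finset.sum_filter, Finset.sum_product,
    Finset.sum_product, ← Finset.sum_add_distrib]
  refine Finset.sum_congr rfl fun i _ => ?_
  rw [Finset.sum_product]
  have h1 : ∀ j ∈ Finset.range (n + 1), (∑ k ∈ Finset.range (n + 1),
      if 1 ≤ j + k ∧ j + k ≤ i then z ^ i * l ^ j * l' ^ k * (if k = 0 then c (i, j) else 0) else 0)
      = if 1 ≤ j ∧ j ≤ i then c (i, j) * (z ^ i * l ^ j) else 0 := fun j _ => by
    rw [Finset.sum_eq_single_of_mem 0 (by simp) fun k _ hk => by simp [hk]]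
    simp only [add_zero, pow_zero, mul_one, if_true]
    split_ifs <;> ring
  rw [Finset.sum_congr rfl h1, Finset.sum_range_succ', Finset.sum_range_succ']
  simp only [Nat.le_add_left, true_and, pow_zero, mul_one, zero_le, if_true]
  simp
  ring

theorem mainTheorem5 (M : ℝ) (hM : 0 < M) :
    (∀ ω : ℝ, ω ≠ 0 →
      IsJostSolution (potential M 0) ω (jostSolution (potential M 0) ω)) ∧
    ∀ n : ℕ, 3 ≤ n → ∀ u : ℝ, 0 < u →
      ∃ (h₀ : ℝ → ℂ) (h : ℕ → ℕ → ℕ → ℝ → ℂ),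
        ContDiff ℝ n h₀ ∧
        (∀ p ∈ expansionIndices n, ContDiff ℝ n (h p.1 p.2.1 p.2.2)) ∧
        ∀ ω : ℝ, ω ≠ 0 →
          deriv (jostSolution (potential M 0) ω) u =
            -I * ω * cexp (-I * ω * u) + h₀ ω +
              ∑ p ∈ expansionIndices n,
                (2 * I * ω) ^ p.1 * Complex.log (2 * I * ω) ^ p.2.1 *
                  Complex.log (-2 * I * ω) ^ p.2.2 * h p.1 p.2.1 p.2.2 ω := by
  refine ⟨fun ω hω => (isTailPotential_potential hM).isJostSolution hω
    ⟨_, potential_zero_le hM⟩, fun n _ u _ => ?_⟩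
  obtain ⟨c, h, hh, hsum⟩ := exists_deriv_jostSolution_expansion hM n u
  -- The first summand of h₀ cancels the prescribed term -iω e^{-iωu}; the flat remainder and the
  -- pure powers of 2iω are smooth and also go into h₀. The other coefficients are constants, zero
  -- for k ≠ 0.
  refine ⟨fun ω => I * ω * cexp (-I * ω * u) + h ω
      + ∑ i ∈ Finset.range (n + 1), c (i, 0) * (2 * I * ω) ^ i,
    fun i j k _ => if k = 0 then c (i, j) else 0, ?_, fun _ _ => contDiff_const, fun ω hω => ?_⟩
  · have hω : ContDiff ℝ n fun ω : ℝ => (ω : ℂ) := ofRealCLM.contDiff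
    refine ContDiff.add (ContDiff.add ?_ hh) (ContDiff.sum fun i _ => ?_)
    · exact (contDiff_const.mul hω).mul ((contDiff_const.mul hω).mul contDiff_const).cexp
    · exact contDiff_const.mul ((contDiff_const.mul hω).pow i)
  · rw [hsum ω hω, sum_triangle_eq n c _ _ (Complex.log (-2 * I * ω))]
    ring
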